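/- **Setting.** Let $(\mathbb G_\kappa)_{\kappa\in\mathbb N}$ be a family of cyclic groups of prime order $N=N_\kappa$ with generators $\mathbf G=\mathbf G_\kappa$, an injective encoding of group elements by bit strings of fixed length (for each $\kappa$), and an addition computable in time polynomial in $\kappa$ (for example the prime-order subgroup of an elliptic curve such as FourQ; a family is needed because security is asymptotic). Let $v=v_\kappa$, $k=k_\kappa$ be integers with $2<v<k$, and let $ID=ID_\kappa$ be an identity string computable in time polynomial in $\kappa$. Let $H:\{0,1\}^*\to\mathbb Z_N$ be a hash function, modelled as a random oracle. "PPT" means probabilistic polynomial time in $\kappa$, and "negligible" means $o(\kappa^{-n})$ for every $n$. **The scheme BPV-SC-FourQ-Schnorr over $\mathbb G_\kappa$.** * *Key generation.* $d,b\leftarrow\mathbb Z_N^*$ uniformly, $\mathbf D=d\times\mathbf G$, $\mathbf U=b\times\mathbf G$, $x=H(ID\|\mathbf U)\,b+d \bmod N$; $r'_0,\dots,r'_{k-1}\leftarrow\mathbb Z_N^*$ uniformly and independently, $\mathbf R'_i=r'_i\times\mathbf G$, $\Gamma=(r'_i,\mathbf R'_i)_{i<k}$. The secret key is $(x,\Gamma)$,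 the public key $(ID,\mathbf U,\mathbf D)$. * *Signing $m$.* Choose a uniformly random $S\subset\{0,\dots,k-1\}$ with $|S|=v$, put $r=\sum_{i\in S}r'_i \bmod N$, $\mathbf R=\sum_{i\in S}\mathbf R'_i$, $e=H(m\|\mathbf R)$, $s=r-ex\bmod N$; the signature is $(s,e)$. * *Verification of $(s,e)$ on $m$.* Put $\mathbf R'=e\times[H(ID\|\mathbf U)\times\mathbf U+\mathbf D]+s\times\mathbf G$ and accept iff $e=H(m\|\mathbf R')$. **Assumptions.** * *Discrete logarithm (DL).* For each PPT algorithm, the probability of finding $d$ from $d\times\mathbf G$, $d\leftarrow\mathbb Z_N^*$ uniform, is negligible. * *Affine hidden subset sum, in the discrete logarithm setting.* Let $s,\alpha_0,\dots,\alpha_{k-1}\leftarrow\mathbb Z_N^*$ be uniform, independent and secret. For each PPT algorithm that is given $s\times\mathbf G$ and as many independent samples $(b_i,c_i)$ as it asks for, where $c_i\in\mathbb Z_N$ is uniform and $b_i+s\,c_i=\sum_{j\in S_i}\alpha_j \bmod N$ for a uniformly random (hidden) set $S_i\subset\{0,\dots,k-1\}$ of size $v$, the probability of finding $s$ is negligible.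 (The public parameters $\kappa$, $N$, $\mathbf G$, a description of the group and, except in DL, $(v,k)$ are given to all algorithms.) **Theorem 2.** Under these assumptions the scheme is EU-CMA secure in the random oracle model: for each PPT adversary that is given the public parameters and the public key and has access to $H$ and to a signing oracle, the probability that it outputs $(m^*,\sigma^*)$ such that $\sigma^*$ is a valid signature on $m^*$ and $m^*$ was not submitted to the signing oracle is negligible. -/

import Mathlib

open scoped Polynomial

namespace BPVSchnorr

/-! ## A probabilistic oracle machine model with a step count

Programs manipulate finite binary trees with natural numbers (in binary) at the leaves. Every
elementary instruction is charged the bit size of what it reads and writes, so that running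
times agree, up to a polynomial, with those of probabilistic oracle Turing machines. -/

/-- The data programs work on: natural numbers and ordered pairs. -/
inductive Val : Type
  | num (n : ℕ) : Val
  | pair (a b : Val) : Val

namespace Val

/-- Bit size of a value (numbers are written in binary). -/
def size : Val → ℕ
  | num n => n.size + 1
  | pair a b => a.size + b.size + 1

/-- The number stored in a leaf (0 for a pair). -/
def toNat : Val → ℕ
  | num n => n
  | pair _ _ => 0

def fst : Val → Val
  | num _ => num 0
  | pair a _ => a

def snd : Val → Val
  | num _ => num 0
  | pair _ b => b

/-- 1 for a leaf, 0 for a pair. -/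
def isNum : Val → Val
  | num _ => num 1
  | pair _ _ => num 0

/-- Representation of a bit string as a list of 0/1 leaves. -/
def ofBits : List Bool → Val
  | [] => num 0
  | b :: l => pair (num b.toNat) (ofBits l)

/-- Reading a value as a bit string; a left inverse of `ofBits`. -/
def toBits : Val → List Bool
  | num _ => []
  | pair a b => decide (a.toNat ≠ 0) :: b.toBits

theorem toBits_ofBits (l : List Bool) : (ofBits l).toBits = l := by
  induction l with
  | nil => rfl
  | cons b l ih => cases b <;> simp [ofBits, toBits, toNat, ih]

end Val

/-- The arithmetic instructions, acting on a pair of numbers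
(`sub` is truncated, `div` and `mod` are Euclidean). -/
inductive Arith : Type
  | add | sub | mul | div | mod

def Arith.eval : Arith → ℕ → ℕ → ℕ
  | .add, a, b => a + b
  | .sub, a, b => a - b
  | .mul, a, b => a * b
  | .div, a, b => a / b
  | .mod, a, b => a % b

/-- Programs with access to oracles named by `ι`. A program maps an input value to an output
value. -/
inductive Prog (ι : Type) : Type
  /-- return the input -/
  | id : Prog ι
  /-- return a fixed value -/
  | const (v : Val) : Prog ι
  /-- first and second component -/
  | fst : Prog ι
  | snd : Prog ι
  /-- is the input a number? -/
  | isNum : Prog ι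
  /-- arithmetic on a pair of numbers -/
  | arith (o : Arith) : Prog ι
  /-- on input `n`, a uniformly random number below `n` -/
  | rand : Prog ι
  /-- send the input to an oracle and return the answer -/
  | ask (i : ι) : Prog ι
  /-- `p`, then `q` on the result of `p` -/
  | seq (p q : Prog ι) : Prog ι
  /-- run `p`, then `q`, on the same input and return the pair of the results -/
  | fork (p q : Prog ι) : Prog ι
  /-- run `c` on the input; if the result is `0` run `p` on the input, otherwise `q` -/
  | ifz (c p q : Prog ι) : Prog ι
  /-- on input `(n, x)`: run `p` on `x`, on the result, and so on, `n` times in all -/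
  | iter (p : Prog ι) : Prog ι

/-- Probabilistic computations with a state `σ` (the state of the oracles). -/
abbrev PState (σ : Type) (α : Type) : Type := StateT σ PMF α

/-- A random draw that does not touch the state. -/
noncomputable def draw {σ α : Type} (μ : PMF α) : PState σ α := fun s => μ.map fun a => (a, s)

/-- A uniformly random number below `n` (`0` if `n = 0`). -/
noncomputable def uniformBelow (n : ℕ) : PMF ℕ :=
  if h : 0 < n then
    PMF.uniformOfFinset (Finset.range n) (Finset.nonempty_range_iff.mpr h.ne')
  else PMF.pure 0

/-- `n`-fold iteration of a computation that also reports its cost; costs are added up. -/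
noncomputable def iterRun {σ : Type} (f : Val → PState σ (Val × ℕ)) :
    ℕ → Val → PState σ (Val × ℕ)
  | 0, x => pure (x, 0)
  | n + 1, x => do
      let (y, c) ← f x
      let (z, c') ← iterRun f n y
      pure (z, c + c')

/-- Cost of an elementary instruction that reads `x` and writes `y`. -/
def stepCost (x y : Val) : ℕ := x.size + y.size + 1

/-- Semantics of programs: `P.run O x` runs `P` on input `x` with oracles `O` and returns the
output together with the number of steps spent. -/
noncomputable def Prog.run {ι σ : Type} (O : ι → Val → PState σ Val) :
    Prog ι → Val → PState σ (Val × ℕ)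
  | .id, x => pure (x, stepCost x x)
  | .const v, x => pure (v, stepCost x v)
  | .fst, x => pure (x.fst, stepCost x x.fst)
  | .snd, x => pure (x.snd, stepCost x x.snd)
  | .isNum, x => pure (x.isNum, stepCost x x.isNum)
  | .arith o, x =>
      let y := Val.num (o.eval x.fst.toNat x.snd.toNat)
      pure (y, stepCost x y)
  | .rand, x => do
      let r ← draw (uniformBelow x.toNat)
      pure (.num r, stepCost x (.num r))
  | .ask i, x => do
      let y ← O i x
      pure (y, stepCost x y)
  | .seq p q, x => do
      let (y, c) ← p.run O x
      let (z, c') ← q.run O y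
      pure (z, c + c' + 1)
  | .fork p q, x => do
      let (y, c) ← p.run O x
      let (z, c') ← q.run O x
      pure (.pair y z, c + c' + 1)
  | .ifz cnd p q, x => do
      let (b, c) ← cnd.run O x
      let (z, c') ← match b with
        | .num 0 => p.run O x
        | _ => q.run O x
      pure (z, c + c' + 1)
  | .iter p, x => do
      let (y, c) ← iterRun (p.run O) x.fst.toNat x.snd
      pure (y, c + stepCost x y)

/-- Running a program without oracles. -/
noncomputable def Prog.runPlain (P : Prog Empty) (x : Val) : PMF (Val × ℕ) :=
  (fun r => r.1) <$> (P.run (σ := Unit) (fun i _ => i.elim) x).run ()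

/-- The values `out a` can be computed from the values `inp a` by one program in time polynomial
in the security parameter `κ a`. -/
def EfficientlyComputable {α : Type} (κ : α → ℕ) (inp out : α → Val) : Prop :=
  ∃ (P : Prog Empty) (p : ℕ[X]), ∀ a, ∃ c ≤ p.eval (κ a), P.runPlain (inp a) = PMF.pure (out a, c)

/-- Negligible functions of the security parameter: `κ ^ n * ε κ` tends to `0` for all `n`. -/
def Negligible (ε : ℕ → ℝ) : Prop :=
  Asymptotics.SuperpolynomialDecay Filter.atTop (fun κ : ℕ => (κ : ℝ)) ε

/-! ## Groups of prime order -/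

/-- A family, indexed by the security parameter `κ`, of cyclic groups of prime order (such as the
prime order subgroup of the points of an elliptic curve), with a generator, an injective encoding
of the group elements by bit strings of a fixed length, and an efficient addition. -/
structure GroupFamily where
  /-- the group elements (points) -/
  Pt : ℕ → Type
  [grp : ∀ κ, AddCommGroup (Pt κ)]
  /-- the order `N` -/
  N : ℕ → ℕ
  [prime : ∀ κ, Fact (N κ).Prime]
  /-- the generator -/
  G : ∀ κ, Pt κ
  addOrderOf_G : ∀ κ, addOrderOf (G κ) = N κ
  generates : ∀ κ (A : Pt κ), A ∈ AddSubgroup.zmultiples (G κ)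
  /-- length of the encoding of a group element -/
  len : ℕ → ℕ
  enc : ∀ κ, Pt κ → List Bool
  enc_injective : ∀ κ, Function.Injective (enc κ)
  enc_length : ∀ κ (A : Pt κ), (enc κ A).length = len κ
  /-- public description of the group (for a curve: base field and coefficients) -/
  desc : ℕ → Val
  add_efficient : EfficientlyComputable (α := Σ κ, Pt κ × Pt κ) (fun a => a.1)
    (fun a => .pair (.pair (.num a.1) (.pair (.num (N a.1)) (desc a.1)))
      (.pair (.ofBits (enc a.1 a.2.1)) (.ofBits (enc a.1 a.2.2))))
    (fun a => .ofBits (enc a.1 (a.2.1 + a.2.2)))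

attribute [instance] GroupFamily.grp GroupFamily.prime

namespace GroupFamily

variable (𝓖 : GroupFamily) (κ : ℕ)

/-- The encoding of a group element as a value. -/
def ptVal (A : 𝓖.Pt κ) : Val := .ofBits (𝓖.enc κ A)

/-- The public parameters `(κ, N, description)` and `G`. -/
def params : Val :=
  .pair (.pair (.num κ) (.pair (.num (𝓖.N κ)) (𝓖.desc κ))) (𝓖.ptVal κ (𝓖.G κ))

/-- Scalar multiplication by an element of `ℤ/N`. -/
def smul (x : ZMod (𝓖.N κ)) (A : 𝓖.Pt κ) : 𝓖.Pt κ := x.val • A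

end GroupFamily

/-! ## The BPV generator -/

/-- BPV parameters: `k` precomputed pairs, `v` of which are added up, `2 < v < k`. -/
structure BPVParams where
  v : ℕ → ℕ
  k : ℕ → ℕ
  two_lt : ∀ κ, 2 < v κ
  lt : ∀ κ, v κ < k κ

/-- The public value `(v, k)`. -/
def BPVParams.toVal (B : BPVParams) (κ : ℕ) : Val := .pair (.num (B.v κ)) (.num (B.k κ))

/-- A uniformly random nonzero residue modulo a prime. -/
noncomputable def randUnit (N : ℕ) [Fact N.Prime] : PMF (ZMod N) :=
  (PMF.uniformOfFintype (ZMod N)ˣ).map fun u => (u : ZMod N)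

/-- The secret residues `r'_0, …, r'_{k-1}`, independent and uniform in `(ℤ/N)ˣ`. -/
noncomputable def randTable (N k : ℕ) [Fact N.Prime] : PMF (Fin k → ZMod N) :=
  (PMF.uniformOfFintype (Fin k → (ZMod N)ˣ)).map fun u i => (u i : ZMod N)

/-- A uniformly random set of `v κ` indices below `k κ`. -/
noncomputable def BPVParams.randSubset (B : BPVParams) (κ : ℕ) : PMF (Finset (Fin (B.k κ))) :=
  PMF.uniformOfFinset (Finset.powersetCard (B.v κ) Finset.univ)
    (Finset.powersetCard_nonempty.mpr (by simpa using (B.lt κ).le))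

/-- The precomputation table `Γ`: pairs `(r'_i, R'_i)` with `R'_i = r'_i × G`. -/
noncomputable def bpvOffline (𝓖 : GroupFamily) (B : BPVParams) (κ : ℕ) :
    PMF (Fin (B.k κ) → ZMod (𝓖.N κ) × 𝓖.Pt κ) :=
  (randTable (𝓖.N κ) (B.k κ)).map fun r i => (r i, 𝓖.smul κ (r i) (𝓖.G κ))

/-- `(r, R)`: the sums of `r'_i` and of `R'_i` over a random `v`-element set of indices. -/
noncomputable def bpvOnline (𝓖 : GroupFamily) (B : BPVParams) (κ : ℕ)
    (Γ : Fin (B.k κ) → ZMod (𝓖.N κ) × 𝓖.Pt κ) : PMF (ZMod (𝓖.N κ) × 𝓖.Pt κ) :=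
  (B.randSubset κ).map fun S => (∑ i ∈ S, (Γ i).1, ∑ i ∈ S, (Γ i).2)

/-! ## Signature schemes in the random oracle model -/

/-- The part of a random function `{0,1}* → ℤ/N` that has been sampled so far. -/
abbrev HashTable (N : ℕ) : Type := List (List Bool × ZMod N)

/-- The value at `w`, if it has been sampled. -/
def HashTable.get? {N : ℕ} (T : HashTable N) (w : List Bool) : Option (ZMod N) := T.lookup w

/-- Computations with access to the random oracle. -/
abbrev ROM (N : ℕ) (α : Type) : Type := PState (HashTable N) α

/-- The random oracle `H : {0,1}* → ℤ/N`, sampled lazily: a new query gets a fresh uniform answer,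
a repeated one the old answer. -/
noncomputable def romHash {N : ℕ} [Fact N.Prime] (w : List Bool) : ROM N (ZMod N) := do
  let T ← get
  match T.get? w with
  | some h => pure h
  | none => do
      let h ← draw (PMF.uniformOfFintype (ZMod N))
      set (((w, h) :: T : HashTable N))
      pure h

/-- A signature scheme `(Kg, Sig, Ver)` on bit strings in the random oracle model (at one value of
the security parameter), with the representations by which an adversary sees it. -/
structure SigScheme (N : ℕ) where
  SK : Type
  PK : Type
  Sgn : Type
  kg : ROM N (SK × PK)
  sig : SK → List Bool → ROM N Sgn
  ver : List Bool → Sgn → PK → ROM N Bool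
  pkVal : PK → Val
  sgnVal : Sgn → Val
  readSgn : Val → Sgn

/-- The oracles of a chosen message attacker in the random oracle model. -/
inductive CMAOracle : Type
  | hash
  | sign

/-- Their implementation; the state consists of the random oracle table and of the list of the
messages that have been submitted for signature. -/
noncomputable def cmaOracles {N : ℕ} [Fact N.Prime] (Sch : SigScheme N) (sk : Sch.SK) :
    CMAOracle → Val → PState (HashTable N × List (List Bool)) Val
  | .hash, x => fun (T, Q) =>
      ((romHash x.toBits).run T).map fun (h, T') => (.num h.val, (T', Q))
  | .sign, x => fun (T, Q) =>
      ((Sch.sig sk x.toBits).run T).map fun (s, T') => (Sch.sgnVal s, (T', x.toBits :: Q))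

/-- The EU-CMA experiment, against the program `A` run for at most `t` steps. The adversary is given
`pub` and the public key and outputs `(m*, σ*)`; the result is `true` iff it stops in time, `σ*` is
a valid signature of `m*`, and `m*` was not submitted to the signing oracle. -/
noncomputable def euCMA {N : ℕ} [Fact N.Prime] (Sch : SigScheme N) (pub : Val)
    (A : Prog CMAOracle) (t : ℕ) : PMF Bool := do
  let ((sk, pk), T₀) ← Sch.kg.run []
  let ((out, c), (T, Q)) ← (A.run (cmaOracles Sch sk) (.pair pub (Sch.pkVal pk))).run (T₀, [])
  let m := out.fst.toBits
  let (ok, _) ← (Sch.ver m (Sch.readSgn out.snd) pk).run T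
  pure (ok && decide (m ∉ Q) && decide (c ≤ t))

/-- EU-CMA security: each probabilistic polynomial time adversary (a program `A` with a polynomial
time bound `p`) has negligible advantage. -/
def EUCMASecure {N : ℕ → ℕ} [∀ κ, Fact (N κ).Prime] (Sch : ∀ κ, SigScheme (N κ))
    (pub : ℕ → Val) : Prop :=
  ∀ (A : Prog CMAOracle) (p : ℕ[X]),
    Negligible fun κ => (euCMA (Sch κ) (pub κ) A (p.eval κ) true).toReal

/-! ## The Schnorr scheme with self-certified keys and BPV nonces -/

section Scheme

variable (𝓖 : GroupFamily) (B : BPVParams) (ID : List Bool) (κ : ℕ)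

/-- The hash input `w || A`. -/
def cat (w : List Bool) (A : 𝓖.Pt κ) : List Bool := w ++ 𝓖.enc κ A

/-- Signing key: the self-certified private key `x` and the table `Γ`. -/
abbrev SchnorrSK : Type := ZMod (𝓖.N κ) × (Fin (B.k κ) → ZMod (𝓖.N κ) × 𝓖.Pt κ)

/-- Public key: the user's `U` and the system wide `D` (and the identity `ID`). -/
abbrev SchnorrPK : Type := 𝓖.Pt κ × 𝓖.Pt κ

/-- Key generation for the user `ID`. -/
noncomputable def schnorrKg : ROM (𝓖.N κ) (SchnorrSK 𝓖 B κ × SchnorrPK 𝓖 κ) := do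
  let d ← draw (randUnit (𝓖.N κ))
  let D := 𝓖.smul κ d (𝓖.G κ)
  let b ← draw (randUnit (𝓖.N κ))
  let U := 𝓖.smul κ b (𝓖.G κ)
  let h ← romHash (cat 𝓖 κ ID U)
  let x := h * b + d
  let Γ ← draw (bpvOffline 𝓖 B κ)
  pure ((x, Γ), (U, D))

/-- Signing. -/
noncomputable def schnorrSig (sk : SchnorrSK 𝓖 B κ) (m : List Bool) :
    ROM (𝓖.N κ) (ZMod (𝓖.N κ) × ZMod (𝓖.N κ)) := do
  let (r, R) ← draw (bpvOnline 𝓖 B κ sk.2)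
  let e ← romHash (cat 𝓖 κ m R)
  pure (r - e * sk.1, e)

/-- Verification. -/
noncomputable def schnorrVer (m : List Bool) (σ : ZMod (𝓖.N κ) × ZMod (𝓖.N κ))
    (pk : SchnorrPK 𝓖 κ) : ROM (𝓖.N κ) Bool := do
  let (s, e) := σ
  let (U, D) := pk
  let h ← romHash (cat 𝓖 κ ID U)
  let R := 𝓖.smul κ e (𝓖.smul κ h U + D) + 𝓖.smul κ s (𝓖.G κ)
  let e' ← romHash (cat 𝓖 κ m R)
  pure (decide (e = e'))

/-- The scheme for the user `ID`. Signatures are pairs `(s, e)`. -/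
noncomputable def bpvSchnorr : SigScheme (𝓖.N κ) where
  SK := SchnorrSK 𝓖 B κ
  PK := SchnorrPK 𝓖 κ
  Sgn := ZMod (𝓖.N κ) × ZMod (𝓖.N κ)
  kg := schnorrKg 𝓖 B ID κ
  sig := schnorrSig 𝓖 B κ
  ver := schnorrVer 𝓖 ID κ
  pkVal pk := .pair (.ofBits ID) (.pair (𝓖.ptVal κ pk.1) (𝓖.ptVal κ pk.2))
  sgnVal σ := .pair (.num σ.1.val) (.num σ.2.val)
  readSgn x := (x.fst.toNat, x.snd.toNat)

/-- What is public besides the key: the group parameters and `(v, k)`. -/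
def schnorrPub : Val := .pair (𝓖.params κ) (B.toVal κ)

end Scheme

/-! ## The two computational problems -/

/-- The discrete logarithm experiment: given `d × G`, find `d`, in at most `t` steps. -/
noncomputable def dlExpt (𝓖 : GroupFamily) (κ : ℕ) (P : Prog Empty) (t : ℕ) : PMF Bool := do
  let d ← randUnit (𝓖.N κ)
  let (out, c) ← P.runPlain (.pair (𝓖.params κ) (𝓖.ptVal κ (𝓖.smul κ d (𝓖.G κ))))
  pure (decide ((out.toNat : ZMod (𝓖.N κ)) = d) && decide (c ≤ t))

/-- Hardness of discrete logarithms for probabilistic polynomial time algorithms. -/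
def DLHard (𝓖 : GroupFamily) : Prop :=
  ∀ (P : Prog Empty) (p : ℕ[X]), Negligible fun κ => (dlExpt 𝓖 κ P (p.eval κ) true).toReal

/-- One sample of the affine hidden subset sum problem with hidden multiplier `s` and hidden
residues `α`: a pair `(b, c)` with `c` uniform and `b + s c` the sum of the `α i` over a random
`v`-element set of indices. -/
noncomputable def ahssSample (N : ℕ) [Fact N.Prime] (B : BPVParams) (κ : ℕ) (s : ZMod N)
    (α : Fin (B.k κ) → ZMod N) : PMF (ZMod N × ZMod N) := do
  let c ← PMF.uniformOfFintype (ZMod N)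
  let S ← B.randSubset κ
  pure (∑ i ∈ S, α i - s * c, c)

/-- The affine hidden subset sum experiment in the discrete logarithm setting: given `s × G` and
as many samples `(b, c)` as desired, find `s`, in at most `t` steps. The point `s × G` singles out
`s` among the pairs (multiplier, residues) that explain the samples. -/
noncomputable def ahssExpt (𝓖 : GroupFamily) (B : BPVParams) (κ : ℕ) (P : Prog Unit) (t : ℕ) :
    PMF Bool := do
  let s ← randUnit (𝓖.N κ)
  let α ← randTable (𝓖.N κ) (B.k κ)
  let O : Unit → Val → PState Unit Val := fun _ _ =>
    draw ((ahssSample (𝓖.N κ) B κ s α).map fun (b, c) => .pair (.num b.val) (.num c.val))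
  let ((out, c), _) ← (P.run O
    (.pair (.pair (𝓖.params κ) (B.toVal κ)) (𝓖.ptVal κ (𝓖.smul κ s (𝓖.G κ))))).run ()
  pure (decide ((out.toNat : ZMod (𝓖.N κ)) = s) && decide (c ≤ t))

/-- Hardness of the affine hidden subset sum problem for probabilistic polynomial time
algorithms. -/
def AHSSHard (𝓖 : GroupFamily) (B : BPVParams) : Prop :=
  ∀ (P : Prog Unit) (p : ℕ[X]), Negligible fun κ => (ahssExpt 𝓖 B κ P (p.eval κ) true).toReal

end BPVSchnorr

/-! A sample `(b, c)` of the hidden subset sum problem with multiplier `x` is a Schnorr signature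
under the secret key `x`: its nonce `b + x * c` is a sum of the hidden residues over a random
`v`-element set, and its hash value `c` is uniform. Hence an attack can be simulated from `X = x ×
G` and samples, without knowing `x`. To sign `m`, draw a sample `(b, c)`, return it, and set the
random oracle to `c` at `m || (c × X + b × G)`. The public key is made backwards: choose `b` and
`h`, put `U = b × G` and `D = X - h × U`, and set the hash of `ID || U` to `h`.

The simulation differs from the real attack in two ways. The real key is `h * b + d` with `d`
uniform and nonzero, whereas `x` itself is uniform and nonzero; this costs at most `1 / (N - 1)`
(`ex_randUnit_shift_le`). And the random oracle may already have a value at the point that a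
signature programs; each signing query meets this with probability at most the size of the table
times the largest probability of a nonce (`step_sign`, `attack_le`). The latter probability is
negligible on average, again by the hidden subset sum assumption: two samples with equal nonces and
different `c` give a linear equation for `x` (`sq_maxNonceProb_le`, `exists_collision_attack`).

Up to `1 / N`, a valid forgery in the simulation rests on an entry of the table (`winProb_le`).
Entries made by signing belong to submitted messages, so the entry comes from a hash query or is the
one at `ID || U`. In the first case the attack is repeated with the same random values up to that
query. By forking (`Tree.sq_le_fork`, `forging`), with probability at least the square of the
original one minus `1 / N` both runs forge with the same commitment and different hash values, and
`e * x + s = e' * x + s'` yields `x`. In the second case the commitment is `U`, and `h * x + s = b`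
yields `x` unless `h = 0`. The decisive event is guessed, which costs a polynomial factor
(`exists_attack`). Hardness of discrete logarithms makes `1 / N` negligible, since a logarithm can
be guessed (`exists_guess`).

The reduction has to be a program of polynomial cost. Programs are unfolded into interaction trees;
`Prog.compile` replaces oracle calls by programs that act on an encoded state, and `compile_approx`
bounds the cost of the result. The state updates are shown to be efficient by closure properties of
`EfficientlyComputable`. Distributions are compared by `Approx`, a one-sided form of coupling with
an error: only lower bounds for the success of the reduction are needed, and nothing need be known
about runs that exceed their time. -/

namespace BPVSchnorr

open scoped ENNReal Polynomial

/-! ## Expectations -/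

/-- Expectation of a nonnegative function. -/
noncomputable def ex {α : Type*} (μ : PMF α) (f : α → ℝ≥0∞) : ℝ≥0∞ := ∑' a, μ a * f a

section Ex

variable {α β : Type*} (μ : PMF α)

theorem ex_mono_support {f g : α → ℝ≥0∞} (h : ∀ a ∈ μ.support, f a ≤ g a) : ex μ f ≤ ex μ g := by
  refine ENNReal.tsum_le_tsum fun a => ?_
  by_cases ha : a ∈ μ.support
  · gcongr; exact h a ha
  · simp [(PMF.apply_eq_zero_iff μ a).2 ha]

theorem ex_mono {f g : α → ℝ≥0∞} (h : ∀ a, f a ≤ g a) : ex μ f ≤ ex μ g :=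
  ex_mono_support μ fun a _ => h a

theorem ex_const (c : ℝ≥0∞) : ex μ (fun _ => c) = c := by
  simp [ex, ENNReal.tsum_mul_right, μ.tsum_coe]

theorem ex_add (f g : α → ℝ≥0∞) : ex μ (fun a => f a + g a) = ex μ f + ex μ g := by
  simp [ex, mul_add, ENNReal.tsum_add]

theorem ex_add_const (f : α → ℝ≥0∞) (c : ℝ≥0∞) : ex μ (fun a => f a + c) = ex μ f + c := by
  rw [ex_add, ex_const]

theorem ex_mul_left (c : ℝ≥0∞) (f : α → ℝ≥0∞) : ex μ (fun a => c * f a) = c * ex μ f := by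
  simp only [ex, ← ENNReal.tsum_mul_left]
  exact tsum_congr fun a => by ring

theorem ex_mul_right (c : ℝ≥0∞) (f : α → ℝ≥0∞) : ex μ (fun a => f a * c) = ex μ f * c := by
  simp only [mul_comm _ c, ex_mul_left]

theorem ex_sum {ι : Type*} (s : Finset ι) (f : ι → α → ℝ≥0∞) :
    ex μ (fun a => ∑ i ∈ s, f i a) = ∑ i ∈ s, ex μ (f i) := by
  classical
  induction s using Finset.induction_on with
  | empty => simp [ex]
  | insert i s hi ih => simp only [Finset.sum_insert hi, ex_add, ih]

theorem ex_le_const {f : α → ℝ≥0∞} {c : ℝ≥0∞} (h : ∀ a, f a ≤ c) : ex μ f ≤ c :=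
  (ex_mono μ h).trans (ex_const μ c).le

theorem ex_eq_zero {f : α → ℝ≥0∞} (h : ∀ a ∈ μ.support, f a = 0) : ex μ f = 0 :=
  le_antisymm ((ex_mono_support μ (g := fun _ => 0) fun a ha => (h a ha).le).trans
    (ex_const μ 0).le) zero_le

@[simp] theorem ex_pure (a : α) (f : α → ℝ≥0∞) : ex (PMF.pure a) f = f a := by
  rw [ex, tsum_eq_single a (fun b hb => by simp [PMF.pure_apply, hb])]
  simp

theorem ex_bind (F : α → PMF β) (f : β → ℝ≥0∞) :
    ex (μ.bind F) f = ex μ fun a => ex (F a) f := by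
  simp only [ex, PMF.bind_apply, ← ENNReal.tsum_mul_right, ← ENNReal.tsum_mul_left]
  rw [ENNReal.tsum_comm]
  exact tsum_congr fun a => tsum_congr fun b => by ring

theorem ex_map (F : α → β) (f : β → ℝ≥0∞) : ex (μ.map F) f = ex μ fun a => f (F a) := by
  rw [PMF.map, ex_bind]; simp

theorem ex_comm (ν : PMF β) (f : α → β → ℝ≥0∞) :
    ex μ (fun a => ex ν (f a)) = ex ν fun b => ex μ fun a => f a b := by
  simp only [ex, ← ENNReal.tsum_mul_left]
  rw [ENNReal.tsum_comm]
  exact tsum_congr fun a => tsum_congr fun b => by ring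

theorem apply_eq_ex [DecidableEq α] (a : α) : μ a = ex μ fun b => if b = a then 1 else 0 := by
  rw [ex, tsum_eq_single a (fun b hb => by simp [hb])]
  simp

theorem bind_apply_eq_ex (F : α → PMF β) (b : β) : μ.bind F b = ex μ fun a => F a b := rfl

/-- The second moment dominates the square of the mean. -/
theorem sq_ex_le {f : α → ℝ≥0∞} (h : ∀ a, f a ≤ 1) : ex μ f ^ 2 ≤ ex μ fun a => f a ^ 2 := by
  set l := ex μ f with hl
  have hl1 : l ≤ 1 := ex_le_const μ h
  have hfin : l ^ 2 ≠ ∞ := (ENNReal.pow_lt_top (hl1.trans_lt ENNReal.one_lt_top)).ne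
  -- This is `(f a - l) ^ 2 ≥ 0`, to be averaged over `a`. The bound `f ≤ 1` keeps `l ^ 2` finite,
  -- so that it can be cancelled at the end.
  have key : ∀ a, 2 * l * f a ≤ f a ^ 2 + l ^ 2 := fun a => by
    have hf : f a ≠ ∞ := ((h a).trans_lt ENNReal.one_lt_top).ne
    have hl' : l ≠ ∞ := (hl1.trans_lt ENNReal.one_lt_top).ne
    lift f a to NNReal using hf with x
    lift l to NNReal using hl' with y
    norm_cast
    rw [← NNReal.coe_le_coe]
    push_cast
    nlinarith [sq_nonneg ((x : ℝ) - y)]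
  have := ex_mono μ key
  rw [ex_mul_left, ex_add_const, ← hl] at this
  have h2 : l ^ 2 + l ^ 2 ≤ ex μ (fun a => f a ^ 2) + l ^ 2 := by
    calc l ^ 2 + l ^ 2 = 2 * l * l := by ring
      _ ≤ _ := this
  exact (ENNReal.add_le_add_iff_right hfin).1 h2

/-- Indicator of a proposition. -/
noncomputable def ind (p : Prop) : ℝ≥0∞ := open Classical in if p then 1 else 0

theorem ind_le_one (p : Prop) : ind p ≤ 1 := by unfold ind; split_ifs <;> simp

theorem ind_true {p : Prop} (h : p) : ind p = 1 := if_pos h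

theorem ind_false {p : Prop} (h : ¬ p) : ind p = 0 := if_neg h

theorem ind_mono {p q : Prop} (h : p → q) : ind p ≤ ind q := by
  by_cases hp : p
  · rw [ind_true hp, ind_true (h hp)]
  · simp [ind_false hp]

theorem ind_le {p : Prop} {c : ℝ≥0∞} (h : p → 1 ≤ c) : ind p ≤ c := by
  by_cases hp : p
  · simpa [ind_true hp] using h hp
  · simp [ind_false hp]

theorem ind_or_le (p q : Prop) : ind (p ∨ q) ≤ ind p + ind q := by
  by_cases hp : p
  · simp [ind_true hp, ind_true (Or.inl hp : p ∨ q)]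
  · by_cases hq : q
    · simp [ind_true hq, ind_true (Or.inr hq : p ∨ q)]
    · simp [ind_false, hp, hq]

theorem ind_and (p q : Prop) : ind (p ∧ q) = ind p * ind q := by
  by_cases hp : p <;> by_cases hq : q <;> simp [ind, hp, hq]

theorem ex_uniformOfFintype [Fintype α] [Nonempty α] (f : α → ℝ≥0∞) :
    ex (PMF.uniformOfFintype α) f = (Fintype.card α : ℝ≥0∞)⁻¹ * ∑ a, f a := by
  simp [ex, tsum_fintype, Finset.mul_sum]

theorem ex_uniformBelow {n : ℕ} (h : 0 < n) (f : ℕ → ℝ≥0∞) :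
    ex (uniformBelow n) f = (n : ℝ≥0∞)⁻¹ * ∑ i ∈ Finset.range n, f i := by
  rw [ex, tsum_eq_sum (s := Finset.range n)]
  · rw [Finset.mul_sum]
    refine Finset.sum_congr rfl fun i hi => ?_
    rw [uniformBelow, dif_pos h, PMF.uniformOfFinset_apply_of_mem _ hi, Finset.card_range]
  · intro i hi
    rw [uniformBelow, dif_pos h, PMF.uniformOfFinset_apply_of_notMem _ hi, zero_mul]

theorem mem_support_uniformBelow {n r : ℕ} (hn : 0 < n) (h : r ∈ (uniformBelow n).support) :
    r < n := by
  simpa [uniformBelow, hn] using h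

theorem uniformBelow_le {n r : ℕ} (h : r ∈ (uniformBelow n).support) : r ≤ n := by
  rcases Nat.eq_zero_or_pos n with rfl | hn
  · simp [uniformBelow] at h; omega
  · exact (mem_support_uniformBelow hn h).le

end Ex

/-! ## Approximate lifting of relations to distributions -/

/-- `ν` dominates `μ` along `R` up to the error `ε`. -/
def Approx {α β : Type*} (ε : ℝ≥0∞) (R : α → β → Prop) (μ : PMF α) (ν : PMF β) : Prop :=
  ∀ (f : α → ℝ≥0∞) (g : β → ℝ≥0∞), (∀ a, f a ≤ 1) → (∀ a b, R a b → f a ≤ g b) →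
    ex μ f ≤ ex ν g + ε

namespace Approx

variable {α β γ δ : Type*} {ε ε' : ℝ≥0∞} {R S : α → β → Prop} {μ : PMF α} {ν : PMF β}

theorem mono (h : Approx ε R μ ν) (hRS : ∀ a b, R a b → S a b) (hε : ε ≤ ε') :
    Approx ε' S μ ν := fun f g hf hfg =>
  (h f g hf fun a b hab => hfg a b (hRS a b hab)).trans (by gcongr)

/-- Outside the supports `f` may be lowered to `0` and `g` raised to `∞` without changing the
expectations. The value `∞` is admissible because `g` is not required to be bounded. -/
theorem mono_support (h : Approx ε R μ ν)
    (hRS : ∀ a ∈ μ.support, ∀ b ∈ ν.support, R a b → S a b) : Approx ε S μ ν := by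
  classical
  intro f g hf hfg
  have h1 : ex μ f ≤ ex μ (fun a => if a ∈ μ.support then f a else 0) :=
    ex_mono_support μ fun a ha => by simp only [ha, if_true]; exact le_rfl
  have h2 : ex ν (fun b => if b ∈ ν.support then g b else ∞) ≤ ex ν g :=
    ex_mono_support ν fun b hb => by simp only [hb, if_true]; exact le_rfl
  refine h1.trans ((h _ (fun b => if b ∈ ν.support then g b else ∞) (fun a => ?_)
    fun a b hab => ?_).trans (add_le_add h2 le_rfl))
  · split_ifs
    exacts [hf a, zero_le]
  · split_ifs with ha hb
    exacts [hfg a b (hRS a ha b hb hab), le_top, zero_le, zero_le]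

theorem pure {a : α} {b : β} (h : R a b) : Approx 0 R (PMF.pure a) (PMF.pure b) :=
  fun f g _ hfg => by simpa using hfg a b h

/-- The error of the second stage is absorbed into the test function `fun b => ex (G b) g + ε'`. It
may exceed `1`, which is why only the left test function is bounded. -/
theorem bind {R : α → β → Prop} {S : γ → δ → Prop} {F : α → PMF γ} {G : β → PMF δ}
    (h : Approx ε R μ ν) (hFG : ∀ a b, R a b → Approx ε' S (F a) (G b)) :
    Approx (ε + ε') S (μ.bind F) (ν.bind G) := by
  intro f g hf hfg
  rw [ex_bind, ex_bind]
  refine (h (fun a => ex (F a) f) (fun b => ex (G b) g + ε') (fun a => ex_le_const _ hf)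
    fun a b hab => hFG a b hab f g hf hfg).trans ?_
  rw [ex_add_const, add_assoc, add_comm ε']

theorem bind_zero {R : α → β → Prop} {S : γ → δ → Prop} {F : α → PMF γ} {G : β → PMF δ}
    (h : Approx 0 R μ ν) (hFG : ∀ a b, R a b → Approx 0 S (F a) (G b)) :
    Approx 0 S (μ.bind F) (ν.bind G) := by
  simpa using h.bind hFG

/-- Serves runs that exceed their time: the relation then promises nothing, so it holds with every
outcome on the right and no coupling is needed. -/
theorem of_forall (h : ∀ a ∈ μ.support, ∀ b, R a b) : Approx 0 R μ ν := by
  intro f g _ hfg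
  rw [add_zero]
  have h1 : ∀ b, ex μ f ≤ g b := fun b =>
    (ex_mono_support μ (g := fun _ => g b) fun a ha => hfg a b (h a ha b)).trans (ex_const μ _).le
  calc ex μ f = ex ν fun _ => ex μ f := (ex_const ν _).symm
    _ ≤ ex ν g := ex_mono ν h1

theorem refl : Approx 0 (· = ·) μ μ := fun f g _ hfg => by
  rw [add_zero]; exact ex_mono μ fun a => hfg a a rfl

theorem bind_same {S : γ → δ → Prop} {F : α → PMF γ} {G : α → PMF δ}
    (h : ∀ a ∈ μ.support, Approx ε S (F a) (G a)) : Approx ε S (μ.bind F) (μ.bind G) := by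
  have h0 : Approx 0 (fun a b => a = b ∧ a ∈ μ.support) μ μ :=
    refl.mono_support fun a ha b _ hab => ⟨hab, ha⟩
  simpa using h0.bind fun a b hab => hab.1 ▸ h a hab.2

end Approx

/-! ## Interaction trees -/

/-- Computations that consist of oracle calls only. -/
inductive Tree (ι ρ : Type) : Type
  | ret (r : ρ) : Tree ι ρ
  | ask (i : ι) (x : Val) (k : Val → Tree ι ρ) : Tree ι ρ

namespace Tree

variable {ι ρ ρ' σ : Type}

def bind : Tree ι ρ → (ρ → Tree ι ρ') → Tree ι ρ'
  | ret r, f => f r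
  | ask i x k, f => ask i x fun v => (k v).bind f

/-- Execution with stateful oracles. -/
noncomputable def interp (O : ι → Val → PState σ Val) : Tree ι ρ → σ → PMF (ρ × σ)
  | ret r, s => PMF.pure (r, s)
  | ask i x k, s => (O i x s).bind fun p => (k p.1).interp O p.2

/-- Execution with stateless oracles. -/
noncomputable def den (ev : ι → Val → PMF Val) : Tree ι ρ → PMF ρ
  | ret r => PMF.pure r
  | ask i x k => (ev i x).bind fun v => (k v).den ev

theorem interp_bind (O : ι → Val → PState σ Val) (t : Tree ι ρ) (f : ρ → Tree ι ρ') (s : σ) :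
    (t.bind f).interp O s = (t.interp O s).bind fun p => (f p.1).interp O p.2 := by
  induction t generalizing s with
  | ret r => simp [bind, interp]
  | ask i x k ih => simp [bind, interp, ih]

theorem den_bind (ev : ι → Val → PMF Val) (t : Tree ι ρ) (f : ρ → Tree ι ρ') :
    (t.bind f).den ev = (t.den ev).bind fun r => (f r).den ev := by
  induction t with
  | ret r => simp [bind, den]
  | ask i x k ih => simp [bind, den, ih]

theorem interp_draw (ev : ι → Val → PMF Val) (t : Tree ι ρ) (s : σ) :
    t.interp (fun i x => draw (ev i x)) s = (t.den ev).map fun r => (r, s) := by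
  induction t with
  | ret r => simp [interp, den, PMF.pure_map]
  | ask i x k ih =>
    simp only [interp, den, draw, PMF.bind_map, PMF.map_bind]
    exact congrArg _ (funext fun v => ih v)

/-- Every leaf lies at depth at most its cost minus `n`, and outputs are no larger than costs. -/
def Costly : ℕ → Tree ι (Val × ℕ) → Prop
  | n, ret r => n ≤ r.2 ∧ r.1.size ≤ r.2
  | n, ask _ _ k => ∀ v, (k v).Costly (n + 1)

theorem Costly.mono {m n : ℕ} (h : m ≤ n) {t : Tree ι (Val × ℕ)} (ht : t.Costly n) :
    t.Costly m := by
  induction t generalizing m n with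
  | ret r => exact ⟨h.trans ht.1, ht.2⟩
  | ask i x k ih => exact fun v => ih v (Nat.succ_le_succ h) (ht v)

theorem Costly.bind {n : ℕ} {t : Tree ι (Val × ℕ)} (ht : t.Costly n)
    {f : Val × ℕ → Tree ι (Val × ℕ)}
    (hf : ∀ r m, r.1.size ≤ r.2 → n ≤ m → m ≤ r.2 → (f r).Costly m) : (t.bind f).Costly n := by
  induction t generalizing n with
  | ret r => exact hf r n ht.2 le_rfl ht.1
  | ask i x k ih =>
    exact fun v => ih v (ht v) fun r m h1 h2 h3 => hf r m h1 (by omega) h3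

theorem Costly.add {n : ℕ} {t : Tree ι (Val × ℕ)} (ht : t.Costly n) (a : ℕ)
    {f : Val × ℕ → Val × ℕ}
    (hf : ∀ r, n ≤ r.2 → r.1.size ≤ r.2 → r.2 + a ≤ (f r).2 ∧ (f r).1.size ≤ (f r).2) :
    (t.bind fun r => ret (f r)).Costly (n + a) := by
  induction t generalizing n with
  | ret r =>
    obtain ⟨h1, h2⟩ := hf r ht.1 ht.2
    exact ⟨by have := ht.1; omega, h2⟩
  | ask i x k ih =>
    intro v
    have := ih v (ht v) fun r h1 h2 => hf r (by omega) h2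
    exact this.mono (by omega)

theorem Costly.interp_support (O : ι → Val → PState σ Val) {n : ℕ} {t : Tree ι (Val × ℕ)}
    (ht : t.Costly n) (s : σ) (q : (Val × ℕ) × σ) (hq : q ∈ (t.interp O s).support) :
    n ≤ q.1.2 ∧ q.1.1.size ≤ q.1.2 := by
  induction t generalizing n s with
  | ret r =>
    simp only [interp, PMF.support_pure, Set.mem_singleton_iff] at hq
    subst hq; exact ht
  | ask i x k ih =>
    simp only [interp, PMF.mem_support_bind_iff] at hq
    obtain ⟨p, _, hp⟩ := hq
    have := ih p.1 (ht p.1) p.2 hp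
    exact ⟨by omega, this.2⟩

theorem Costly.den_support (ev : ι → Val → PMF Val) {n : ℕ} {t : Tree ι (Val × ℕ)}
    (ht : t.Costly n) (q : Val × ℕ) (hq : q ∈ (t.den ev).support) :
    n ≤ q.2 ∧ q.1.size ≤ q.2 := by
  refine ht.interp_support (σ := Unit) (fun i x => draw (ev i x)) () (q, ()) ?_
  rw [interp_draw]
  simpa using hq

end Tree

theorem Val.size_pos (x : Val) : 0 < x.size := by cases x <;> simp [Val.size]

def iterTree {ι : Type} (f : Val → Tree ι (Val × ℕ)) : ℕ → Val → Tree ι (Val × ℕ)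
  | 0, x => .ret (x, 0)
  | n + 1, x => (f x).bind fun r => (iterTree f n r.1).bind fun r' => .ret (r'.1, r.2 + r'.2)

/-- The interaction tree of a program; `none` is the source of randomness. -/
def Prog.tree {ι : Type} : Prog ι → Val → Tree (Option ι) (Val × ℕ)
  | .id, x => .ret (x, stepCost x x)
  | .const v, x => .ret (v, stepCost x v)
  | .fst, x => .ret (x.fst, stepCost x x.fst)
  | .snd, x => .ret (x.snd, stepCost x x.snd)
  | .isNum, x => .ret (x.isNum, stepCost x x.isNum)
  | .arith o, x => .ret (.num (o.eval x.fst.toNat x.snd.toNat),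
      stepCost x (.num (o.eval x.fst.toNat x.snd.toNat)))
  | .rand, x => .ask none x fun y => .ret (y, stepCost x y)
  | .ask i, x => .ask (some i) x fun y => .ret (y, stepCost x y)
  | .seq p q, x => (p.tree x).bind fun r => (q.tree r.1).bind fun r' =>
      .ret (r'.1, r.2 + r'.2 + 1)
  | .fork p q, x => (p.tree x).bind fun r => (q.tree x).bind fun r' =>
      .ret (.pair r.1 r'.1, r.2 + r'.2 + 1)
  | .ifz c p q, x => (c.tree x).bind fun r =>
      (match r.1 with
        | .num 0 => p.tree x
        | _ => q.tree x).bind fun r' => .ret (r'.1, r.2 + r'.2 + 1)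
  | .iter p, x => (iterTree p.tree x.fst.toNat x.snd).bind fun r =>
      .ret (r.1, r.2 + stepCost x r.1)

/-- The random number instruction as an oracle. -/
noncomputable def coin (x : Val) : PMF Val := (uniformBelow x.toNat).map .num

noncomputable def withCoin {ι σ : Type} (O : ι → Val → PState σ Val) :
    Option ι → Val → PState σ Val
  | none, x => draw (coin x)
  | some i, x => O i x

noncomputable def evCoin {ι : Type} (ev : ι → Val → PMF Val) : Option ι → Val → PMF Val
  | none, x => coin x
  | some i, x => ev i x

/-! ### Programs as interaction trees, and lower bounds for their costs. -/

section Run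

variable {ι σ α β : Type}

theorem PState.pure_apply (a : α) (s : σ) : (pure a : PState σ α) s = PMF.pure (a, s) := rfl

theorem PState.bind_apply (m : PState σ α) (f : α → PState σ β) (s : σ) :
    (m >>= f) s = (m s).bind fun p => f p.1 p.2 := rfl

theorem iterRun_eq_interp (f : Val → PState σ (Val × ℕ)) (O : ι → Val → PState σ Val)
    (T : Val → Tree ι (Val × ℕ)) (h : ∀ x s, f x s = (T x).interp O s) (n : ℕ) (x : Val) (s : σ) :
    iterRun f n x s = (iterTree T n x).interp O s := by
  induction n generalizing x s with
  | zero => rfl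
  | succ n ih =>
    simp only [iterRun, iterTree, PState.bind_apply, Tree.interp_bind, h, ih, Tree.interp,
      PState.pure_apply]

theorem Prog.run_eq_interp (O : ι → Val → PState σ Val) (P : Prog ι) (x : Val) (s : σ) :
    P.run O x s = (P.tree x).interp (withCoin O) s := by
  induction P generalizing x s with
  | id => rfl
  | const v => rfl
  | fst => rfl
  | snd => rfl
  | isNum => rfl
  | arith o => rfl
  | rand =>
    simp only [Prog.run, Prog.tree, PState.bind_apply, Tree.interp, withCoin, draw, coin,
      PState.pure_apply, PMF.map_comp, PMF.bind_map, Function.comp_def]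
  | ask i =>
    simp only [Prog.run, Prog.tree, PState.bind_apply, Tree.interp, withCoin, PState.pure_apply]
  | seq p q ihp ihq =>
    simp only [Prog.run, Prog.tree, PState.bind_apply, Tree.interp_bind, ihp, ihq, Tree.interp,
      PState.pure_apply]
  | fork p q ihp ihq =>
    simp only [Prog.run, Prog.tree, PState.bind_apply, Tree.interp_bind, ihp, ihq, Tree.interp,
      PState.pure_apply]
  | ifz c p q ihc ihp ihq =>
    simp only [Prog.run, Prog.tree, PState.bind_apply, Tree.interp_bind, ihc, Tree.interp]
    congr 1
    funext r
    rcases r with ⟨⟨b, c⟩, s'⟩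
    rcases b with (_ | n) | ⟨a, b⟩ <;>
      simp only [PState.bind_apply, PState.pure_apply, ihp, ihq]
  | iter p ih =>
    simp only [Prog.run, Prog.tree, PState.bind_apply, Tree.interp_bind, Tree.interp,
      PState.pure_apply, iterRun_eq_interp _ _ _ ih]

/-- For `n = 0` the input is returned at cost `0`, less than its size; the instruction `iter` makes
up for this by its own charge. -/
theorem iterTree_costly {T : Val → Tree ι (Val × ℕ)} (h : ∀ x, (T x).Costly x.size) (n : ℕ)
    (x : Val) : (iterTree T n x).Costly 0 ∨ n = 0 := by
  rcases n with _ | n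
  · exact .inr rfl
  left
  induction n generalizing x with
  | zero =>
    refine Tree.Costly.bind ((h x).mono (Nat.zero_le _)) fun r m h1 h2 h3 => ?_
    exact ⟨by simp; omega, by simpa using h1⟩
  | succ n ih =>
    refine Tree.Costly.bind ((h x).mono (Nat.zero_le _)) fun r m h1 h2 h3 => ?_
    have := Tree.Costly.add (ih r.1) r.2 (f := fun r' => (r'.1, r.2 + r'.2))
      fun r' _ h => ⟨by simp; omega, by simp; omega⟩
    exact this.mono (by omega)

/-- Reading is charged, so the cost of a run is at least the size of the input plus the number of
oracle calls and coin tosses. A time limit thus bounds the number of events, and an input longer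
than the limit cannot be processed in time. -/
theorem Prog.tree_costly (P : Prog ι) (x : Val) : (P.tree x).Costly x.size := by
  induction P generalizing x with
  | id | const v | fst | snd | isNum | arith o =>
    exact ⟨by simp only [stepCost]; omega, by simp only [stepCost]; omega⟩
  | rand | ask i =>
    exact fun v => ⟨by simp only [stepCost]; omega, by simp only [stepCost]; omega⟩
  | seq p q ihp ihq =>
    refine (ihp x).bind fun r m h1 h2 h3 => ?_
    exact ((ihq r.1).add (r.2 + 1) (f := fun r' => (r'.1, r.2 + r'.2 + 1))
      fun r' _ h => ⟨by simp; omega, by simp; omega⟩).mono (by omega)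
  | fork p q ihp ihq =>
    refine (ihp x).bind fun r m h1 h2 h3 => ?_
    exact ((ihq x).add (r.2 + 1) (f := fun r' => (.pair r.1 r'.1, r.2 + r'.2 + 1))
      fun r' _ h => ⟨by simp; omega, by simp [Val.size]; omega⟩).mono (by omega)
  | ifz c p q ihc ihp ihq =>
    refine (ihc x).bind fun r m h1 h2 h3 => ?_
    have h : (match r.1 with
        | .num 0 => p.tree x
        | _ => q.tree x).Costly x.size := by
      rcases r.1 with (_ | n) | ⟨a, b⟩
      exacts [ihp x, ihq x, ihq x]
    exact (h.add (r.2 + 1) (f := fun r' => (r'.1, r.2 + r'.2 + 1))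
      fun r' _ h => ⟨by simp; omega, by simp; omega⟩).mono (by omega)
  | iter p ih =>
    rcases iterTree_costly ih x.fst.toNat x.snd with h | h
    · exact (h.add x.size (f := fun r => (r.1, r.2 + stepCost x r.1))
        fun r' _ h => ⟨by simp [stepCost]; omega, by simp [stepCost]; omega⟩).mono (by omega)
    · simp only [Prog.tree, h, iterTree, Tree.bind, Tree.Costly, stepCost]
      omega

/-- No oracles. -/
noncomputable def noEv (i : Empty) (_ : Val) : PMF Val := i.elim

/-- The distribution of output and cost of a program with stateless oracles. -/
noncomputable def Prog.den (ev : ι → Val → PMF Val) (P : Prog ι) (x : Val) : PMF (Val × ℕ) :=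
  (P.tree x).den (evCoin ev)

theorem Prog.run_draw (ev : ι → Val → PMF Val) (P : Prog ι) (x : Val) (s : σ) :
    P.run (fun i y => draw (ev i y)) x s = (P.den ev x).map fun r => (r, s) := by
  rw [Prog.run_eq_interp, Prog.den, ← Tree.interp_draw]
  congr 1
  funext i y
  cases i <;> rfl

theorem Prog.runPlain_eq_den (P : Prog Empty) (x : Val) :
    P.runPlain x = P.den noEv x := by
  have h2 : (fun (i : Empty) (_ : Val) => (i.elim : PState Unit Val)) =
      fun i y => draw (noEv i y) := funext fun i => i.elim
  unfold Prog.runPlain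
  rw [h2]
  change PMF.map _ (P.run (fun (i : Empty) y => draw (noEv i y)) x ()) = _
  rw [P.run_draw noEv x (), PMF.map_comp]
  exact PMF.map_id _

theorem Prog.size_le_of_mem_support_den (ev : ι → Val → PMF Val) (P : Prog ι) (x : Val)
    (r : Val × ℕ) (hr : r ∈ (P.den ev x).support) : x.size ≤ r.2 ∧ r.1.size ≤ r.2 :=
  (P.tree_costly x).den_support _ r hr

theorem Prog.den_seq (ev : ι → Val → PMF Val) (p q : Prog ι) (x : Val) :
    (Prog.seq p q).den ev x = (p.den ev x).bind fun r =>
      (q.den ev r.1).map fun r' => (r'.1, r.2 + r'.2 + 1) := by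
  simp only [Prog.den, Prog.tree, Tree.den_bind, Tree.den]; rfl

theorem Prog.den_fork (ev : ι → Val → PMF Val) (p q : Prog ι) (x : Val) :
    (Prog.fork p q).den ev x = (p.den ev x).bind fun r =>
      (q.den ev x).map fun r' => (Val.pair r.1 r'.1, r.2 + r'.2 + 1) := by
  simp only [Prog.den, Prog.tree, Tree.den_bind, Tree.den]; rfl

open Classical in
theorem Prog.den_ifz (ev : ι → Val → PMF Val) (c p q : Prog ι) (x : Val) :
    (Prog.ifz c p q).den ev x = (c.den ev x).bind fun r =>
      ((if r.1 = .num 0 then p else q).den ev x).map fun r' => (r'.1, r.2 + r'.2 + 1) := by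
  simp only [Prog.den, Prog.tree, Tree.den_bind, Tree.den]
  congr 1
  funext r
  rcases r with ⟨(_ | n) | ⟨a, b⟩, m⟩ <;> simp <;> rfl

/-- The same iteration at the level of distributions. -/
noncomputable def iterDen (F : Val → PMF (Val × ℕ)) : ℕ → Val → PMF (Val × ℕ)
  | 0, x => PMF.pure (x, 0)
  | n + 1, x => (F x).bind fun r => (iterDen F n r.1).map fun r' => (r'.1, r.2 + r'.2)

theorem Prog.den_iter (ev : ι → Val → PMF Val) (p : Prog ι) (x : Val) :
    (Prog.iter p).den ev x = (iterDen (p.den ev) x.fst.toNat x.snd).map fun r =>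
      (r.1, r.2 + stepCost x r.1) := by
  have h : ∀ n y, (iterTree p.tree n y).den (evCoin ev) = iterDen (p.den ev) n y := by
    intro n
    induction n with
    | zero => intro y; rfl
    | succ n ih =>
      intro y
      simp only [iterTree, iterDen, Tree.den_bind, Tree.den, ih]
      rfl
  simp only [Prog.den, Prog.tree, Tree.den_bind, Tree.den, h]
  rfl

theorem Prog.den_ask (ev : ι → Val → PMF Val) (i : ι) (x : Val) :
    (Prog.ask i).den ev x = (ev i x).map fun y => (y, stepCost x y) := rfl

theorem Prog.den_rand (ev : ι → Val → PMF Val) (x : Val) :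
    (Prog.rand : Prog ι).den ev x = (coin x).map fun y => (y, stepCost x y) := rfl

/-- A program without oracles as a program with oracles. -/
def Prog.embed : Prog Empty → Prog ι
  | .id => .id
  | .const v => .const v
  | .fst => .fst
  | .snd => .snd
  | .isNum => .isNum
  | .arith o => .arith o
  | .rand => .rand
  | .ask i => i.elim
  | .seq p q => .seq p.embed q.embed
  | .fork p q => .fork p.embed q.embed
  | .ifz c p q => .ifz c.embed p.embed q.embed
  | .iter p => .iter p.embed

theorem Prog.den_embed (ev : ι → Val → PMF Val) (P : Prog Empty) (x : Val) :
    (P.embed : Prog ι).den ev x = P.den noEv x := by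
  induction P generalizing x with
  | id | const v | fst | snd | isNum | arith o | rand => rfl
  | ask i => exact i.elim
  | seq p q ihp ihq => simp only [Prog.embed, Prog.den_seq, ihp, ihq]
  | fork p q ihp ihq => simp only [Prog.embed, Prog.den_fork, ihp, ihq]
  | ifz c p q ihc ihp ihq =>
    simp only [Prog.embed, Prog.den_ifz, ihc]
    congr 1
    funext r
    split_ifs
    · rw [ihp]
    · rw [ihq]
  | iter p ih =>
    simp only [Prog.embed, Prog.den_iter]
    rw [funext ih]

end Run

/-! ## Answering oracle calls by programs -/

namespace Prog

variable {ι ι' σ : Type}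

/-- `(x, (st, y)) ↦ (st, x)` -/
def stFst : Prog ι := .fork (.seq .snd .fst) .fst

/-- `(a, (b, c)) ↦ (b, (a, c))` -/
def swapHead : Prog ι := .fork (.seq .snd .fst) (.fork .fst (.seq .snd .snd))

/-- Replaces oracle calls and coin tosses by programs that act on a pair of a state and a query
and return a pair of a new state and an answer. The result maps `(state, input)` to
`(new state, output)`. -/
def compile (h : Option ι → Prog ι') : Prog ι → Prog ι'
  | .id => .id
  | .const v => .fork .fst (.const v)
  | .fst => .fork .fst (.seq .snd .fst)
  | .snd => .fork .fst (.seq .snd .snd)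
  | .isNum => .fork .fst (.seq .snd .isNum)
  | .arith o => .fork .fst (.seq .snd (.arith o))
  | .rand => h none
  | .ask i => h (some i)
  | .seq p q => .seq (p.compile h) (q.compile h)
  -- The values passed on are `(st, x)`, then `(x, (st₁, y))`, then `(y, (st₂, z))`, and finally
  -- `(st₂, (y, z))`. In the case of `iter`, `swapHead` brings the counter to the front.
  | .fork p q => .seq (.fork .snd (p.compile h))
      (.seq (.fork (.seq .snd .snd) (.seq stFst (q.compile h))) swapHead)
  | .ifz c p q => .seq (.fork .snd (c.compile h))
      (.ifz (.seq .snd .snd) (.seq stFst (p.compile h)) (.seq stFst (q.compile h)))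
  | .iter p => .seq swapHead (.iter (p.compile h))

section

variable (ev : ι → Val → PMF Val) (x : Val)

theorem den_id : (Prog.id : Prog ι).den ev x = PMF.pure (x, stepCost x x) := rfl
theorem den_const (v : Val) : (Prog.const v : Prog ι).den ev x = PMF.pure (v, stepCost x v) := rfl
theorem den_fst : (Prog.fst : Prog ι).den ev x = PMF.pure (x.fst, stepCost x x.fst) := rfl
theorem den_snd : (Prog.snd : Prog ι).den ev x = PMF.pure (x.snd, stepCost x x.snd) := rfl
theorem den_isNum : (Prog.isNum : Prog ι).den ev x = PMF.pure (x.isNum, stepCost x x.isNum) := rfl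
theorem den_arith (o : Arith) : (Prog.arith o : Prog ι).den ev x =
    PMF.pure (.num (o.eval x.fst.toNat x.snd.toNat),
      stepCost x (.num (o.eval x.fst.toNat x.snd.toNat))) := rfl

end

end Prog

@[simp] theorem Val.fst_pair (a b : Val) : (Val.pair a b).fst = a := rfl
@[simp] theorem Val.snd_pair (a b : Val) : (Val.pair a b).snd = b := rfl
@[simp] theorem Val.toNat_num (n : ℕ) : (Val.num n).toNat = n := rfl
@[simp] theorem Val.size_pair (a b : Val) : (Val.pair a b).size = a.size + b.size + 1 := rfl
@[simp] theorem Val.size_num (n : ℕ) : (Val.num n).size = n.size + 1 := rfl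

theorem Val.size_fst_le (x : Val) : x.fst.size ≤ x.size := by
  cases x <;> simp [Val.size, Val.fst]; omega

theorem Val.size_snd_le (x : Val) : x.snd.size ≤ x.size := by
  cases x <;> simp [Val.size, Val.snd]; omega

theorem Val.size_isNum_le (x : Val) : x.isNum.size ≤ 2 := by
  cases x <;> simp [Val.isNum]

section Compile

variable {ι ι' σ : Type} (ev : ι' → Val → PMF Val) (h : Option ι → Prog ι')
  (O : Option ι → Val → PState σ Val) (enc : σ → Val) (pot : σ → ℕ) (t₀ F D W : ℕ)

/-- How a run of a compiled program is related to the run it simulates, if that has cost at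
most `t`. -/
def CompileRel (a : σ) (t : ℕ) (r : (Val × ℕ) × σ) (o : Val × ℕ) : Prop :=
  r.1.2 ≤ t → o.1 = .pair (enc r.2) r.1.1 ∧ pot r.2 ≤ pot a + D * r.1.2 ∧
    o.2 ≤ r.1.2 * W

/-- The programs `h` implement the oracles `O`, with states encoded by `enc`: queries of size
at most `t₀` raise the potential of the state by at most `D` and cost at most `W`, as long as the
potential stays below `F`. -/
def Handles : Prop :=
  ∀ i x a, x.size ≤ t₀ → pot a + D ≤ F →
    Approx 0 (fun (r : Val × σ) (o : Val × ℕ) => o.1 = .pair (enc r.2) r.1 ∧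
      pot r.2 ≤ pot a + D ∧ o.2 ≤ W) (O i x a) ((h i).den ev (.pair (enc a) x))

variable {ev h O enc pot t₀ F D W}

theorem CompileRel.of_lt {a : σ} {t : ℕ} {μ : PMF ((Val × ℕ) × σ)} {ν : PMF (Val × ℕ)}
    (hlt : ∀ r ∈ μ.support, t < r.1.2) : Approx 0 (CompileRel enc pot D W a t) μ ν :=
  Approx.of_forall fun r hr _ hle => absurd (hlt r hr) (not_lt.2 hle)

/-- If the first part exceeds the budget `t`, then so does the whole, by `hf`, and there is nothing
to show. So `hG` may assume that the first part stayed within the budget and was simulated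
faithfully. -/
theorem approx_bind_compile {a : σ} {t c : ℕ} (T : Tree (Option ι) (Val × ℕ)) (n : ℕ)
    (hT : T.Costly n)
    {ν : PMF (Val × ℕ)} (f : (Val × ℕ) → Tree (Option ι) (Val × ℕ)) (G : Val × ℕ → PMF (Val × ℕ))
    (hν : Approx 0 (CompileRel enc pot D W a t) (T.interp O a) ν)
    (hf : ∀ r s, ∀ q ∈ ((f r).interp O s).support, r.2 + c ≤ q.1.2)
    (hG : ∀ (r : (Val × ℕ) × σ) (o : Val × ℕ), n ≤ r.1.2 → r.1.1.size ≤ r.1.2 → r.1.2 ≤ t →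
      o.1 = .pair (enc r.2) r.1.1 → pot r.2 ≤ pot a + D * r.1.2 →
      o.2 ≤ r.1.2 * W → Approx 0 (CompileRel enc pot D W a t) ((f r.1).interp O r.2) (G o)) :
    Approx 0 (CompileRel enc pot D W a t) ((T.bind f).interp O a) (ν.bind G) := by
  rw [Tree.interp_bind]
  have hν' : Approx 0 (fun r o => CompileRel enc pot D W a t r o ∧ n ≤ r.1.2 ∧ r.1.1.size ≤ r.1.2)
      (T.interp O a) ν := by
    refine hν.mono_support fun r hr o _ hro => ⟨hro, ?_⟩
    exact hT.interp_support O a r hr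
  refine hν'.bind_zero fun r o ⟨hro, hn, hs⟩ => ?_
  by_cases hc : r.1.2 ≤ t
  · obtain ⟨h1, h2, h3⟩ := hro hc
    exact hG r o hn hs hc h1 h2 h3
  · exact CompileRel.of_lt fun q hq => by have := hf r.1 r.2 q hq; omega

/-- Appending a simulated computation to one that has had cost `c`. -/
theorem CompileRel.continue {a b : σ} {t c C : ℕ} (hc : c ≤ t)
    (hb : pot b ≤ pot a + D * c) (hC : C ≤ c * W)
    {μ : PMF ((Val × ℕ) × σ)} {ν : PMF (Val × ℕ)}
    (h : Approx 0 (CompileRel enc pot D W b (t - c)) μ ν) (φ : Val → Val) (k : Val → ℕ)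
    (ψ : Val × ℕ → PMF (Val × ℕ))
    (hψ : ∀ q ∈ μ.support, ∀ n, c + q.1.2 + k q.1.1 ≤ t →
      pot q.2 ≤ pot a + D * (c + q.1.2) →
      ∃ C', ψ (.pair (enc q.2) q.1.1, n) = PMF.pure (.pair (enc q.2) (φ q.1.1), C') ∧
        C' ≤ C + n + k q.1.1 * W) :
    Approx 0 (CompileRel enc pot D W a t)
      (μ.bind fun q => PMF.pure ((φ q.1.1, c + q.1.2 + k q.1.1), q.2)) (ν.bind ψ) := by
  have h' : Approx 0 (fun r o => CompileRel enc pot D W b (t - c) r o ∧ r ∈ μ.support) μ ν :=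
    h.mono_support fun r hr o _ hro => ⟨hro, hr⟩
  refine h'.bind_zero fun q o ⟨hqo, hq⟩ => ?_
  by_cases hle : c + q.1.2 + k q.1.1 ≤ t
  · obtain ⟨h1, h2, h3⟩ := hqo (by omega)
    rcases o with ⟨o, n⟩
    simp only at h1 h3
    subst h1
    have h4 : pot q.2 ≤ pot a + D * (c + q.1.2) := by rw [mul_add]; omega
    obtain ⟨C', hd, hC'⟩ := hψ q hq n hle h4
    rw [hd]
    refine Approx.pure fun _ => ⟨rfl, h4.trans (by gcongr; simp), hC'.trans ?_⟩
    simp only [add_mul]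
    omega
  · refine CompileRel.of_lt fun r hr => ?_
    simp only [PMF.support_pure, Set.mem_singleton_iff] at hr
    subst hr
    simpa using hle

theorem compile_elementary (x y : Val) (p : Prog ι')
    (a : σ) (t c : ℕ) (hx : x.size ≤ c)
    (hp : c ≤ t → ∃ C ≤ W, p.den ev (.pair (enc a) x) = PMF.pure (.pair (enc a) y, C)) :
    Approx 0 (CompileRel enc pot D W a t) (PMF.pure ((y, c), a)) (p.den ev (.pair (enc a) x)) := by
  by_cases hc : c ≤ t
  · obtain ⟨C, hC, hd⟩ := hp hc
    rw [hd]
    refine Approx.pure fun _ => ⟨rfl, by simp, ?_⟩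
    exact hC.trans (Nat.le_mul_of_pos_left W (by have := x.size_pos; simp only; omega))
  · refine CompileRel.of_lt fun r hr => ?_
    simp only [PMF.support_pure, Set.mem_singleton_iff] at hr
    subst hr
    simpa using hc

/-- A call is charged at least one unit of cost, which pays for the growth `D` of the potential and
for the cost `W` of the handler. A query larger than `t` already exceeds the budget. -/
theorem compile_query (hH : Handles ev h O enc pot t₀ F D W) (x : Val) (a : σ) (t : ℕ) (ht : t ≤ t₀)
    (ha : pot a + D * t ≤ F) (i : Option ι) :
    Approx 0 (CompileRel enc pot D W a t)
      ((Tree.ask i x fun y => .ret (y, stepCost x y)).interp O a)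
      ((h i).den ev (.pair (enc a) x)) := by
  by_cases hx : x.size ≤ t
  · have h1 : 1 ≤ t := by have := x.size_pos; omega
    have h2 : D ≤ D * t := Nat.le_mul_of_pos_right D h1
    rw [← PMF.bind_pure ((h i).den ev (.pair (enc a) x))]
    refine (hH i x a (by omega) (by omega)).bind_zero fun r o ⟨h3, h4, h5⟩ => ?_
    refine Approx.pure fun hc => ⟨h3, ?_, ?_⟩
    · have : D ≤ D * stepCost x r.1 := Nat.le_mul_of_pos_right D (by simp [stepCost])
      simp only
      omega
    · exact h5.trans (Nat.le_mul_of_pos_left W (by simp [stepCost]))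
  · refine CompileRel.of_lt fun r hr => ?_
    have := Tree.Costly.interp_support O (n := x.size)
      (t := Tree.ask i x fun y => .ret (y, stepCost x y))
      (fun v => ⟨by simp only [stepCost]; omega, by simp only [stepCost]; omega⟩) a r hr
    omega

theorem compile_iter (p : Prog ι)
    (ih : ∀ x a t, t ≤ t₀ → pot a + D * t ≤ F → Approx 0 (CompileRel enc pot D W a t)
      ((p.tree x).interp O a) ((p.compile h).den ev (.pair (enc a) x))) (n : ℕ) (x : Val) (a : σ)
    (t : ℕ) (ht : t ≤ t₀) (ha : pot a + D * t ≤ F) :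
    Approx 0 (CompileRel enc pot D W a t) ((iterTree p.tree n x).interp O a)
      (iterDen ((p.compile h).den ev) n (.pair (enc a) x)) := by
  induction n generalizing x a t with
  | zero => exact Approx.pure fun _ => ⟨rfl, by simp, by simp⟩
  | succ n ihn =>
    simp only [iterTree, iterDen]
    refine approx_bind_compile (c := 0) _ x.size (p.tree_costly x) _ _ (ih x a t ht ha) ?_ ?_
    · intro r s q hq
      simp only [Tree.interp_bind, Tree.interp, PMF.mem_support_bind_iff, PMF.support_pure,
        Set.mem_singleton_iff] at hq
      obtain ⟨q', -, rfl⟩ := hq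
      simp
    · rintro r ⟨o, C⟩ hn hs hc rfl h2 h3
      obtain ⟨u, rfl⟩ := Nat.exists_eq_add_of_le hc
      rw [Tree.interp_bind, PMF.map]
      rw [mul_add] at ha
      refine CompileRel.continue hc h2 h3 (ihn r.1.1 r.2 _ (by omega)
        (by simp only [Nat.add_sub_cancel_left]; omega)) (φ := fun y => y) (k := fun _ => 0) _ ?_
      exact fun q _ n _ _ => ⟨_, rfl, by simp⟩

/-- Each instruction costs at least one unit and is replaced by boundedly many instructions besides
the handlers. These act on simulated values, whose size is bounded by the cost, and on the encoded
state, whose size is bounded by the potential; the potential grows by at most `D` per unit and stays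
below `F`. So an overhead of `100 * (F + 1)` per unit is ample. -/
theorem compile_approx (hpot : ∀ a, (enc a).size ≤ pot a) (hH : Handles ev h O enc pot t₀ F D W) (ht₀ : t₀ ≤ F) (hW : 100 * (F + 1) ≤ W)
    (P : Prog ι) (x : Val) (a : σ) (t : ℕ) (ht : t ≤ t₀) (ha : pot a + D * t ≤ F) :
    Approx 0 (CompileRel enc pot D W a t) ((P.tree x).interp O a)
      ((P.compile h).den ev (.pair (enc a) x)) := by
  induction P generalizing x a t with
  | id =>
    refine compile_elementary x x .id a t _ (by simp only [stepCost]; omega) fun hc => ⟨_, ?_, rfl⟩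
    have he := hpot a
    simp only [stepCost, Val.size_pair] at hc ⊢
    omega
  | const v =>
    refine compile_elementary x v (.fork .fst (.const v)) a t _ (by simp only [stepCost]; omega)
      fun hc => ?_
    simp only [Prog.den_fork, Prog.den_fst, Prog.den_const, PMF.pure_bind, PMF.pure_map,
      Val.fst_pair]
    refine ⟨_, ?_, rfl⟩
    have he := hpot a
    simp only [stepCost, Val.size_pair] at hc ⊢
    omega
  | fst =>
    have h1 := x.size_fst_le
    refine compile_elementary x x.fst (.fork .fst (.seq .snd .fst)) a t _
      (by simp only [stepCost]; omega) fun hc => ?_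
    simp only [Prog.den_fork, Prog.den_seq, Prog.den_fst, Prog.den_snd, PMF.pure_bind,
      PMF.pure_map, Val.fst_pair, Val.snd_pair]
    refine ⟨_, ?_, rfl⟩
    have he := hpot a
    simp only [stepCost, Val.size_pair] at hc ⊢
    omega
  | snd =>
    have h1 := x.size_snd_le
    refine compile_elementary x x.snd (.fork .fst (.seq .snd .snd)) a t _
      (by simp only [stepCost]; omega) fun hc => ?_
    simp only [Prog.den_fork, Prog.den_seq, Prog.den_fst, Prog.den_snd, PMF.pure_bind,
      PMF.pure_map, Val.fst_pair, Val.snd_pair]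
    refine ⟨_, ?_, rfl⟩
    have he := hpot a
    simp only [stepCost, Val.size_pair] at hc ⊢
    omega
  | isNum =>
    refine compile_elementary x x.isNum (.fork .fst (.seq .snd .isNum)) a t _
      (by simp only [stepCost]; omega) fun hc => ?_
    simp only [Prog.den_fork, Prog.den_seq, Prog.den_fst, Prog.den_snd, Prog.den_isNum,
      PMF.pure_bind, PMF.pure_map, Val.fst_pair, Val.snd_pair]
    refine ⟨_, ?_, rfl⟩
    have he := hpot a
    simp only [stepCost, Val.size_pair] at hc ⊢
    omega
  | arith o =>
    refine compile_elementary x (.num (o.eval x.fst.toNat x.snd.toNat))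
      (.fork .fst (.seq .snd (.arith o))) a t _ (by simp only [stepCost]; omega) fun hc => ?_
    simp only [Prog.den_fork, Prog.den_seq, Prog.den_fst, Prog.den_snd, Prog.den_arith,
      PMF.pure_bind, PMF.pure_map, Val.fst_pair, Val.snd_pair]
    refine ⟨_, ?_, rfl⟩
    have he := hpot a
    simp only [stepCost, Val.size_pair] at hc ⊢
    omega
  | rand => exact compile_query hH x a t ht ha none
  | ask i => exact compile_query hH x a t ht ha (some i)
  | seq p q ihp ihq =>
    rw [Prog.compile, Prog.den_seq, Prog.tree]
    refine approx_bind_compile (c := 1) _ x.size (p.tree_costly x) _ _ (ihp x a t ht ha) ?_ ?_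
    · intro r s q hq
      simp only [Tree.interp_bind, Tree.interp, PMF.mem_support_bind_iff, PMF.support_pure,
        Set.mem_singleton_iff] at hq
      obtain ⟨q', -, rfl⟩ := hq
      simp only
      omega
    · rintro r ⟨o, C⟩ hn hs hc rfl h2 h3
      obtain ⟨u, rfl⟩ := Nat.exists_eq_add_of_le hc
      rw [Tree.interp_bind, PMF.map]
      rw [mul_add] at ha
      refine CompileRel.continue hc h2 h3 (ihq r.1.1 r.2 _ (by omega)
        (by simp only [Nat.add_sub_cancel_left]; omega)) (φ := fun y => y) (k := fun _ => 1) _ ?_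
      exact fun q _ n _ _ => ⟨_, rfl, by simp only; omega⟩
  | fork p q ihp ihq =>
    simp only [Prog.compile, Prog.den_seq, Prog.den_fork, Prog.den_snd, Prog.tree, PMF.map,
      PMF.bind_bind, PMF.pure_bind, Function.comp_def, Val.snd_pair]
    refine approx_bind_compile (c := 1) _ x.size (p.tree_costly x) _ _ (ihp x a t ht ha) ?_ ?_
    · intro r s q hq
      simp only [Tree.interp_bind, Tree.interp, PMF.mem_support_bind_iff, PMF.support_pure,
        Set.mem_singleton_iff] at hq
      obtain ⟨q', -, rfl⟩ := hq
      simp only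
      omega
    · rintro r ⟨o, C⟩ hn hs hc rfl h2 h3
      obtain ⟨u, rfl⟩ := Nat.exists_eq_add_of_le hc
      rw [Tree.interp_bind]
      simp only [Prog.stFst, Prog.swapHead, Prog.den_seq, Prog.den_fork, Prog.den_snd,
        Prog.den_fst, PMF.map, PMF.pure_bind, Function.comp_def, Val.snd_pair,
        Val.fst_pair]
      rw [mul_add] at ha
      refine CompileRel.continue hc h2 h3 (ihq x r.2 _ (by omega)
        (by simp only [Nat.add_sub_cancel_left]; omega)) (φ := fun y => .pair r.1.1 y)
        (k := fun _ => 1) _ ?_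
      refine fun q hq n hle hsz => ⟨_, rfl, ?_⟩
      have h5 := (q.1.1.size_pos)
      have h7 := hpot q.2
      have h9 := hpot a
      have h8 := hpot r.2
      have h4 := ((‹Prog ι›).tree_costly x).interp_support O r.2 q hq
      have h6 : D * (r.1.2 + q.1.2) ≤ D * (r.1.2 + u) := by gcongr; omega
      rw [mul_add _ _ u] at h6
      simp only [stepCost, Val.size_pair, Val.fst_pair, Val.snd_pair]
      omega
  | ifz c p q ihc ihp ihq =>
    simp only [Prog.compile, Prog.den_seq, Prog.den_fork, Prog.den_snd, Prog.tree, PMF.map,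
      PMF.bind_bind, PMF.pure_bind, Function.comp_def, Val.snd_pair]
    refine approx_bind_compile (c := 1) _ x.size (c.tree_costly x) _ _ (ihc x a t ht ha) ?_ ?_
    · intro r s q hq
      simp only [Tree.interp_bind, Tree.interp, PMF.mem_support_bind_iff, PMF.support_pure,
        Set.mem_singleton_iff] at hq
      obtain ⟨q', -, rfl⟩ := hq
      simp only
      omega
    · rintro r ⟨o, C⟩ hn hs hc rfl h2 h3
      obtain ⟨u, rfl⟩ := Nat.exists_eq_add_of_le hc
      rw [Tree.interp_bind]
      simp only [Prog.den_ifz, Prog.den_seq, Prog.den_snd,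
        PMF.map, PMF.bind_bind, PMF.pure_bind, Function.comp_def, Val.snd_pair]
      rw [mul_add] at ha
      have branch : ∀ p' : Prog ι, (∀ x a t, t ≤ t₀ → pot a + D * t ≤ F →
          Approx 0 (CompileRel enc pot D W a t) ((p'.tree x).interp O a)
            ((p'.compile h).den ev (.pair (enc a) x))) → ∀ G : Val × ℕ → PMF (Val × ℕ),
          (∀ o, ∃ C', G o = PMF.pure (o.1, C') ∧ C' ≤ C + o.2 + W) →
          Approx 0 (CompileRel enc pot D W a (r.1.2 + u))
            (((p'.tree x).interp O r.2).bind fun q =>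
              PMF.pure ((q.1.1, r.1.2 + q.1.2 + 1), q.2))
            (((p'.compile h).den ev (.pair (enc r.2) x)).bind G) := by
        intro p' ih G hG
        refine CompileRel.continue hc h2 h3 (ih x r.2 _ (by omega)
          (by simp only [Nat.add_sub_cancel_left]; omega)) (φ := fun y => y) (k := fun _ => 1) _ ?_
        intro q _ n _ _
        obtain ⟨C', h4, h5⟩ := hG (.pair (enc q.2) q.1.1, n)
        exact ⟨C', h4, by simpa using h5⟩
      have h8 := hpot r.2
      have h9 := hpot a
      by_cases hb : r.1.1 = .num 0
      · simp only [hb, if_true, Prog.stFst, Prog.den_seq, Prog.den_fork, Prog.den_snd,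
          Prog.den_fst, PMF.map, PMF.bind_bind, PMF.pure_bind, Function.comp_def, Val.snd_pair,
          Val.fst_pair]
        refine branch p ihp _ fun o => ⟨_, rfl, ?_⟩
        rw [hb] at hs
        simp only [stepCost, Val.size_pair]
        omega
      · simp only [hb, if_false, Prog.stFst, Prog.den_seq, Prog.den_fork, Prog.den_snd,
          Prog.den_fst, PMF.map, PMF.bind_bind, PMF.pure_bind, Function.comp_def, Val.snd_pair,
          Val.fst_pair]
        refine branch q ihq _ fun o => ⟨_, rfl, ?_⟩
        simp only [stepCost, Val.size_pair]
        omega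
  | iter p ih =>
    have h1 := x.size_fst_le
    have h2 := x.size_snd_le
    simp only [Prog.compile, Prog.den_seq, Prog.den_iter, Prog.swapHead, Prog.den_fork,
      Prog.den_snd, Prog.den_fst, Prog.tree, PMF.map,
      PMF.bind_bind, PMF.pure_bind, Function.comp_def, Val.snd_pair, Val.fst_pair]
    rw [Tree.interp_bind]
    have := CompileRel.continue (a := a) (t := t) (c := 0) (C := 0) (Nat.zero_le _) (by simp)
      (by simp) (compile_iter p ih x.fst.toNat x.snd a t ht ha) (φ := fun y => y)
      (k := fun y => stepCost x y)
    simp only [Nat.zero_add] at this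
    refine this _ fun q hq n hle hsz => ⟨_, rfl, ?_⟩
    have h3 : D * q.1.2 ≤ D * t := by gcongr; omega
    have h5 := hpot a
    have h6 := hpot q.2
    have h4 : W ≤ stepCost x q.1.1 * W := Nat.le_mul_of_pos_left W (by simp [stepCost])
    simp only [stepCost, Val.size_pair] at hle h4 ⊢
    omega

end Compile

/-! ## Polynomial bounds -/

theorem eval_mono (p : ℕ[X]) {a b : ℕ} (h : a ≤ b) : p.eval a ≤ p.eval b := by
  simp only [Polynomial.eval_eq_sum_range]
  gcongr

/-- `f` is bounded by a polynomial in `m`. -/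
def PolyBdd {α : Type*} (m f : α → ℕ) : Prop := ∃ p : ℕ[X], ∀ a, f a ≤ p.eval (m a)

namespace PolyBdd

variable {α β : Type*} {m m' f g : α → ℕ}

theorem mono (hg : PolyBdd m g) (h : ∀ a, f a ≤ g a) : PolyBdd m f := by
  obtain ⟨p, hp⟩ := hg
  exact ⟨p, fun a => (h a).trans (hp a)⟩

theorem const (c : ℕ) : PolyBdd m fun _ => c := ⟨Polynomial.C c, fun a => by simp⟩

theorem self : PolyBdd m m := ⟨Polynomial.X, fun a => by simp⟩

theorem add (hf : PolyBdd m f) (hg : PolyBdd m g) : PolyBdd m fun a => f a + g a := by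
  obtain ⟨p, hp⟩ := hf
  obtain ⟨q, hq⟩ := hg
  exact ⟨p + q, fun a => by simpa using add_le_add (hp a) (hq a)⟩

theorem mul (hf : PolyBdd m f) (hg : PolyBdd m g) : PolyBdd m fun a => f a * g a := by
  obtain ⟨p, hp⟩ := hf
  obtain ⟨q, hq⟩ := hg
  exact ⟨p * q, fun a => by simpa using Nat.mul_le_mul (hp a) (hq a)⟩

theorem eval (q : ℕ[X]) (hf : PolyBdd m f) : PolyBdd m fun a => q.eval (f a) := by
  obtain ⟨p, hp⟩ := hf
  exact ⟨q.comp p, fun a => by simpa using eval_mono q (hp a)⟩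

theorem trans (h : PolyBdd m f) (hm : PolyBdd m' m) : PolyBdd m' f := by
  obtain ⟨p, hp⟩ := h
  exact (hm.eval p).mono hp

theorem reindex (h : PolyBdd m f) (j : β → α) : PolyBdd (fun b => m (j b)) fun b => f (j b) := by
  obtain ⟨p, hp⟩ := h
  exact ⟨p, fun b => hp (j b)⟩

end PolyBdd

/-! ## Closure properties of efficient computability -/

theorem ec_iff {α : Type} {m : α → ℕ} {inp out : α → Val} :
    EfficientlyComputable m inp out ↔ ∃ (P : Prog Empty) (p : ℕ[X]), ∀ a, ∃ c ≤ p.eval (m a),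
      P.den noEv (inp a) = PMF.pure (out a, c) := by
  simp only [EfficientlyComputable, Prog.runPlain_eq_den]

namespace EfficientlyComputable

variable {α β : Type} {m m' : α → ℕ} {inp out out₁ out₂ A : α → Val}

theorem of_bound (P : Prog Empty) {cost : α → ℕ} (hc : PolyBdd m cost)
    (h : ∀ a, ∃ c ≤ cost a, P.den noEv (inp a) = PMF.pure (out a, c)) :
    EfficientlyComputable m inp out := by
  obtain ⟨p, hp⟩ := hc
  refine ec_iff.2 ⟨P, p, fun a => ?_⟩
  obtain ⟨c, h1, h2⟩ := h a
  exact ⟨c, h1.trans (hp a), h2⟩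

theorem exists_cost (h : EfficientlyComputable m inp out) :
    ∃ (P : Prog Empty) (cost : α → ℕ), PolyBdd m cost ∧
      ∀ a, P.den noEv (inp a) = PMF.pure (out a, cost a) := by
  obtain ⟨P, p, h⟩ := ec_iff.1 h
  choose c hc hd using h
  exact ⟨P, c, ⟨p, hc⟩, hd⟩

theorem size_le_cost {P : Prog Empty} {x y : Val} {c : ℕ} (h : P.den noEv x = PMF.pure (y, c)) :
    x.size ≤ c ∧ y.size ≤ c :=
  P.size_le_of_mem_support_den noEv x (y, c) (by rw [h]; simp)

theorem size_inp (h : EfficientlyComputable m inp out) : PolyBdd m fun a => (inp a).size := by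
  obtain ⟨P, c, hc, hP⟩ := h.exists_cost
  exact hc.mono fun a => (size_le_cost (hP a)).1

theorem size_out (h : EfficientlyComputable m inp out) : PolyBdd m fun a => (out a).size := by
  obtain ⟨P, c, hc, hP⟩ := h.exists_cost
  exact hc.mono fun a => (size_le_cost (hP a)).2

theorem congr (h : EfficientlyComputable m inp out) (e : ∀ a, out a = out₁ a) :
    EfficientlyComputable m inp out₁ := (funext e : out = out₁) ▸ h

theorem reindex (h : EfficientlyComputable m inp out) (j : β → α) :
    EfficientlyComputable (fun b => m (j b)) (fun b => inp (j b)) fun b => out (j b) := by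
  obtain ⟨P, p, h⟩ := h
  exact ⟨P, p, fun b => h (j b)⟩

theorem measure (h : EfficientlyComputable m inp out) (hm : PolyBdd m' m) :
    EfficientlyComputable m' inp out := by
  obtain ⟨P, c, hc, hP⟩ := h.exists_cost
  exact of_bound P (hc.trans hm) fun a => ⟨c a, le_rfl, hP a⟩

theorem id (h : PolyBdd m fun a => (inp a).size) : EfficientlyComputable m inp inp :=
  of_bound .id ((h.add h).add (.const 1)) fun _ => ⟨_, le_rfl, rfl⟩

theorem const (h : PolyBdd m fun a => (inp a).size) (v : Val) :
    EfficientlyComputable m inp fun _ => v :=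
  of_bound (.const v) ((h.add (.const v.size)).add (.const 1)) fun _ => ⟨_, le_rfl, rfl⟩

theorem comp (h₁ : EfficientlyComputable m inp A) (h₂ : EfficientlyComputable m A out) :
    EfficientlyComputable m inp out := by
  obtain ⟨P, c, hc, hP⟩ := h₁.exists_cost
  obtain ⟨Q, d, hd, hQ⟩ := h₂.exists_cost
  refine of_bound (.seq P Q) ((hc.add hd).add (.const 1)) fun a => ⟨_, le_rfl, ?_⟩
  rw [Prog.den_seq, hP, PMF.pure_bind]
  simp only [hQ, PMF.pure_map]

theorem pair (h₁ : EfficientlyComputable m inp out₁) (h₂ : EfficientlyComputable m inp out₂) :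
    EfficientlyComputable m inp fun a => .pair (out₁ a) (out₂ a) := by
  obtain ⟨P, c, hc, hP⟩ := h₁.exists_cost
  obtain ⟨Q, d, hd, hQ⟩ := h₂.exists_cost
  refine of_bound (.fork P Q) ((hc.add hd).add (.const 1)) fun a => ⟨_, le_rfl, ?_⟩
  rw [Prog.den_fork, hP, PMF.pure_bind]
  simp only [hQ, PMF.pure_map]

theorem fst (h : EfficientlyComputable m inp out) :
    EfficientlyComputable m inp fun a => (out a).fst :=
  h.comp (of_bound .fst ((h.size_out.add h.size_out).add (.const 1)) fun a =>
    ⟨_, by have := (out a).size_fst_le; simp only [stepCost]; omega, rfl⟩)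

theorem snd (h : EfficientlyComputable m inp out) :
    EfficientlyComputable m inp fun a => (out a).snd :=
  h.comp (of_bound .snd ((h.size_out.add h.size_out).add (.const 1)) fun a =>
    ⟨_, by have := (out a).size_snd_le; simp only [stepCost]; omega, rfl⟩)

theorem isNum (h : EfficientlyComputable m inp out) :
    EfficientlyComputable m inp fun a => (out a).isNum :=
  h.comp (of_bound .isNum ((h.size_out.add (.const 2)).add (.const 1)) fun a =>
    ⟨_, by have := (out a).size_isNum_le; simp only [stepCost]; omega, rfl⟩)

theorem size_toNat_le (x : Val) : x.toNat.size + 1 ≤ x.size := by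
  cases x
  · simp [Val.toNat]
  · rename_i a b
    have := a.size_pos
    simp [Val.toNat]

theorem size_arith_le (o : Arith) (a b : ℕ) : (o.eval a b).size ≤ a.size + b.size + 1 := by
  have ha := Nat.lt_size_self a
  have hb := Nat.lt_size_self b
  rw [Nat.size_le]
  have hA : 2 ^ a.size ≤ 2 ^ (a.size + b.size) := Nat.pow_le_pow_right (by norm_num) (by omega)
  have hB : 2 ^ b.size ≤ 2 ^ (a.size + b.size) := Nat.pow_le_pow_right (by norm_num) (by omega)
  rw [pow_succ]
  cases o <;> simp only [Arith.eval]
  · omega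
  · omega
  · have : a * b < 2 ^ (a.size + b.size) := by rw [pow_add]; gcongr
    omega
  · have := Nat.div_le_self a b
    omega
  · have := Nat.mod_le a b
    omega

theorem arith (o : Arith) (h₁ : EfficientlyComputable m inp out₁)
    (h₂ : EfficientlyComputable m inp out₂) :
    EfficientlyComputable m inp fun a => .num (o.eval (out₁ a).toNat (out₂ a).toNat) := by
  refine (h₁.pair h₂).comp (of_bound (.arith o) ((((h₁.size_out.add h₂.size_out).add
    (.const 1)).add (((h₁.size_out.add h₂.size_out).add (.const 1)).add (.const 1))).add
    (.const 1)) fun a => ⟨_, ?_, rfl⟩)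
  have := size_arith_le o (out₁ a).toNat (out₂ a).toNat
  have h3 := size_toNat_le (out₁ a)
  have h4 := size_toNat_le (out₂ a)
  simp only [stepCost, Val.size_pair, Val.size_num, Val.fst_pair, Val.snd_pair]
  omega

theorem add {f g : α → ℕ} (hf : EfficientlyComputable m inp fun a => .num (f a))
    (hg : EfficientlyComputable m inp fun a => .num (g a)) :
    EfficientlyComputable m inp fun a => .num (f a + g a) := hf.arith .add hg

theorem sub {f g : α → ℕ} (hf : EfficientlyComputable m inp fun a => .num (f a))
    (hg : EfficientlyComputable m inp fun a => .num (g a)) :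
    EfficientlyComputable m inp fun a => .num (f a - g a) := hf.arith .sub hg

theorem mul {f g : α → ℕ} (hf : EfficientlyComputable m inp fun a => .num (f a))
    (hg : EfficientlyComputable m inp fun a => .num (g a)) :
    EfficientlyComputable m inp fun a => .num (f a * g a) := hf.arith .mul hg

theorem div {f g : α → ℕ} (hf : EfficientlyComputable m inp fun a => .num (f a))
    (hg : EfficientlyComputable m inp fun a => .num (g a)) :
    EfficientlyComputable m inp fun a => .num (f a / g a) := hf.arith .div hg

theorem mod {f g : α → ℕ} (hf : EfficientlyComputable m inp fun a => .num (f a))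
    (hg : EfficientlyComputable m inp fun a => .num (g a)) :
    EfficientlyComputable m inp fun a => .num (f a % g a) := hf.arith .mod hg

theorem toNat (h : EfficientlyComputable m inp out) :
    EfficientlyComputable m inp fun a => .num (out a).toNat :=
  (h.arith .add (const h.size_inp (.num 0))).congr fun _ => rfl

theorem ite {C : α → Val} {p : α → Prop} [DecidablePred p] (hc : EfficientlyComputable m inp C)
    (hp : ∀ a, C a = .num 0 ↔ p a) (h₁ : EfficientlyComputable m inp out₁)
    (h₂ : EfficientlyComputable m inp out₂) :
    EfficientlyComputable m inp fun a => if p a then out₁ a else out₂ a := by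
  obtain ⟨R, e, he, hR⟩ := hc.exists_cost
  obtain ⟨P, c, hc, hP⟩ := h₁.exists_cost
  obtain ⟨Q, d, hd, hQ⟩ := h₂.exists_cost
  refine of_bound (.ifz R P Q) ((he.add (hc.add hd)).add (.const 1)) fun a => ?_
  rw [Prog.den_ifz, hR, PMF.pure_bind]
  by_cases h : p a
  · simp only [(hp a).2 h, h, if_true, hP, PMF.pure_map]
    exact ⟨_, by omega, rfl⟩
  · simp only [mt (hp a).1 h, h, if_false, hQ, PMF.pure_map]
    exact ⟨_, by omega, rfl⟩

/-- The input is carried along with the loop state, so each step may use it. The sizes of the states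
need no separate bound: the cost of a step bounds what it reads and writes. -/
theorem loop {n : α → ℕ} {s : α → ℕ → Val} (hn : PolyBdd m n)
    (hin : EfficientlyComputable m inp fun a => .num (n a))
    (h₀ : EfficientlyComputable m inp fun a => s a 0)
    (hs : EfficientlyComputable (α := Σ a, Fin (n a)) (fun q => m q.1)
      (fun q => .pair (inp q.1) (s q.1 q.2)) fun q => s q.1 (q.2 + 1)) :
    EfficientlyComputable m inp fun a => s a (n a) := by
  obtain ⟨P, c, hc, hP⟩ := h₀.exists_cost
  obtain ⟨Q, d, ⟨q, hd⟩, hQ⟩ := hs.exists_cost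
  -- Here `j` counts the iterations that are left. One iteration runs `Q` for at most `q`, and
  -- copying the input costs at most `2 * q + 1`, since the cost of `Q` bounds the size of the pair
  -- it reads; one more unit is for the pairing.
  have key : ∀ a j, j ≤ n a → ∃ C ≤ j * (3 * q.eval (m a) + 2),
      iterDen ((Prog.fork .fst Q).den noEv) j (.pair (inp a) (s a (n a - j))) =
        PMF.pure (.pair (inp a) (s a (n a)), C) := by
    intro a j
    induction j with
    | zero => intro _; exact ⟨0, by simp, rfl⟩
    | succ j ih =>
      intro hj
      obtain ⟨C, hC, hD⟩ := ih (by omega)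
      let i : Σ a, Fin (n a) := ⟨a, ⟨n a - (j + 1), by omega⟩⟩
      have h1 := hQ i
      have h2 := (size_le_cost h1).1
      have h3 := hd i
      have h4 : n a - (j + 1) + 1 = n a - j := by omega
      simp only [i, h4] at h1 h2 h3
      rw [iterDen, Prog.den_fork, Prog.den_fst, PMF.pure_bind, h1]
      simp only [PMF.pure_map, PMF.pure_bind, Val.fst_pair, hD]
      refine ⟨_, ?_, rfl⟩
      simp only [stepCost, Val.size_pair] at h2 ⊢
      rw [add_mul, one_mul]
      omega
  have hq : PolyBdd m fun a => q.eval (m a) := PolyBdd.eval q .self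
  have hsz : PolyBdd m fun a => (s a (n a)).size := by
    refine (h₀.size_out.add hq).mono fun a => ?_
    rcases Nat.eq_zero_or_pos (n a) with h | h
    · simp [h]
    · have h1 := hQ ⟨a, ⟨n a - 1, by omega⟩⟩
      have h2 := (size_le_cost h1).2
      have h3 := hd ⟨a, ⟨n a - 1, by omega⟩⟩
      have h4 : n a - 1 + 1 = n a := by omega
      simp only [h4] at h2 h3
      omega
  have hin' := (hin.pair ((id hin.size_inp).pair h₀)).size_out
  have h2 : EfficientlyComputable m (fun a => .pair (.num (n a)) (.pair (inp a) (s a 0)))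
      fun a => .pair (inp a) (s a (n a)) := by
    refine of_bound (.iter (.fork .fst Q))
      ((hn.mul (((PolyBdd.const 3).mul hq).add (.const 2))).add
        ((hin'.add ((hin.size_inp.add hsz).add (.const 1))).add (.const 1))) fun a => ?_
    obtain ⟨C, hC, hD⟩ := key a (n a) le_rfl
    rw [Nat.sub_self] at hD
    rw [Prog.den_iter]
    simp only [Val.fst_pair, Val.snd_pair, Val.toNat_num, hD, PMF.pure_map]
    refine ⟨_, ?_, rfl⟩
    simp only [stepCost, Val.size_pair]
    omega
  exact ((hin.pair ((id hin.size_inp).pair h₀)).comp h2).snd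

/-- Inside a loop, whatever can be computed from the context is available. -/
theorem inLoop {n : α → ℕ} {s : α → ℕ → Val} (h : EfficientlyComputable m inp out)
    (hs : PolyBdd (α := Σ a, Fin (n a)) (fun q => m q.1) fun q => (s q.1 q.2).size) :
    EfficientlyComputable (α := Σ a, Fin (n a)) (fun q => m q.1)
      (fun q => .pair (inp q.1) (s q.1 q.2)) fun q => out q.1 :=
  (id (((h.size_inp.reindex Sigma.fst).add hs).add (.const 1))).fst.comp (h.reindex Sigma.fst)

theorem loopState {n : α → ℕ} {s : α → ℕ → Val} (h : PolyBdd m fun a => (inp a).size)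
    (hs : PolyBdd (α := Σ a, Fin (n a)) (fun q => m q.1) fun q => (s q.1 q.2).size) :
    EfficientlyComputable (α := Σ a, Fin (n a)) (fun q => m q.1)
      (fun q => .pair (inp q.1) (s q.1 q.2)) fun q => s q.1 q.2 :=
  (id (((h.reindex Sigma.fst).add hs).add (.const 1))).snd

end EfficientlyComputable

/-! ## Lists and bit strings -/

namespace Val

/-- The entries of a list. -/
def elems : Val → List Val
  | num _ => []
  | pair a b => a :: b.elems

/-- Total size of the entries of a list. -/
def weight (l : List Val) : ℕ := (l.map fun v => v.size + 1).sum

end Val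

def listVal : List Val → Val
  | [] => .num 0
  | a :: l => .pair a (listVal l)

namespace Val

@[simp] theorem elems_listVal (l : List Val) : (listVal l).elems = l := by
  induction l with
  | nil => rfl
  | cons a l ih => simp [listVal, elems, ih]

theorem toBits_eq (x : Val) : x.toBits = x.elems.map fun v => decide (v.toNat ≠ 0) := by
  induction x with
  | num n => rfl
  | pair a b _ ih => simp [toBits, elems, ih]

@[simp] theorem toBits_listVal (l : List Val) :
    (listVal l).toBits = l.map fun v => decide (v.toNat ≠ 0) := by
  rw [toBits_eq, elems_listVal]

theorem ofBits_eq_listVal (l : List Bool) : ofBits l = listVal (l.map fun b => .num b.toNat) := by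
  induction l with
  | nil => rfl
  | cons b l ih => simp [ofBits, listVal, ih]

theorem weight_append (l l' : List Val) : weight (l ++ l') = weight l + weight l' := by
  simp [weight]

theorem weight_reverse (l : List Val) : weight l.reverse = weight l := by
  simp [weight, List.sum_reverse]

theorem weight_take_le (n : ℕ) (l : List Val) : weight (l.take n) ≤ weight l := by
  conv_rhs => rw [← List.take_append_drop n l, weight_append]
  omega

theorem size_listVal (l : List Val) : (listVal l).size = weight l + 2 - 1 := by
  induction l with
  | nil => simp [listVal, weight]
  | cons a l ih =>
    simp only [listVal, size_pair, ih, weight, List.map_cons, List.sum_cons]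
    omega

theorem weight_elems_lt (x : Val) : weight x.elems < x.size := by
  induction x with
  | num n => simp [elems, weight]
  | pair a b _ ih =>
    simp only [elems, size_pair, weight, List.map_cons, List.sum_cons] at ih ⊢
    omega

theorem length_le_weight (l : List Val) : l.length ≤ weight l := by
  induction l with
  | nil => simp
  | cons a l ih => simp only [weight, List.map_cons, List.sum_cons, List.length_cons] at ih ⊢; omega

theorem length_elems_le (x : Val) : x.elems.length ≤ x.size :=
  (length_le_weight _).trans (weight_elems_lt x).le

theorem snd_iterate_size_le (n : ℕ) (x : Val) : (snd^[n] x).size ≤ x.size := by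
  induction n generalizing x with
  | zero => rfl
  | succ n ih => exact (ih x.snd).trans x.size_snd_le

theorem elems_snd (x : Val) : x.snd.elems = x.elems.tail := by
  cases x <;> rfl

theorem elems_snd_iterate (n : ℕ) (x : Val) : (snd^[n] x).elems = x.elems.drop n := by
  induction n generalizing x with
  | zero => rfl
  | succ n ih => rw [Function.iterate_succ_apply, ih, elems_snd, List.drop_tail]

theorem isNum_eq_zero_iff (x : Val) : x.isNum = num 0 ↔ ∃ a b, x = pair a b := by
  cases x <;> simp [isNum]

/-- 0 for a leaf, 1 or 2 for a pair, depending on the bit in its first component. -/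
def bitTag (x : Val) : ℕ := (1 - x.isNum.toNat) * (2 - (1 - x.fst.toNat))

/-- Number of mismatches among the first `n` places of two bit strings. -/
def bitDiff (n : ℕ) (x y : Val) : ℕ :=
  ∑ i ∈ Finset.range n, ((snd^[i] x).bitTag - (snd^[i] y).bitTag +
    ((snd^[i] y).bitTag - (snd^[i] x).bitTag))

/-- Keys of the random oracle must be compared as bit strings, since different values may represent
the same string. The tags `0`, `1`, `2` stand for the end of the string and the two bits; the two
truncated differences add up to the distance of the tags. -/
theorem bitDiff_eq_zero_iff {n : ℕ} {x y : Val} (hx : x.elems.length ≤ n)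
    (hy : y.elems.length ≤ n) : bitDiff n x y = 0 ↔ x.toBits = y.toBits := by
  induction n generalizing x y with
  | zero =>
    cases x <;> cases y <;> simp_all [elems, bitDiff, toBits]
  | succ n ih =>
    rw [bitDiff, Finset.sum_range_succ']
    have h := @ih x.snd y.snd (by rw [elems_snd, List.length_tail]; omega)
      (by rw [elems_snd, List.length_tail]; omega)
    rw [bitDiff] at h
    simp only [Function.iterate_succ_apply, Nat.add_eq_zero_iff, h, Function.iterate_zero, _root_.id]
    cases x <;> cases y <;> simp [bitTag, isNum, fst, snd, toBits]
    · omega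
    · omega
    · rename_i a b c d
      generalize toNat a = p
      generalize toNat c = q
      rw [and_comm, and_congr_left_iff]
      intro _
      constructor
      · intro h; constructor <;> omega
      · intro h; omega

end Val

namespace EfficientlyComputable

variable {α : Type} {m : α → ℕ} {inp : α → Val}

theorem polyEval {f : α → ℕ} (q : ℕ[X]) (hf : EfficientlyComputable m inp fun a => .num (f a)) :
    EfficientlyComputable m inp fun a => .num (q.eval (f a)) := by
  induction q using Polynomial.induction_on with
  | C c => exact (const hf.size_inp (.num c)).congr fun a => by simp
  | add p q hp hq => exact (hp.add hq).congr fun a => by simp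
  | monomial n c h => exact (h.mul hf).congr fun a => by simp [pow_succ, mul_assoc]

/-- The loop state consists of the rest of `x` and of the entries already moved, which pile up on
`l` in reverse order. Once `x` is exhausted the loop idles, so `n` may exceed its length. Two passes
concatenate lists. -/
theorem revTake {x : α → Val} {l : α → List Val} {n : α → ℕ} (hn : PolyBdd m n)
    (hnc : EfficientlyComputable m inp fun a => .num (n a)) (hx : EfficientlyComputable m inp x)
    (hl : EfficientlyComputable m inp fun a => listVal (l a)) :
    EfficientlyComputable m inp fun a => listVal (((x a).elems.take (n a)).reverse ++ l a) := by
  have hsz : PolyBdd (α := Σ a, Fin (n a)) (fun q => m q.1) fun q =>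
      (Val.pair (Val.snd^[q.2] (x q.1))
        (listVal (((x q.1).elems.take q.2).reverse ++ l q.1))).size := by
    refine (((hx.size_out.add (hx.size_out.add hl.size_out)).add (.const 2)).reindex
      Sigma.fst).mono fun q => ?_
    have h1 := Val.snd_iterate_size_le q.2 (x q.1)
    have h2 := Val.weight_take_le q.2 (x q.1).elems
    have h3 := Val.weight_elems_lt (x q.1)
    simp only [Val.size_pair, Val.size_listVal, Val.weight_append, Val.weight_reverse]
    omega
  have hst := loopState (s := fun a i => Val.pair (Val.snd^[i] (x a))
    (listVal (((x a).elems.take i).reverse ++ l a))) hnc.size_inp hsz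
  refine (loop (s := fun a i => Val.pair (Val.snd^[i] (x a))
    (listVal (((x a).elems.take i).reverse ++ l a))) hn hnc
    ((hx.pair hl).congr fun a => by simp) ?_).snd
  classical
  refine ((hst.fst.snd).pair (ite (p := fun q => ∃ b c, Val.snd^[q.2] (x q.1) = .pair b c)
    (hst.fst.isNum) (fun q => Val.isNum_eq_zero_iff _) (hst.fst.fst.pair hst.snd) hst.snd)).congr ?_
  rintro ⟨a, i, hi⟩
  simp only [Val.fst_pair, Val.snd_pair, Function.iterate_succ_apply']
  congr 1
  have h1 := Val.elems_snd_iterate i (x a)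
  split_ifs with h
  · obtain ⟨b, c, h⟩ := h
    rw [h] at h1 ⊢
    rw [Val.elems] at h1
    have h2 : (x a).elems.take (i + 1) = (x a).elems.take i ++ [b] := by
      rw [List.take_add, ← h1]; simp
    rw [h2]
    simp [listVal]
  · have h2 : (x a).elems.drop i = [] := by
      rw [← h1]
      rcases h3 : Val.snd^[i] (x a) with n | ⟨b, c⟩
      · rfl
      · exact absurd ⟨b, c, h3⟩ h
    have h3 : (x a).elems.length ≤ i := by simpa using h2
    rw [List.take_of_length_le h3, List.take_of_length_le (h3.trans i.le_succ)]

theorem append {x : α → Val} {l : α → List Val} {n : α → ℕ} (hn : PolyBdd m n)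
    (hnc : EfficientlyComputable m inp fun a => .num (n a)) (hx : EfficientlyComputable m inp x)
    (hl : EfficientlyComputable m inp fun a => listVal (l a))
    (hxn : ∀ a, (x a).elems.length ≤ n a) :
    EfficientlyComputable m inp fun a => listVal ((x a).elems ++ l a) := by
  have h := revTake (l := fun _ => []) hn hnc hx (const hx.size_inp (.num 0))
  refine (revTake hn hnc h hl).congr fun a => ?_
  have h2 : (x a).elems.reverse.length ≤ n a := by simpa using hxn a
  simp [List.take_of_length_le (hxn a), List.take_of_length_le h2]

theorem bitDiff {x y : α → Val} {n : α → ℕ} (hn : PolyBdd m n)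
    (hnc : EfficientlyComputable m inp fun a => .num (n a)) (hx : EfficientlyComputable m inp x)
    (hy : EfficientlyComputable m inp y) :
    EfficientlyComputable m inp fun a => .num (Val.bitDiff (n a) (x a) (y a)) := by
  have tag_le : ∀ x : Val, x.bitTag ≤ 2 := fun x => by
    rw [Val.bitTag]
    calc _ ≤ 1 * 2 := Nat.mul_le_mul (by omega) (by omega)
      _ = 2 := rfl
  have hsz : PolyBdd (α := Σ a, Fin (n a)) (fun q => m q.1) fun q =>
      (Val.pair (.num (Val.bitDiff q.2 (x q.1) (y q.1)))
        (.pair (Val.snd^[q.2] (x q.1)) (Val.snd^[q.2] (y q.1)))).size := by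
    refine (((((PolyBdd.const 4).mul hn).add (hx.size_out.add hy.size_out)).add
      (.const 10)).reindex Sigma.fst).mono fun q => ?_
    have h1 := Val.snd_iterate_size_le q.2 (x q.1)
    have h2 := Val.snd_iterate_size_le q.2 (y q.1)
    have h3 : Val.bitDiff q.2 (x q.1) (y q.1) ≤ 4 * n q.1 := by
      calc _ ≤ ∑ i ∈ Finset.range q.2.1, (4 : ℕ) := Finset.sum_le_sum fun i _ => by
            have h4 := tag_le (Val.snd^[i] (x q.1))
            have h5 := tag_le (Val.snd^[i] (y q.1))
            omega
        _ = q.2.1 * 4 := by simp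
        _ ≤ _ := by have := q.2.2; omega
    have h4 : (Val.bitDiff q.2 (x q.1) (y q.1)).size ≤ 4 * n q.1 :=
      (Nat.size_le_size h3).trans (Nat.size_le.2 Nat.lt_two_pow_self)
    simp only [Val.size_pair, Val.size_num]
    omega
  have hst := loopState (s := fun a i => Val.pair (.num (Val.bitDiff i (x a) (y a)))
        (.pair (Val.snd^[i] (x a)) (Val.snd^[i] (y a)))) hnc.size_inp hsz
  have tag : ∀ {β : Type} {m : β → ℕ} {inp z : β → Val}, EfficientlyComputable m inp z →
      EfficientlyComputable m inp fun b => .num (z b).bitTag := fun h =>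
    ((const h.size_inp (.num 1)).sub h.isNum.toNat).mul
      ((const h.size_inp (.num 2)).sub ((const h.size_inp (.num 1)).sub h.fst.toNat))
  refine (loop (s := fun a i => Val.pair (.num (Val.bitDiff i (x a) (y a)))
        (.pair (Val.snd^[i] (x a)) (Val.snd^[i] (y a)))) hn hnc
    (((const hx.size_inp (.num 0)).pair (hx.pair hy)).congr fun a => by simp [Val.bitDiff]) ?_).fst
  have hu := tag hst.snd.fst
  have hv := tag hst.snd.snd
  refine ((hst.fst.add ((hu.sub hv).add (hv.sub hu))).pair
    (hst.snd.fst.snd.pair hst.snd.snd.snd)).congr ?_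
  rintro ⟨a, i, hi⟩
  simp only [Val.fst_pair, Val.snd_pair, Function.iterate_succ_apply', Val.bitDiff,
    Finset.sum_range_succ]

/-- Result of a search: `0` or the value found. -/
def _root_.BPVSchnorr.foundVal : Option (Val × Val) → Val
  | none => .num 0
  | some e => .pair (.num 0) e.2

/-- Linear search. The number `n a` serves both as the number of iterations over the table and as
the number of places at which keys are compared. -/
theorem lookup {x : α → Val} {T : α → List (Val × Val)} {n : α → ℕ} (hn : PolyBdd m n)
    (hnc : EfficientlyComputable m inp fun a => .num (n a)) (hx : EfficientlyComputable m inp x)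
    (hT : EfficientlyComputable m inp fun a => listVal ((T a).map fun e => .pair e.1 e.2))
    (hxn : ∀ a, (x a).elems.length ≤ n a) (hTn : ∀ a, (T a).length ≤ n a)
    (hTk : ∀ a, ∀ e ∈ T a, e.1.elems.length ≤ n a) :
    EfficientlyComputable m inp fun a =>
      foundVal ((T a).find? fun e => e.1.toBits = (x a).toBits) := by
  set tv : α → Val := fun a => listVal ((T a).map fun e => .pair e.1 e.2) with htv
  set s : α → ℕ → Val := fun a i =>
    .pair (foundVal (((T a).take i).find? fun e => e.1.toBits = (x a).toBits))
      (Val.snd^[i] (tv a)) with hs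
  have hfsz : ∀ a i, (foundVal (((T a).take i).find? fun e => e.1.toBits = (x a).toBits)).size ≤
      (tv a).size + 2 := by
    intro a i
    rcases h : ((T a).take i).find? fun e => e.1.toBits = (x a).toBits with _ | e
    · rw [h]; simp [foundVal]
    · rw [h]
      have h1 := List.mem_of_mem_take (List.mem_of_find?_eq_some h)
      have h2 : Val.size (.pair e.1 e.2) + 1 ≤ Val.weight ((T a).map fun e => .pair e.1 e.2) :=
        List.single_le_sum (by simp) _ (by
          simp only [List.map_map, List.mem_map]
          exact ⟨e, h1, rfl⟩)
      simp only [htv, foundVal, Val.size_listVal, Val.size_pair, Val.size_num] at h2 ⊢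
      simp only [Nat.size_zero]
      omega
  have hsz : PolyBdd (α := Σ a, Fin (n a)) (fun q => m q.1) fun q => (s q.1 q.2).size := by
    refine (((hT.size_out.add hT.size_out).add (.const 3)).reindex Sigma.fst).mono fun q => ?_
    have h1 := hfsz q.1 q.2
    have h2 := Val.snd_iterate_size_le q.2 (tv q.1)
    simp only [hs, Val.size_pair]
    omega
  have hst := loopState (s := s) hnc.size_inp hsz
  refine (loop (s := s) hn hnc (((const hx.size_inp (.num 0)).pair hT).congr fun a => by
    simp [hs, foundVal, htv]) ?_).fst.congr fun a => by
    simp only [hs, Val.fst_pair, List.take_of_length_le (hTn a)]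
  have hd := bitDiff (hn.reindex Sigma.fst) (hnc.inLoop hsz) (hx.inLoop hsz) hst.snd.fst.fst
  classical
  -- An earlier match is kept. Otherwise, if the table is not exhausted, the key of its current head
  -- is compared with `x`.
  refine ((ite (p := fun q => ∃ b c, (s q.1 q.2).fst = .pair b c) hst.fst.isNum
    (fun q => Val.isNum_eq_zero_iff _) hst.fst
    (ite (p := fun q => ∃ b c, (s q.1 q.2).snd = .pair b c) hst.snd.isNum
      (fun q => Val.isNum_eq_zero_iff _)
      (ite (p := fun q => Val.bitDiff (n q.1) (x q.1) (s q.1 q.2).snd.fst.fst = 0) hd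
        (fun q => by simp) ((const hst.size_inp (.num 0)).pair hst.snd.fst.snd)
        hst.fst) hst.fst)).pair hst.snd.snd).congr ?_
  rintro ⟨a, i, hi⟩
  simp only [hs, Val.fst_pair, Val.snd_pair, Function.iterate_succ_apply']
  congr 1
  have h1 := Val.elems_snd_iterate i (tv a)
  simp only [htv, Val.elems_listVal, ← List.map_drop] at h1
  by_cases hlt : i < (T a).length
  · have h2 : (T a).take (i + 1) = (T a).take i ++ [(T a)[i]] := by
      rw [List.take_succ_eq_append_getElem hlt]
    rw [List.drop_eq_getElem_cons hlt, List.map_cons] at h1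
    rw [h2, List.find?_append]
    rcases h : ((T a).take i).find? fun e => e.1.toBits = (x a).toBits with _ | e
    · rw [h]
      rcases h3 : Val.snd^[i] (tv a) with k | ⟨b, c⟩
      · rw [htv] at h3; simp only at h3; rw [h3] at h1; simp [Val.elems] at h1
      · rw [htv] at h3
        simp only at h3
        rw [h3] at h1
        simp only [Val.elems, List.cons.injEq] at h1
        have h4 := Val.bitDiff_eq_zero_iff (hxn a) (hTk a _ (List.getElem_mem hlt))
        by_cases h5 : (T a)[i].1.toBits = (x a).toBits
        · simp [foundVal, h1.1, h5, h4.2 h5.symm]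
        · have h6 := mt h4.1 (Ne.symm h5)
          simp [foundVal, h1.1, h5, h6]
    · rw [h]; simp [foundVal]
  · rw [List.take_of_length_le (by omega : (T a).length ≤ i + 1),
      List.take_of_length_le (by omega : (T a).length ≤ i)]
    rw [List.drop_of_length_le (by omega)] at h1
    have h2 : ¬ ∃ b c, Val.snd^[i] (tv a) = .pair b c := by
      rintro ⟨b, c, h⟩
      rw [htv] at h; simp only at h; rw [h] at h1; simp [Val.elems] at h1
    rw [if_neg h2]
    split_ifs <;> rfl

end EfficientlyComputable

/-! ## Fast exponentiation, group operations, arithmetic modulo a prime -/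

namespace EfficientlyComputable

variable {α : Type} {m : α → ℕ} {inp : α → Val}

/-- Square and multiply, with the invariant `(n / 2 ^ i, base ^ (1 + n % 2 ^ i), base ^ 2 ^ i)`. The
accumulator starts with `base` instead of `1`, whence the exponent `n + 1`: an encoding of the
neutral element is never needed. -/
theorem binPow {M : α → Type} [∀ a, Monoid (M a)] {e : ∀ a, M a → Val} {ctx : α → Val}
    (hmul : EfficientlyComputable (α := Σ a, M a × M a) (fun q => m q.1)
      (fun q => .pair (ctx q.1) (.pair (e q.1 q.2.1) (e q.1 q.2.2)))
      fun q => e q.1 (q.2.1 * q.2.2))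
    {base : ∀ a, M a} {n L : α → ℕ} (hL : PolyBdd m L) (hnL : ∀ a, n a < 2 ^ L a)
    (hctx : EfficientlyComputable m inp ctx)
    (hb : EfficientlyComputable m inp fun a => e a (base a))
    (hn : EfficientlyComputable m inp fun a => .num (n a))
    (hLc : EfficientlyComputable m inp fun a => .num (L a)) :
    EfficientlyComputable m inp fun a => e a (base a ^ (n a + 1)) := by
  set s : α → ℕ → Val := fun a i => .pair (.num (n a / 2 ^ i))
    (.pair (e a (base a ^ (1 + n a % 2 ^ i))) (e a (base a ^ 2 ^ i))) with hs
  have hsz : PolyBdd (α := Σ a, Fin (L a)) (fun q => m q.1) fun q => (s q.1 q.2).size := by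
    have h1 := hmul.size_inp.reindex fun q : Σ a, Fin (L a) =>
      (⟨q.1, (base q.1 ^ (1 + n q.1 % 2 ^ (q.2 : ℕ)), base q.1 ^ 2 ^ (q.2 : ℕ))⟩ :
        Σ a, M a × M a)
    refine (h1.add (hn.size_out.reindex Sigma.fst)).mono fun q => ?_
    have h2 := Nat.size_le_size (Nat.div_le_self (n q.1) (2 ^ (q.2 : ℕ)))
    simp only [hs, Val.size_pair, Val.size_num]
    omega
  have hst := loopState (s := s) hn.size_inp hsz
  have hc := hctx.inLoop hsz
  have h2 : EfficientlyComputable (α := Σ a, Fin (L a)) (fun q => m q.1)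
      (fun q => .pair (inp q.1) (s q.1 q.2)) fun _ => .num 2 := const hst.size_inp _
  have hacc := (hc.pair (hst.snd.fst.pair hst.snd.snd)).comp (hmul.reindex
    fun q : Σ a, Fin (L a) => (⟨q.1, (base q.1 ^ (1 + n q.1 % 2 ^ (q.2 : ℕ)),
      base q.1 ^ 2 ^ (q.2 : ℕ))⟩ : Σ a, M a × M a))
  have hsq := (hc.pair (hst.snd.snd.pair hst.snd.snd)).comp (hmul.reindex
    fun q : Σ a, Fin (L a) => (⟨q.1, (base q.1 ^ 2 ^ (q.2 : ℕ),
      base q.1 ^ 2 ^ (q.2 : ℕ))⟩ : Σ a, M a × M a))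
  refine (loop (s := s) hL hLc ((hn.pair (hb.pair hb)).congr fun a => by
    simp [hs, Nat.mod_one]) ?_).snd.fst.congr fun a => by
    simp only [hs, Val.fst_pair, Val.snd_pair, Nat.mod_eq_of_lt (hnL a), add_comm 1]
  refine ((hst.fst.div h2).pair ((ite (p := fun q => n q.1 / 2 ^ (q.2 : ℕ) % 2 = 0)
    (hst.fst.mod h2) (fun q => by simp) hst.snd.fst hacc).pair hsq)).congr ?_
  rintro ⟨a, i, hi⟩
  simp only [hs, Val.fst_pair, Val.snd_pair]
  congr 1
  · rw [Nat.div_div_eq_div_mul, pow_succ]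
  · congr 1
    · rw [Nat.mod_pow_succ]
      split_ifs with h
      · simp [h]
      · rw [← pow_add, show n a / 2 ^ i % 2 = 1 by omega]
        congr 2
        ring
    · rw [← pow_add]; congr 2; ring

end EfficientlyComputable

namespace GroupFamily

variable (𝓖 : GroupFamily) (κ : ℕ)

/-- The part of the public parameters that addition needs. -/
def context : Val := .pair (.num κ) (.pair (.num (𝓖.N κ)) (𝓖.desc κ))

theorem order_smul (A : 𝓖.Pt κ) : 𝓖.N κ • A = 0 := by
  obtain ⟨z, rfl⟩ := AddSubgroup.mem_zmultiples_iff.1 (𝓖.generates κ A)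
  rw [← 𝓖.addOrderOf_G κ, ← natCast_zsmul, smul_comm, natCast_zsmul, addOrderOf_nsmul_eq_zero,
    smul_zero]

end GroupFamily

namespace EfficientlyComputable

variable {α : Type} {m : α → ℕ} {inp : α → Val} {𝓖 : GroupFamily} {κ : α → ℕ}

theorem ptAdd (hκ : PolyBdd m κ) {A B : ∀ a, 𝓖.Pt (κ a)}
    (hctx : EfficientlyComputable m inp fun a => 𝓖.context (κ a))
    (hA : EfficientlyComputable m inp fun a => 𝓖.ptVal (κ a) (A a))
    (hB : EfficientlyComputable m inp fun a => 𝓖.ptVal (κ a) (B a)) :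
    EfficientlyComputable m inp fun a => 𝓖.ptVal (κ a) (A a + B a) :=
  (hctx.pair (hA.pair hB)).comp ((𝓖.add_efficient.reindex fun a : α =>
    (⟨κ a, (A a, B a)⟩ : Σ κ, 𝓖.Pt κ × 𝓖.Pt κ)).measure hκ)

/-- Since `N • A = 0`, the multiple equals `((n + N - 1) + 1) • A`, which has the form that `binPow`
computes, even for `n = 0`. -/
theorem ptNsmul (hκ : PolyBdd m κ) {A : ∀ a, 𝓖.Pt (κ a)} {n F : α → ℕ} (hF : PolyBdd m F)
    (hnF : ∀ a, n a < 2 ^ F a) (hNF : ∀ a, 𝓖.N (κ a) ≤ 2 ^ F a)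
    (hctx : EfficientlyComputable m inp fun a => 𝓖.context (κ a))
    (hA : EfficientlyComputable m inp fun a => 𝓖.ptVal (κ a) (A a))
    (hn : EfficientlyComputable m inp fun a => .num (n a))
    (hFc : EfficientlyComputable m inp fun a => .num (F a)) :
    EfficientlyComputable m inp fun a => 𝓖.ptVal (κ a) (n a • A a) := by
  have h1 : EfficientlyComputable m inp fun _ => .num 1 := const hn.size_inp _
  have hN : EfficientlyComputable m inp fun a => .num (𝓖.N (κ a)) := hctx.snd.fst
  refine (binPow (M := fun a => Multiplicative (𝓖.Pt (κ a)))
    (e := fun a A => 𝓖.ptVal (κ a) A.toAdd) (ctx := fun a => 𝓖.context (κ a))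
    ((𝓖.add_efficient.reindex fun q : Σ a, Multiplicative (𝓖.Pt (κ a)) ×
      Multiplicative (𝓖.Pt (κ a)) => (⟨κ q.1, (q.2.1.toAdd, q.2.2.toAdd)⟩ :
        Σ κ, 𝓖.Pt κ × 𝓖.Pt κ)).measure (hκ.reindex Sigma.fst))
    (base := fun a => .ofAdd (A a)) (n := fun a => n a + 𝓖.N (κ a) - 1) (L := fun a => F a + 1)
    (hF.add (.const 1)) (fun a => ?_) hctx hA ((hn.add hN).sub h1) (hFc.add h1)).congr fun a => ?_
  · have h2 := hnF a
    have h3 := hNF a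
    rw [pow_succ]
    omega
  · have h2 := (𝓖.prime (κ a)).out.pos
    rw [Nat.sub_add_cancel (by omega)]
    simp [add_nsmul, 𝓖.order_smul]

section ZMod

variable {N : α → ℕ} [∀ a, Fact (N a).Prime]

theorem zmodCast {x : α → ℕ} (hN : EfficientlyComputable m inp fun a => .num (N a))
    (hx : EfficientlyComputable m inp fun a => .num (x a)) :
    EfficientlyComputable m inp fun a => .num ((x a : ZMod (N a)).val) :=
  (hx.mod hN).congr fun a => by rw [ZMod.val_natCast]

theorem zmodSub {x y : ∀ a, ZMod (N a)} (hN : EfficientlyComputable m inp fun a => .num (N a))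
    (hx : EfficientlyComputable m inp fun a => .num (x a).val)
    (hy : EfficientlyComputable m inp fun a => .num (y a).val) :
    EfficientlyComputable m inp fun a => .num (x a - y a).val := by
  refine ((hx.add (hN.sub hy)).mod hN).congr fun a => ?_
  have h := (ZMod.val_lt (y a)).le
  rw [← ZMod.val_natCast]
  congr 2
  push_cast [Nat.cast_sub h]
  simp [sub_eq_add_neg]

theorem zmodMul {x y : ∀ a, ZMod (N a)} (hN : EfficientlyComputable m inp fun a => .num (N a))
    (hx : EfficientlyComputable m inp fun a => .num (x a).val)
    (hy : EfficientlyComputable m inp fun a => .num (y a).val) :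
    EfficientlyComputable m inp fun a => .num (x a * y a).val :=
  ((hx.mul hy).mod hN).congr fun a => by rw [ZMod.val_mul]

theorem zmodPow {x : ∀ a, ZMod (N a)} {n F : α → ℕ} (hF : PolyBdd m F)
    (hnF : ∀ a, n a < 2 ^ F a) (hN : EfficientlyComputable m inp fun a => .num (N a))
    (hx : EfficientlyComputable m inp fun a => .num (x a).val)
    (hn : EfficientlyComputable m inp fun a => .num (n a))
    (hFc : EfficientlyComputable m inp fun a => .num (F a)) :
    EfficientlyComputable m inp fun a => .num (x a ^ (n a + 1)).val := by
  have hsz : PolyBdd (α := Σ a, ZMod (N a) × ZMod (N a)) (fun q => m q.1) fun q =>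
      (Val.pair (.num (N q.1)) (.pair (.num q.2.1.val) (.num q.2.2.val))).size := by
    refine (((PolyBdd.const 3).mul (hN.size_out.reindex Sigma.fst)).add (.const 5)).mono
      fun q => ?_
    have h1 := Nat.size_le_size (ZMod.val_lt q.2.1).le
    have h2 := Nat.size_le_size (ZMod.val_lt q.2.2).le
    simp only [Val.size_pair, Val.size_num]
    omega
  have hc := EfficientlyComputable.id hsz
  exact binPow (M := fun a => ZMod (N a)) (e := fun a x => .num x.val) (ctx := fun a => .num (N a))
    (zmodMul hc.fst hc.snd.fst hc.snd.snd) hF hnF hN hx hn hFc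

/-- Solution `x` of `e₁ x + s₁ = e₂ x + s₂`. -/
def _root_.BPVSchnorr.solve {n : ℕ} [Fact n.Prime] (s₁ e₁ s₂ e₂ : ZMod n) : ZMod n :=
  (s₁ - s₂) * (e₂ - e₁) ^ (n - 3 + 1)

theorem zmodSolve {s₁ e₁ s₂ e₂ F : α → ℕ} (hF : PolyBdd m F) (hNF : ∀ a, N a ≤ 2 ^ F a)
    (hN : EfficientlyComputable m inp fun a => .num (N a))
    (hFc : EfficientlyComputable m inp fun a => .num (F a))
    (h₁ : EfficientlyComputable m inp fun a => .num (s₁ a))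
    (h₂ : EfficientlyComputable m inp fun a => .num (e₁ a))
    (h₃ : EfficientlyComputable m inp fun a => .num (s₂ a))
    (h₄ : EfficientlyComputable m inp fun a => .num (e₂ a)) :
    EfficientlyComputable m inp fun a =>
      .num (solve (n := N a) (s₁ a) (e₁ a) (s₂ a) (e₂ a)).val :=
  zmodMul hN (zmodSub hN (zmodCast hN h₁) (zmodCast hN h₃))
    (zmodPow (n := fun a => N a - 3) hF
      (fun a => by
        have h1 := hNF a
        have h2 := (Fact.out : (N a).Prime).pos
        omega) hN
      (zmodSub hN (zmodCast hN h₄) (zmodCast hN h₂)) (hN.sub (const hN.size_inp (.num 3))) hFc)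

end ZMod

end EfficientlyComputable

/-- Division by Fermat's little theorem. The exponent `n - 3 + 1` is `n - 2` for odd `n`; for `n =
2` truncation makes it `1`, which also inverts the only nonzero residue. The form `_ + 1` is the one
required by `zmodPow`. -/
theorem solve_eq {n : ℕ} [Fact n.Prime] {s₁ e₁ s₂ e₂ x : ZMod n} (he : e₁ ≠ e₂)
    (h : e₁ * x + s₁ = e₂ * x + s₂) : solve s₁ e₁ s₂ e₂ = x := by
  have two : ∀ y : ZMod 2, y ≠ 0 → y * y ^ (2 - 3 + 1) = 1 := by decide
  have hp : (e₂ - e₁) * (e₂ - e₁) ^ (n - 3 + 1) = 1 := by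
    have h0 : e₂ - e₁ ≠ 0 := sub_ne_zero.2 he.symm
    rcases (Fact.out : n.Prime).eq_two_or_odd' with rfl | hodd
    · exact two _ h0
    · have h2 := (Fact.out : n.Prime).two_le
      have h3 : n - 3 + 1 + 1 = n - 1 := by
        obtain ⟨k, rfl⟩ := hodd
        omega
      rw [← pow_succ', h3]
      exact ZMod.pow_card_sub_one_eq_one h0
  have h1 : s₁ - s₂ = (e₂ - e₁) * x := by linear_combination h
  rw [solve, h1, mul_right_comm, hp, one_mul]

theorem sq_ex {α : Type*} (μ : PMF α) (f : α → ℝ≥0∞) :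
    ex μ f ^ 2 = ex μ fun a => ex μ fun b => f a * f b := by
  simp only [ex_mul_left, ex_mul_right, pow_two]

/-! ## Forking -/

section Fork

variable {ι ρ σ : Type} (ev : ι → Val → PMF Val) (post : ι → Val → Val → σ → Val × σ)

/-- Oracles that draw a random value and update their state deterministically. -/
noncomputable def machine (i : ι) (x : Val) : PState σ Val := fun a =>
  (ev i x).map fun v => post i x v a

/-- The same oracles with a log of the values drawn (latest first) and a list of values to be
used before new ones are drawn. -/
noncomputable def logMachine (i : ι) (x : Val) : PState (σ × List Val × List Val) Val := fun s =>
  match s.2.2 with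
  | [] => (ev i x).map fun v => ((post i x v s.1).1, (post i x v s.1).2, v :: s.2.1, [])
  | v :: l => PMF.pure ((post i x v s.1).1, (post i x v s.1).2, v :: s.2.1, l)

namespace Tree

/-- Execution that reports the list of values drawn. -/
noncomputable def execLog : Tree ι ρ → σ → PMF ((ρ × σ) × List Val)
  | ret r, a => PMF.pure ((r, a), [])
  | ask i x k, a => (ev i x).bind fun v =>
      ((k (post i x v a).1).execLog (post i x v a).2).map fun q => (q.1, v :: q.2)

/-- Execution that uses given values before it draws new ones. -/
noncomputable def replay : Tree ι ρ → σ → List Val → PMF (ρ × σ)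
  | ret r, a, _ => PMF.pure (r, a)
  | ask i x k, a, [] => (ev i x).bind fun v => (k (post i x v a).1).replay (post i x v a).2 []
  | ask i x k, a, v :: l => (k (post i x v a).1).replay (post i x v a).2 l

/-- Two executions that share the first `n` values drawn. -/
noncomputable def fork (n : ℕ) (t : Tree ι ρ) (a : σ) : PMF ((ρ × σ) × (ρ × σ)) :=
  (t.execLog ev post a).bind fun q =>
    (t.replay ev post a (q.2.take n)).map fun q' => (q.1, q')

variable {ev post}

theorem interp_logMachine (t : Tree ι ρ) (a : σ) (l : List Val) :
    t.interp (logMachine ev post) (a, l, []) =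
      (t.execLog ev post a).map fun q => (q.1.1, q.1.2, q.2.reverse ++ l, []) := by
  induction t generalizing a l with
  | ret r => simp [interp, execLog, PMF.pure_map]
  | ask i x k ih =>
    simp only [interp, logMachine, execLog, PMF.map_bind, PMF.bind_map, PMF.map_comp]
    congr 1
    funext v
    simp [ih, Function.comp_def]

theorem interp_logMachine_map (t : Tree ι ρ) (a : σ) (l l' : List Val) :
    (t.interp (logMachine ev post) (a, l, l')).map (fun q => (q.1, q.2.1)) =
      t.replay ev post a l' := by
  induction t generalizing a l l' with
  | ret r => simp [interp, replay, PMF.pure_map]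
  | ask i x k ih =>
    rcases l' with _ | ⟨v, l'⟩
    · simp only [interp, logMachine, replay, PMF.map_bind, PMF.bind_map, Function.comp_def, ih]
    · simp only [interp, logMachine, replay, PMF.pure_bind, ih]

theorem replay_nil (t : Tree ι ρ) (a : σ) :
    t.replay ev post a [] = t.interp (machine ev post) a := by
  induction t generalizing a with
  | ret r => rfl
  | ask i x k ih =>
    simp only [interp, machine, replay, PMF.bind_map, Function.comp_def, ih]

theorem execLog_map_fst (t : Tree ι ρ) (a : σ) :
    (t.execLog ev post a).map Prod.fst = t.interp (machine ev post) a := by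
  induction t generalizing a with
  | ret r => simp [interp, execLog, PMF.pure_map]
  | ask i x k ih =>
    simp only [interp, machine, execLog, PMF.map_bind, PMF.bind_map, PMF.map_comp,
      Function.comp_def, ← ih]

theorem interp_machine_ask (i : ι) (x : Val) (k : Val → Tree ι ρ) (a : σ) :
    (ask i x k).interp (machine ev post) a =
      (ev i x).bind fun v => (k (post i x v a).1).interp (machine ev post) (post i x v a).2 := by
  simp only [interp, machine, PMF.bind_map, Function.comp_def]

theorem fork_zero (t : Tree ι ρ) (a : σ) (G : (ρ × σ) × (ρ × σ) → ℝ≥0∞) :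
    ex (t.fork ev post 0 a) G = ex (t.interp (machine ev post) a) fun q =>
      ex (t.interp (machine ev post) a) fun q' => G (q, q') := by
  simp only [fork, List.take_zero, replay_nil, ex_bind, ex_map, ← execLog_map_fst t a]

theorem fork_succ_ask (n : ℕ) (i : ι) (x : Val) (k : Val → Tree ι ρ) (a : σ) :
    (ask i x k).fork ev post (n + 1) a =
      (ev i x).bind fun v => (k (post i x v a).1).fork ev post n (post i x v a).2 := by
  simp only [fork, execLog, PMF.bind_bind, PMF.bind_map, Function.comp_def, List.take_succ_cons,
    replay]

theorem fork_ret (n : ℕ) (r : ρ) (a : σ) :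
    (ret r : Tree ι ρ).fork ev post n a = PMF.pure ((r, a), (r, a)) := by
  simp [fork, execLog, replay, PMF.pure_map]

/-- Forking lemma. -/
theorem sq_le_fork {g : ρ × σ → ℝ≥0∞} {G : (ρ × σ) × (ρ × σ) → ℝ≥0∞} (hg : ∀ q, g q ≤ 1)
    {ε : ℝ≥0∞} {Φ : ℕ → σ → Prop}
    (hΦ : ∀ n a, Φ (n + 1) a → ∀ i x v, Φ n (post i x v a).2)
    (hret : ∀ n r a, Φ n a → g (r, a) ^ 2 ≤ G ((r, a), (r, a)) + ε)
    (hask : ∀ i x k a, Φ 0 a → ex ((ask i x k).interp (machine ev post) a) g ^ 2 ≤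
      ex ((ask i x k).fork ev post 0 a) G + ε)
    (t : Tree ι ρ) (n : ℕ) (a : σ) (ha : Φ n a) :
    ex (t.interp (machine ev post) a) g ^ 2 ≤ ex (t.fork ev post n a) G + ε := by
  induction t generalizing n a with
  | ret r => simpa [fork_ret, interp] using hret n r a ha
  | ask i x k ih =>
    rcases n with _ | n
    · exact hask i x k a ha
    -- Before the fork both runs share the value drawn, so the square can be moved inside the
    -- expectation over this value (`sq_ex_le`).
    · rw [interp_machine_ask, fork_succ_ask, ex_bind, ex_bind]
      refine (sq_ex_le _ fun v => ex_le_const _ hg).trans ?_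
      rw [← ex_add_const]
      exact ex_mono _ fun v => ih _ n _ (hΦ n a ha i x v)

theorem interp_machine_invariant {J : σ → Prop} (hJ : ∀ i x v a, J a → J (post i x v a).2)
    (t : Tree ι ρ) (a : σ) (ha : J a) (q : ρ × σ)
    (hq : q ∈ (t.interp (machine ev post) a).support) : J q.2 := by
  induction t generalizing a with
  | ret r =>
    simp only [interp, PMF.support_pure, Set.mem_singleton_iff] at hq
    subst hq; exact ha
  | ask i x k ih =>
    rw [interp_machine_ask, PMF.mem_support_bind_iff] at hq
    obtain ⟨v, -, hv⟩ := hq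
    exact ih _ _ (hJ i x v a ha) hv

end Tree

end Fork

/-! ## Uniform residues -/

section Uniform

variable (N : ℕ) [Fact N.Prime]

theorem ex_uniformBelow_prime (f : ℕ → ℝ≥0∞) :
    ex (uniformBelow N) f = ex (PMF.uniformOfFintype (ZMod N)) fun z => f z.val := by
  have hN := (Fact.out : N.Prime).pos
  rw [ex_uniformBelow hN, ex_uniformOfFintype, ZMod.card]
  congr 1
  refine Finset.sum_bij' (i := fun n _ => (n : ZMod N)) (j := fun z _ => z.val)
    (fun _ _ => Finset.mem_univ _) (fun z _ => Finset.mem_range.2 (ZMod.val_lt z)) ?_ ?_ ?_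
  · exact fun n hn => ZMod.val_cast_of_lt (Finset.mem_range.1 hn)
  · exact fun z _ => ZMod.natCast_zmod_val z
  · exact fun n hn => by rw [ZMod.val_cast_of_lt (Finset.mem_range.1 hn)]

theorem ex_uniform_ind_eq (c : ZMod N) :
    ex (PMF.uniformOfFintype (ZMod N)) (fun z => ind (z = c)) = (N : ℝ≥0∞)⁻¹ := by
  rw [ex_uniformOfFintype, ZMod.card, Finset.sum_eq_single c (fun b _ hb => ind_false hb) (by simp),
    ind_true rfl, mul_one]

theorem ex_coin (f : Val → ℝ≥0∞) :
    ex (coin (.num N)) f = ex (PMF.uniformOfFintype (ZMod N)) fun z => f (.num z.val) := by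
  rw [coin, ex_map, Val.toNat_num, ex_uniformBelow_prime N]

end Uniform

/-! ## The simulated attack -/

/-- An entry of the random oracle table: query, answer, and the number of the event in which it
was drawn (`none` for entries that do not come from a hash query). -/
abbrev Entry : Type := (Val × Val) × Option ℕ

/-- State of the simulation: random oracle table, messages submitted for signature, number of
events. -/
structure Sim where
  entries : List Entry
  asked : List (List Bool)
  count : ℕ

namespace Sim

def find (a : Sim) (w : List Bool) : Option Entry := a.entries.find? fun e => e.1.1.toBits = w

theorem mem_of_find {a : Sim} {w : List Bool} {e : Entry} (h : a.find w = some e) :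
    e ∈ a.entries := List.mem_of_find?_eq_some h

theorem key_of_find {a : Sim} {w : List Bool} {e : Entry} (h : a.find w = some e) :
    e.1.1.toBits = w := by simpa using List.find?_some h

end Sim

section Simulation

variable (𝓖 : GroupFamily) (κ : ℕ) (X : 𝓖.Pt κ)

/-- The commitment of the signature `(s, e)` for the verification key `X`. -/
def commitment (v : Val) : 𝓖.Pt κ := v.snd.toNat • X + v.fst.toNat • 𝓖.G κ

/-- Reaction of the simulator to the query `x` if the random value `v` is drawn; `v` is a hash
value or a signature. -/
def simPost : Option CMAOracle → Val → Val → Sim → Val × Sim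
  | none, _, v, a => (v, ⟨a.entries, a.asked, a.count + 1⟩)
  | some .hash, x, v, a =>
    match a.find x.toBits with
    | none => (v, ⟨((x, v), some a.count) :: a.entries, a.asked, a.count + 1⟩)
    -- A value is drawn, and an event counted, even if the answer is already in the table. So events
    -- correspond to values drawn, and a number of events determines a fork point.
    | some e => (e.1.2, ⟨a.entries, a.asked, a.count + 1⟩)
  -- The table is programmed without checking for an earlier entry at the same point; the new entry
  -- hides an old one. The probability of such a clash is accounted for in `step_sign`.
  | some .sign, x, v, a =>
    (v, ⟨((listVal (x.elems ++ (𝓖.ptVal κ (commitment 𝓖 κ X v)).elems), v.snd), none) ::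
      a.entries, x.toBits :: a.asked, a.count + 1⟩)

/-- The random values, given the distribution `μ` of signatures. -/
noncomputable def simEv (μ : PMF Val) : Option CMAOracle → Val → PMF Val
  | none, x => coin x
  | some .hash, _ => coin (.num (𝓖.N κ))
  | some .sign, _ => μ

/-- The commitment that verification computes from an attacker's output. -/
def outCommitment (o : Val) : 𝓖.Pt κ :=
  𝓖.smul κ (o.snd.snd.toNat : ZMod (𝓖.N κ)) X + 𝓖.smul κ (o.snd.fst.toNat : ZMod (𝓖.N κ)) (𝓖.G κ)

/-- The result of an attack is a forgery that is valid due to the table entry `e`. -/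
def ForgesAt (t : ℕ) (q : (Val × ℕ) × Sim) (e : Entry) : Prop :=
  q.1.2 ≤ t ∧ q.1.1.fst.toBits ∉ q.2.asked ∧
    q.2.find (cat 𝓖 κ q.1.1.fst.toBits (outCommitment 𝓖 κ X q.1.1)) = some e ∧
    (e.1.2.toNat : ZMod (𝓖.N κ)) = q.1.1.snd.snd.toNat

/-- Two outputs in time from which the discrete logarithm of `X` can be computed. -/
def Extractable (t : ℕ) (q : ((Val × ℕ) × Sim) × ((Val × ℕ) × Sim)) : Prop :=
  q.1.1.2 ≤ t ∧ q.2.1.2 ≤ t ∧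
    (q.1.1.1.snd.snd.toNat : ZMod (𝓖.N κ)) ≠ q.2.1.1.snd.snd.toNat ∧
    outCommitment 𝓖 κ X q.1.1.1 = outCommitment 𝓖 κ X q.2.1.1

variable {𝓖 κ}

/-- The encodings of points have a fixed length, so the end of the message can be located. -/
theorem cat_inj {m m' : List Bool} {A A' : 𝓖.Pt κ} (h : cat 𝓖 κ m A = cat 𝓖 κ m' A') :
    m = m' ∧ A = A' := by
  obtain ⟨h1, h2⟩ := List.append_inj' h (by simp [𝓖.enc_length])
  exact ⟨h1, 𝓖.enc_injective κ h2⟩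

theorem toBits_cat (x : Val) (A : 𝓖.Pt κ) :
    (listVal (x.elems ++ (𝓖.ptVal κ A).elems)).toBits = cat 𝓖 κ x.toBits A := by
  rw [Val.toBits_listVal, List.map_append, ← Val.toBits_eq, ← Val.toBits_eq, GroupFamily.ptVal,
    Val.toBits_ofBits, cat]

theorem simPost_count (i : Option CMAOracle) (x v : Val) (a : Sim) :
    (simPost 𝓖 κ X i x v a).2.count = a.count + 1 := by
  rcases i with _ | _ | _ <;> simp only [simPost]
  split <;> rfl

theorem mem_simPost {i : Option CMAOracle} {x v : Val} {a : Sim} {e : Entry}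
    (he : e ∈ (simPost 𝓖 κ X i x v a).2.entries) :
    e.2 = none ∨ e ∈ a.entries ∨ (i = some .hash ∧ e = ((x, v), some a.count)) := by
  rcases i with _ | _ | _ <;> simp only [simPost] at he
  · exact .inr (.inl he)
  · rcases h : a.find x.toBits with _ | e' <;> rw [h] at he
    · rcases List.mem_cons.1 he with rfl | he
      · exact .inr (.inr ⟨rfl, rfl⟩)
      · exact .inr (.inl he)
    · exact .inr (.inl he)
  · rcases List.mem_cons.1 he with rfl | he
    · exact .inl rfl
    · exact .inr (.inl he)

/-- The fork is at event `n`. No entry has the number `n` before this event, and no later event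
creates one. So in both runs the forgery rests on the query made at event `n`; this query is common
to both and fixes message and commitment, while the two answers are independent. If the answers
differ, the outputs are `Extractable`; they agree with probability `1 / N`. -/
theorem forging (μ : PMF Val) (t n : ℕ) (τ : Tree (Option CMAOracle) (Val × ℕ)) (a : Sim)
    (ha : a.count = 0) (ha' : ∀ e ∈ a.entries, e.2 = none) :
    ex (τ.interp (machine (simEv 𝓖 κ μ) (simPost 𝓖 κ X)) a)
        (fun q => ind (∃ e, ForgesAt 𝓖 κ X t q e ∧ e.2 = some n)) ^ 2 ≤
      ex (τ.fork (simEv 𝓖 κ μ) (simPost 𝓖 κ X) n a) (fun q => ind (Extractable 𝓖 κ X t q)) +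
        (𝓖.N κ : ℝ≥0∞)⁻¹ := by
  refine Tree.sq_le_fork (Φ := fun k a => a.count + k = n ∧
    ∀ e ∈ a.entries, ∀ j, e.2 = some j → j < a.count) (fun q => ind_le_one _) ?_ ?_ ?_ τ n a
    ⟨by omega, fun e he j hj => by simp [ha' e he] at hj⟩
  · rintro k a ⟨h1, h2⟩ i x v
    rw [simPost_count]
    refine ⟨by omega, fun e he j hj => ?_⟩
    rcases mem_simPost X he with h | he' | ⟨-, rfl⟩
    · simp [h] at hj
    · have := h2 e he' j hj
      omega
    · simp only [Option.some.injEq] at hj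
      omega
  -- A run that ends before event `n` has no entry with that number, so it contributes nothing.
  · rintro k r a ⟨h1, h2⟩
    rw [ind_false, zero_pow two_ne_zero]
    · exact zero_le
    · rintro ⟨e, ⟨-, -, he, -⟩, hn⟩
      have := h2 e (Sim.mem_of_find he) n hn
      omega
  · rintro i x k a ⟨h1, h2⟩
    have hJ : ∀ v, ∀ q ∈ ((k (simPost 𝓖 κ X i x v a).1).interp
        (machine (simEv 𝓖 κ μ) (simPost 𝓖 κ X)) (simPost 𝓖 κ X i x v a).2).support,
        n < q.2.count ∧ ∀ e ∈ q.2.entries, e.2 = some n →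
          i = some .hash ∧ e.1.1.toBits = x.toBits ∧ e.1.2 = v := by
      intro v
      refine Tree.interp_machine_invariant (J := fun b : Sim => n < b.count ∧ ∀ e ∈ b.entries,
        e.2 = some n → i = some .hash ∧ e.1.1.toBits = x.toBits ∧ e.1.2 = v) ?_ _ _ ?_
      · rintro i' x' v' b ⟨h3, h4⟩
        rw [simPost_count]
        refine ⟨by omega, fun e he hn => ?_⟩
        rcases mem_simPost X he with h | he' | ⟨-, rfl⟩
        · simp [h] at hn
        · exact h4 e he' hn
        · simp only [Option.some.injEq] at hn
          omega
      · rw [simPost_count]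
        refine ⟨by omega, fun e he hn => ?_⟩
        rcases mem_simPost X he with h | he' | ⟨hi, rfl⟩
        · simp [h] at hn
        · have := h2 e he' n hn
          omega
        · exact ⟨hi, rfl, rfl⟩
    rw [Tree.fork_zero]
    simp only [Tree.interp_machine_ask, ex_bind]
    rw [sq_ex]
    set E := fun v => (k (simPost 𝓖 κ X i x v a).1).interp
        (machine (simEv 𝓖 κ μ) (simPost 𝓖 κ X)) (simPost 𝓖 κ X i x v a).2
    have step : ∀ v v', ex (E v) (fun q => ind (∃ e, ForgesAt 𝓖 κ X t q e ∧ e.2 = some n)) *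
        ex (E v') (fun q => ind (∃ e, ForgesAt 𝓖 κ X t q e ∧ e.2 = some n)) ≤
        ex (E v) (fun q => ex (E v') fun q' => ind (Extractable 𝓖 κ X t (q, q'))) +
          ind (i = some .hash ∧ (v'.toNat : ZMod (𝓖.N κ)) = v.toNat) := by
      intro v v'
      rw [← ex_mul_right]
      simp only [← ex_mul_left]
      rw [← ex_add_const]
      refine ex_mono_support _ fun q hq => ?_
      rw [← ex_add_const]
      refine ex_mono_support _ fun q' hq' => ?_
      rw [← ind_and]
      refine (ind_mono ?_).trans (ind_or_le _ _)
      rintro ⟨⟨e, ⟨h3, -, h4, h5⟩, h6⟩, ⟨e', ⟨h3', -, h4', h5'⟩, h6'⟩⟩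
      obtain ⟨hi, hk, hv⟩ := (hJ v q hq).2 e (Sim.mem_of_find h4) h6
      obtain ⟨-, hk', hv'⟩ := (hJ v' q' hq').2 e' (Sim.mem_of_find h4') h6'
      rw [hv] at h5
      rw [hv'] at h5'
      by_cases hvv : (v'.toNat : ZMod (𝓖.N κ)) = v.toNat
      · exact .inr ⟨hi, hvv⟩
      · refine .inl ⟨h3, h3', fun h => hvv ?_, ?_⟩
        · rw [h5, h5']; exact h.symm
        · rw [Sim.key_of_find h4] at hk
          rw [Sim.key_of_find h4'] at hk'
          exact (cat_inj (hk.trans hk'.symm)).2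
    refine (ex_mono _ fun v => ex_mono _ fun v' => step v v').trans ?_
    simp only [ex_add]
    gcongr ?_ + ?_
    · refine ex_mono _ fun v => ?_
      rw [ex_comm]
    · refine ex_le_const _ fun v => ?_
      -- Only hash queries make numbered entries. For other kinds of events the success probability
      -- vanishes and no collision term arises.
      by_cases hi : i = some .hash
      · subst hi
        simp only [true_and, simEv]
        rw [ex_coin]
        simp only [Val.toNat_num, ZMod.natCast_zmod_val]
        exact (ex_uniform_ind_eq _ _).le
      · simp only [hi, false_and]
        exact ex_le_const _ fun _ => by simp [ind_false]

end Simulation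

/-! ## Errors that are small on average -/

theorem Approx.one {α β : Type*} {R : α → β → Prop} {μ : PMF α} {ν : PMF β} : Approx 1 R μ ν :=
  fun _ _ hf _ => (ex_le_const μ hf).trans le_add_self

theorem Approx.bind_same_avg {α γ δ : Type*} {S : γ → δ → Prop} {μ : PMF α} {F : α → PMF γ}
    {G : α → PMF δ} {ε : α → ℝ≥0∞} (h : ∀ a, Approx (ε a) S (F a) (G a)) :
    Approx (ex μ ε) S (μ.bind F) (μ.bind G) := by
  intro f g hf hfg
  rw [ex_bind, ex_bind, ← ex_add]
  exact ex_mono μ fun a => h a f g hf hfg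

theorem ex_exists_mem_le {α β : Type*} (μ : PMF α) (l : List β) (p : β → α → Prop) {c : ℝ≥0∞}
    (h : ∀ e ∈ l, ex μ (fun a => ind (p e a)) ≤ c) :
    ex μ (fun a => ind (∃ e ∈ l, p e a)) ≤ l.length * c := by
  induction l with
  | nil => simp [ind_false, ex_const]
  | cons e l ih =>
    calc ex μ (fun a => ind (∃ e' ∈ e :: l, p e' a))
        ≤ ex μ fun a => ind (∃ e ∈ l, p e a) + ind (p e a) := ex_mono μ fun a =>
          (ind_mono (by
            rintro ⟨e', he', hp⟩
            rcases List.mem_cons.1 he' with rfl | he'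
            exacts [.inr hp, .inl ⟨e', he', hp⟩])).trans (ind_or_le _ _)
      _ ≤ l.length * c + c := by
          rw [ex_add]
          exact add_le_add (ih fun e he => h e (List.mem_cons_of_mem _ he)) (h e (by simp))
      _ = _ := by rw [List.length_cons]; push_cast; ring

/-- Step-by-step comparison of two executions up to time `t`. -/
theorem Tree.approx_interp {ι σ₁ σ₂ : Type} {O₁ : ι → Val → PState σ₁ Val}
    {O₂ : ι → Val → PState σ₂ Val} {I : ℕ → σ₁ → σ₂ → Prop} {t : ℕ} {ε : ℝ≥0∞}
    (h : ∀ n < t, ∀ i x s₁ s₂, I n s₁ s₂ →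
      Approx ε (fun p q => p.1 = q.1 ∧ I (n + 1) p.2 q.2) (O₁ i x s₁) (O₂ i x s₂))
    (τ : Tree ι (Val × ℕ)) (n : ℕ) (hτ : τ.Costly n) (s₁ : σ₁) (s₂ : σ₂) (hI : I n s₁ s₂) :
    Approx ((t - n : ℕ) * ε) (fun p q => p.1.2 ≤ t → p.1 = q.1 ∧ ∃ k ≤ t, I k p.2 q.2)
      (τ.interp O₁ s₁) (τ.interp O₂ s₂) := by
  induction τ generalizing n s₁ s₂ with
  | ret r =>
    exact (Approx.pure (R := fun p q => p.1.2 ≤ t → p.1 = q.1 ∧ ∃ k ≤ t, I k p.2 q.2)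
      fun hr => ⟨rfl, n, hτ.1.trans hr, hI⟩).mono (fun _ _ h => h) zero_le
  | ask i x k ih =>
    by_cases hn : n < t
    · have h1 : ((t - n : ℕ) : ℝ≥0∞) * ε = ε + (t - (n + 1) : ℕ) * ε := by
        rw [show t - n = t - (n + 1) + 1 by omega]
        push_cast
        ring
      rw [h1]
      refine (h n hn i x s₁ s₂ hI).bind fun p q ⟨h2, h3⟩ => ?_
      rw [h2]
      exact ih _ _ (hτ _) _ _ h3
    -- A call at depth `n ≥ t` forces the cost above `t`, where the relation is void. Hence only `t
    -- - n` calls contribute an error.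
    · refine (Approx.of_forall fun q hq b hc => ?_).mono (fun _ _ h => h) zero_le
      simp only [interp, PMF.mem_support_bind_iff] at hq
      obtain ⟨p, -, hp⟩ := hq
      have := ((hτ p.1).interp_support O₁ p.2 q hp).1
      omega

/-! ## Scalar multiplication -/

namespace GroupFamily

variable (𝓖 : GroupFamily) (κ : ℕ)

theorem smul_natCast (n : ℕ) (A : 𝓖.Pt κ) : 𝓖.smul κ (n : ZMod (𝓖.N κ)) A = n • A := by
  rw [smul, ZMod.val_natCast]
  conv_rhs => rw [← Nat.mod_add_div n (𝓖.N κ)]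
  rw [add_nsmul, mul_comm, mul_nsmul', 𝓖.order_smul, nsmul_zero, add_zero]

theorem smul_add (x y : ZMod (𝓖.N κ)) (A : 𝓖.Pt κ) :
    𝓖.smul κ (x + y) A = 𝓖.smul κ x A + 𝓖.smul κ y A := by
  rw [← ZMod.natCast_zmod_val x, ← ZMod.natCast_zmod_val y, ← Nat.cast_add]
  simp only [smul_natCast, add_nsmul]

theorem smul_smul (x y : ZMod (𝓖.N κ)) (A : 𝓖.Pt κ) :
    𝓖.smul κ x (𝓖.smul κ y A) = 𝓖.smul κ (x * y) A := by
  rw [← ZMod.natCast_zmod_val x, ← ZMod.natCast_zmod_val y, ← Nat.cast_mul]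
  simp only [smul_natCast, mul_nsmul']

theorem smul_sum {ι : Type*} (s : Finset ι) (f : ι → ZMod (𝓖.N κ)) (A : 𝓖.Pt κ) :
    𝓖.smul κ (∑ i ∈ s, f i) A = ∑ i ∈ s, 𝓖.smul κ (f i) A :=
  map_sum (AddMonoidHom.mk' (fun x => 𝓖.smul κ x A) fun x y => 𝓖.smul_add κ x y A) f s

theorem smul_G_injective : Function.Injective fun x => 𝓖.smul κ x (𝓖.G κ) := by
  intro x y h
  have h0 : x.val ≡ y.val [MOD addOrderOf (𝓖.G κ)] := nsmul_eq_nsmul_iff_modEq.1 h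
  have h1 := h0.of_dvd (𝓖.addOrderOf_G κ).symm.dvd
  rw [← ZMod.natCast_zmod_val x, ← ZMod.natCast_zmod_val y]
  exact (ZMod.natCast_eq_natCast_iff _ _ _).2 h1

end GroupFamily

theorem coin_eq_map (N : ℕ) [Fact N.Prime] :
    coin (.num N) = (PMF.uniformOfFintype (ZMod N)).map fun z => .num z.val := by
  classical
  ext v
  rw [apply_eq_ex, ex_coin, apply_eq_ex, ex_map]

/-! ## The random oracle -/

section Hash

variable {N : ℕ} [Fact N.Prime] (T : HashTable N) (w : List Bool)

theorem romHash_of_some {h : ZMod N} (hT : T.get? w = some h) :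
    romHash w T = PMF.pure (h, T) := by
  unfold romHash
  rw [PState.bind_apply]
  change (PMF.pure (T, T)).bind _ = _
  rw [PMF.pure_bind]
  simp only [hT]
  rfl

theorem romHash_of_none (hT : T.get? w = none) :
    romHash w T = (PMF.uniformOfFintype (ZMod N)).map fun h => (h, (w, h) :: T) := by
  unfold romHash
  rw [PState.bind_apply]
  change (PMF.pure (T, T)).bind _ = _
  rw [PMF.pure_bind]
  simp only [hT, PState.bind_apply, draw, PMF.bind_map]
  rw [PMF.map]
  congr 1
  funext h
  change (PMF.pure (_, _)).bind _ = _
  rw [PMF.pure_bind]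
  rfl

omit [Fact N.Prime] in
theorem get?_cons (w' : List Bool) (h : ZMod N) :
    HashTable.get? ((w', h) :: T) w = if w' = w then some h else T.get? w := by
  simp only [HashTable.get?, List.lookup_cons]
  by_cases hw : w' = w
  · simp [hw]
  · have : (w == w') = false := by simpa using Ne.symm hw
    simp [hw, this]

end Hash

theorem Sim.find_cons (e : Entry) (l : List Entry) (Q : List (List Bool)) (n : ℕ) (w : List Bool) :
    Sim.find ⟨e :: l, Q, n⟩ w = if e.1.1.toBits = w then some e else Sim.find ⟨l, Q, n⟩ w := by
  simp only [Sim.find, List.find?_cons]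
  by_cases h : e.1.1.toBits = w <;> simp [h]

/-! ## From the real attack to the simulated one -/

section Hop

variable {𝓖 : GroupFamily} {B : BPVParams} {κ : ℕ}

/-- Probability that the nonce is `z`, given the residues `r`. -/
noncomputable def nonceProb (B : BPVParams) (κ : ℕ) {N : ℕ} (r : Fin (B.k κ) → ZMod N)
    (z : ZMod N) : ℝ≥0∞ := ex (B.randSubset κ) fun S => ind (∑ i ∈ S, r i = z)

/-- The largest probability of a nonce. -/
noncomputable def maxNonceProb (B : BPVParams) (κ : ℕ) {N : ℕ} (r : Fin (B.k κ) → ZMod N) :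
    ℝ≥0∞ := ⨆ z, nonceProb B κ r z

/-- A signature as a value. -/
def sgnPair {N : ℕ} (p : ZMod N × ZMod N) : Val := .pair (.num p.1.val) (.num p.2.val)

/-- The table of precomputed pairs. -/
def nonceTable (𝓖 : GroupFamily) (B : BPVParams) (κ : ℕ) (r : Fin (B.k κ) → ZMod (𝓖.N κ))
    (i : Fin (B.k κ)) : ZMod (𝓖.N κ) × 𝓖.Pt κ := (r i, 𝓖.smul κ (r i) (𝓖.G κ))

/-- How the states of the real attack and of the simulation are related after `n` events. -/
structure Related (W : List Bool) (h : ZMod (𝓖.N κ)) (n : ℕ)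
    (s : HashTable (𝓖.N κ) × List (List Bool)) (a : Sim) : Prop where
  get? : ∀ w, s.1.get? w = (a.find w).map fun e => (e.1.2.toNat : ZMod (𝓖.N κ))
  asked : s.2 = a.asked
  count : a.count = n
  -- At most one entry per event, and one from key generation.
  length : a.entries.length ≤ n + 1
  idx_lt : ∀ e ∈ a.entries, ∀ j, e.2 = some j → j < n
  -- This excludes forgeries through entries made by signing: their messages have been submitted.
  signed : ∀ e ∈ a.entries, e.2 = none → e.1.1.toBits = W ∨
    ∃ m ∈ a.asked, ∃ R, e.1.1.toBits = cat 𝓖 κ m R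
  -- The real oracle returns the canonical representative of a residue and the simulator the stored
  -- value; the two have to be equal as values, not only modulo `N`.
  canonical : ∀ e ∈ a.entries, e.1.2 = .num (e.1.2.toNat : ZMod (𝓖.N κ)).val
  self : s.1.get? W = some h

/-- The string `w` determines the commitment, and the commitment determines the nonce, so at most
one nonce can hit `w`. -/
theorem ex_nonce_hit_le (r : Fin (B.k κ) → ZMod (𝓖.N κ)) (m w : List Bool) :
    ex (B.randSubset κ) (fun S => ind (w = cat 𝓖 κ m (𝓖.smul κ (∑ i ∈ S, r i) (𝓖.G κ)))) ≤
      maxNonceProb B κ r := by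
  by_cases h : ∃ S₀ : Finset (Fin (B.k κ)), w = cat 𝓖 κ m (𝓖.smul κ (∑ i ∈ S₀, r i) (𝓖.G κ))
  · obtain ⟨S₀, rfl⟩ := h
    refine le_trans (ex_mono _ fun S => ind_mono fun h => ?_)
      (le_iSup (nonceProb B κ r) (∑ i ∈ S₀, r i))
    exact (𝓖.smul_G_injective κ (cat_inj h).2).symm
  · exact ex_le_const _ fun S => by rw [ind_false fun h' => h ⟨S, h'⟩]; exact zero_le

variable {ID : List Bool} {x h : ZMod (𝓖.N κ)} {r : Fin (B.k κ) → ZMod (𝓖.N κ)}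

theorem bpvOnline_nonceTable : bpvOnline 𝓖 B κ (nonceTable 𝓖 B κ r) =
    (B.randSubset κ).map fun S => (∑ i ∈ S, r i, 𝓖.smul κ (∑ i ∈ S, r i) (𝓖.G κ)) := by
  simp only [bpvOnline, nonceTable, 𝓖.smul_sum]

theorem commitment_sgnPair (z c : ZMod (𝓖.N κ)) :
    commitment 𝓖 κ (𝓖.smul κ x (𝓖.G κ)) (sgnPair (z - x * c, c)) = 𝓖.smul κ z (𝓖.G κ) := by
  simp only [commitment, sgnPair, Val.fst_pair, Val.snd_pair, Val.toNat_num]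
  rw [← 𝓖.smul_natCast, ← 𝓖.smul_natCast, ZMod.natCast_zmod_val, ZMod.natCast_zmod_val,
    𝓖.smul_smul, ← 𝓖.smul_add]
  congr 1
  ring

theorem step_hash {W : List Bool} {n : ℕ} (μ : PMF Val) (y : Val)
    (s : HashTable (𝓖.N κ) × List (List Bool)) (a : Sim) (hI : Related W h n s a) (X : 𝓖.Pt κ) :
    Approx 0 (fun p q => p.1 = q.1 ∧ Related W h (n + 1) p.2 q.2)
      (((romHash y.toBits) s.1).map fun q => (Val.num q.1.val, (q.2, s.2)))
      (machine (simEv 𝓖 κ μ) (simPost 𝓖 κ X) (some .hash) y a) := by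
  unfold machine
  rcases hf : a.find y.toBits with _ | e
  · have hT : s.1.get? y.toBits = none := by rw [hI.get?, hf]; rfl
    rw [romHash_of_none _ _ hT]
    simp only [simEv, coin_eq_map, PMF.map_comp]
    rw [PMF.map, PMF.map]
    refine Approx.bind_same fun z _ => Approx.pure ?_
    simp only [Function.comp, simPost, hf]
    refine ⟨trivial, ⟨fun w => ?_, hI.asked, by rw [← hI.count], ?_, ?_, ?_, ?_, ?_⟩⟩
    · rw [get?_cons, Sim.find_cons]
      split_ifs
      · simp
      · exact hI.get? w
    · simpa using hI.length
    · intro e he j hj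
      rcases List.mem_cons.1 he with rfl | he
      · simp only [Option.some.injEq] at hj
        have := hI.count
        omega
      · exact (hI.idx_lt e he j hj).trans n.lt_succ_self
    · intro e he hj
      rcases List.mem_cons.1 he with rfl | he
      · simp at hj
      · exact hI.signed e he hj
    · intro e he
      rcases List.mem_cons.1 he with rfl | he
      · simp
      · exact hI.canonical e he
    · rw [get?_cons, if_neg]
      · exact hI.self
      · intro hw
        have := hI.self
        rw [← hw, hT] at this
        simp at this
  · have hT : s.1.get? y.toBits = some (e.1.2.toNat : ZMod (𝓖.N κ)) := by rw [hI.get?, hf]; rfl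
    have hmem := Sim.mem_of_find hf
    -- On a repeated query the simulator draws a value that it does not use; an idle draw is added
    -- on the real side to match it.
    rw [romHash_of_some _ _ hT, PMF.pure_map,
      ← PMF.bind_const (simEv 𝓖 κ μ (some .hash) y) (PMF.pure _), PMF.map]
    refine Approx.bind_same fun z _ => Approx.pure ?_
    simp only [simPost, hf]
    exact ⟨(hI.canonical e hmem).symm, hI.get?, hI.asked, by rw [← hI.count],
      hI.length.trans (by omega), fun e' he j hj => (hI.idx_lt e' he j hj).trans n.lt_succ_self,
      hI.signed, hI.canonical, hI.self⟩

/-- The distribution of simulated signatures. -/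
noncomputable def sgnDist (𝓖 : GroupFamily) (B : BPVParams) (κ : ℕ) (x : ZMod (𝓖.N κ))
    (r : Fin (B.k κ) → ZMod (𝓖.N κ)) : PMF Val := (ahssSample (𝓖.N κ) B κ x r).map sgnPair

/-- The index set and the hash value are independent, so the nonce can be drawn first, as in real
signing. -/
theorem sgnDist_eq : sgnDist 𝓖 B κ x r = (B.randSubset κ).bind fun S =>
    (PMF.uniformOfFintype (ZMod (𝓖.N κ))).map fun c => sgnPair (∑ i ∈ S, r i - x * c, c) := by
  have h0 : ahssSample (𝓖.N κ) B κ x r = (PMF.uniformOfFintype (ZMod (𝓖.N κ))).bind fun c =>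
      (B.randSubset κ).bind fun S => PMF.pure (∑ i ∈ S, r i - x * c, c) := rfl
  rw [sgnDist, h0, PMF.bind_comm]
  simp only [PMF.map_bind, PMF.pure_map]
  rfl

theorem schnorrSig_apply (m : List Bool) (T : HashTable (𝓖.N κ)) :
    schnorrSig 𝓖 B κ (x, nonceTable 𝓖 B κ r) m T = (B.randSubset κ).bind fun S =>
      (romHash (cat 𝓖 κ m (𝓖.smul κ (∑ i ∈ S, r i) (𝓖.G κ))) T).map fun q =>
        ((∑ i ∈ S, r i - q.1 * x, q.1), q.2) := by
  unfold schnorrSig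
  rw [bpvOnline_nonceTable, PState.bind_apply]
  simp only [draw, PMF.map_comp, PMF.bind_map]
  rfl

/-- Both sides use the same index set. If the point `m || R` is not in the table, then the real
oracle draws a fresh uniform `c`, and signature and new entry agree with the simulated ones.
Otherwise the comparison is given up; there are at most `n + 1` points to be hit, each with
probability at most `maxNonceProb`. -/
theorem step_sign {W : List Bool} {n : ℕ} (y : Val)
    (s : HashTable (𝓖.N κ) × List (List Bool)) (a : Sim) (hI : Related W h n s a) :
    Approx ((n + 1 : ℕ) * maxNonceProb B κ r) (fun p q => p.1 = q.1 ∧ Related W h (n + 1) p.2 q.2)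
      ((schnorrSig 𝓖 B κ (x, nonceTable 𝓖 B κ r) y.toBits s.1).map fun q =>
        (sgnPair q.1, (q.2, y.toBits :: s.2)))
      (machine (simEv 𝓖 κ (sgnDist 𝓖 B κ x r)) (simPost 𝓖 κ (𝓖.smul κ x (𝓖.G κ)))
        (some .sign) y a) := by
  have herr : ex (B.randSubset κ) (fun S => ind (∃ e ∈ a.entries, e.1.1.toBits =
      cat 𝓖 κ y.toBits (𝓖.smul κ (∑ i ∈ S, r i) (𝓖.G κ)))) ≤ (n + 1 : ℕ) * maxNonceProb B κ r := by
    refine (ex_exists_mem_le _ _ _ fun e _ => ex_nonce_hit_le r y.toBits e.1.1.toBits).trans ?_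
    gcongr
    exact hI.length
  refine Approx.mono ?_ (fun _ _ h => h) herr
  unfold machine
  simp only [simEv, sgnDist_eq, schnorrSig_apply, PMF.map_bind, PMF.map_comp]
  refine Approx.bind_same_avg fun S => ?_
  set R := 𝓖.smul κ (∑ i ∈ S, r i) (𝓖.G κ) with hR
  by_cases hS : ∃ e ∈ a.entries, e.1.1.toBits = cat 𝓖 κ y.toBits R
  · rw [ind_true hS]; exact Approx.one
  rw [ind_false hS]
  have hf : a.find (cat 𝓖 κ y.toBits R) = none := by
    rw [Sim.find, List.find?_eq_none]
    intro e he
    have := fun h' => hS ⟨e, he, h'⟩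
    simpa using this
  have hT : s.1.get? (cat 𝓖 κ y.toBits R) = none := by rw [hI.get?, hf]; rfl
  rw [romHash_of_none _ _ hT, PMF.map_comp, PMF.map, PMF.map]
  refine Approx.bind_same fun c _ => Approx.pure ?_
  simp only [Function.comp, simPost, commitment_sgnPair, mul_comm c x, ← hR]
  have hkey : ∀ w, (listVal (y.elems ++ (𝓖.ptVal κ R).elems)).toBits = w ↔
      cat 𝓖 κ y.toBits R = w := fun w => by rw [toBits_cat]
  refine ⟨trivial, ⟨fun w => ?_, by rw [hI.asked], by rw [← hI.count], ?_, ?_, ?_, ?_, ?_⟩⟩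
  · rw [get?_cons, Sim.find_cons]
    simp only [hkey]
    split_ifs
    · simp [sgnPair]
    · exact hI.get? w
  · simpa using hI.length
  · intro e he j hj
    rcases List.mem_cons.1 he with rfl | he
    · simp at hj
    · exact (hI.idx_lt e he j hj).trans n.lt_succ_self
  · intro e he hj
    rcases List.mem_cons.1 he with rfl | he
    · exact .inr ⟨y.toBits, by simp, R, toBits_cat y R⟩
    · rcases hI.signed e he hj with h1 | ⟨m, hm, h1⟩
      · exact .inl h1
      · exact .inr ⟨m, List.mem_cons_of_mem _ hm, h1⟩
  · intro e he
    rcases List.mem_cons.1 he with rfl | he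
    · simp [sgnPair]
    · exact hI.canonical e he
  · rw [get?_cons, if_neg]
    · exact hI.self
    · intro hw
      have := hI.self
      rw [← hw, hT] at this
      simp at this

theorem Related.tick {W : List Bool} {n : ℕ} {s : HashTable (𝓖.N κ) × List (List Bool)} {a : Sim}
    (hI : Related W h n s a) : Related W h (n + 1) s ⟨a.entries, a.asked, a.count + 1⟩ :=
  ⟨hI.get?, hI.asked, by rw [← hI.count], hI.length.trans (by omega),
    fun e he j hj => (hI.idx_lt e he j hj).trans n.lt_succ_self, hI.signed, hI.canonical, hI.self⟩

theorem step_cma {W : List Bool} {n : ℕ} (i : Option CMAOracle) (y : Val)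
    (s : HashTable (𝓖.N κ) × List (List Bool)) (a : Sim) (hI : Related W h n s a) :
    Approx ((n + 1 : ℕ) * maxNonceProb B κ r) (fun p q => p.1 = q.1 ∧ Related W h (n + 1) p.2 q.2)
      (withCoin (cmaOracles (bpvSchnorr 𝓖 B ID κ) (x, nonceTable 𝓖 B κ r)) i y s)
      (machine (simEv 𝓖 κ (sgnDist 𝓖 B κ x r)) (simPost 𝓖 κ (𝓖.smul κ x (𝓖.G κ))) i y a) := by
  rcases i with _ | _ | _
  · refine Approx.mono (ε := 0) ?_ (fun _ _ h => h) zero_le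
    simp only [withCoin, draw, machine, simEv]
    rw [PMF.map, PMF.map]
    exact Approx.bind_same fun z _ => Approx.pure ⟨rfl, hI.tick⟩
  · exact (step_hash _ y s a hI _).mono (fun _ _ h => h) zero_le
  · exact step_sign y s a hI

end Hop

/-! ## Uniform nonzero residues -/

section RandUnit

variable {N : ℕ} [Fact N.Prime]

theorem randUnit_eq : randUnit N = (PMF.uniformOfFintype (ZMod N)ˣ).map Units.val := by
  unfold randUnit
  exact PMF.map_id _

theorem ex_randUnit (f : ZMod N → ℝ≥0∞) : ex (randUnit N) f =
    ((N - 1 : ℕ) : ℝ≥0∞)⁻¹ * ∑ z ∈ Finset.univ.erase 0, f z := by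
  rw [randUnit_eq, ex_map, ex_uniformOfFintype, ZMod.card_units_eq_totient,
    Nat.totient_prime Fact.out]
  congr 1
  refine Finset.sum_bij (fun u _ => (u : ZMod N)) (fun u _ => by simp) (fun u _ v _ h => Units.ext h)
    (fun z hz => ?_) fun _ _ => rfl
  exact ⟨Units.mk0 z (Finset.ne_of_mem_erase hz), Finset.mem_univ _, rfl⟩

/-- A shift of the nonzero residues consists of distinct residues, at most one of which is zero;
that one contributes at most `1 / (N - 1)`. -/
theorem ex_randUnit_shift_le {f : ZMod N → ℝ≥0∞} (hf : ∀ z, f z ≤ 1) (c : ZMod N) :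
    ex (randUnit N) (fun d => f (c + d)) ≤ ex (randUnit N) f + ((N - 1 : ℕ) : ℝ≥0∞)⁻¹ := by
  rw [ex_randUnit, ex_randUnit]
  nth_rw 3 [← mul_one ((N - 1 : ℕ) : ℝ≥0∞)⁻¹]
  rw [← mul_add]
  gcongr
  calc ∑ z ∈ Finset.univ.erase 0, f (c + z) ≤ ∑ z, f (c + z) :=
        Finset.sum_le_sum_of_subset (Finset.erase_subset _ _)
    _ = ∑ z, f z := Equiv.sum_comp (Equiv.addLeft c) f
    _ = ∑ z ∈ Finset.univ.erase 0, f z + f 0 := (Finset.sum_erase_add _ _ (Finset.mem_univ _)).symm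
    _ ≤ _ := by gcongr; exact hf 0

end RandUnit

/-! ## The advantage in the real attack -/

section Advantage

variable (𝓖 : GroupFamily) (B : BPVParams) (ID : List Bool) (κ : ℕ) (A : Prog CMAOracle) (t : ℕ)

/-- The state of the simulation before the attack. -/
def simStart (b h : ZMod (𝓖.N κ)) : Sim :=
  ⟨[((listVal ((Val.ofBits ID).elems ++ (𝓖.ptVal κ (𝓖.smul κ b (𝓖.G κ))).elems),
    .num h.val), none)], [], 0⟩

/-- The attacker's input for the signing key `x`, if `U = b × G` and the hash value is `h`. -/
def attackInput (x b h : ZMod (𝓖.N κ)) : Val :=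
  .pair (schnorrPub 𝓖 B κ) (.pair (.ofBits ID) (.pair (𝓖.ptVal κ (𝓖.smul κ b (𝓖.G κ)))
    (𝓖.ptVal κ (𝓖.smul κ (x - h * b) (𝓖.G κ)))))

/-- Random choice of key, nonces, and key generation randomness. -/
noncomputable def exKeys (f : ZMod (𝓖.N κ) → (Fin (B.k κ) → ZMod (𝓖.N κ)) → ZMod (𝓖.N κ) →
    ZMod (𝓖.N κ) → ℝ≥0∞) : ℝ≥0∞ :=
  ex (randUnit (𝓖.N κ)) fun x => ex (randTable (𝓖.N κ) (B.k κ)) fun r =>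
    ex (randUnit (𝓖.N κ)) fun b => ex (PMF.uniformOfFintype (ZMod (𝓖.N κ))) fun h => f x r b h

/-- Expectation over a simulated attack. -/
noncomputable def exSim (g : ZMod (𝓖.N κ) → ZMod (𝓖.N κ) → ZMod (𝓖.N κ) →
    (Val × ℕ) × Sim → ℝ≥0∞) : ℝ≥0∞ :=
  exKeys 𝓖 B κ fun x r b h => ex ((A.tree (attackInput 𝓖 B ID κ x b h)).interp
    (machine (simEv 𝓖 κ (sgnDist 𝓖 B κ x r)) (simPost 𝓖 κ (𝓖.smul κ x (𝓖.G κ))))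
    (simStart 𝓖 ID κ b h)) (g x b h)

/-- A forgery on the identity, with commitment `U` and the hash value `h` used in the key. -/
def ForgesSelf (x b h : ZMod (𝓖.N κ)) (q : (Val × ℕ) × Sim) : Prop :=
  q.1.2 ≤ t ∧ outCommitment 𝓖 κ (𝓖.smul κ x (𝓖.G κ)) q.1.1 = 𝓖.smul κ b (𝓖.G κ) ∧
    (q.1.1.snd.snd.toNat : ZMod (𝓖.N κ)) = h

/-- Probability that the result of an attack is successful. -/
noncomputable def winProb (pk : SchnorrPK 𝓖 κ)
    (q : (Val × ℕ) × (HashTable (𝓖.N κ) × List (List Bool))) : ℝ≥0∞ :=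
  ex (schnorrVer 𝓖 ID κ q.1.1.fst.toBits (q.1.1.snd.fst.toNat, q.1.1.snd.snd.toNat) pk q.2.1)
    fun z => ind (z.1 = true ∧ q.1.1.fst.toBits ∉ q.2.2 ∧ q.1.2 ≤ t)

variable {𝓖 B ID κ t}

/-- The hash of `ID || U` is known to be `h`, so the verification key `h × U + D` is `X`. If
verification asks a new hash query, its answer is uniform and fits with probability `1 / N`.
Otherwise the forgery rests on an entry: either it has a number, which is less than `n ≤ t`, or it
is the entry of key generation, because signing entries belong to submitted messages; in that case
the commitment is `U`. -/
theorem winProb_le {x b h : ZMod (𝓖.N κ)} {n : ℕ} (hn : n ≤ t)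
    (q : (Val × ℕ) × (HashTable (𝓖.N κ) × List (List Bool))) (a : Sim)
    (hI : Related (cat 𝓖 κ ID (𝓖.smul κ b (𝓖.G κ))) h n q.2 a) :
    winProb 𝓖 ID κ t (𝓖.smul κ b (𝓖.G κ), 𝓖.smul κ (x - h * b) (𝓖.G κ)) q ≤
      ∑ i ∈ Finset.range t,
        ind (∃ e, ForgesAt 𝓖 κ (𝓖.smul κ x (𝓖.G κ)) t (q.1, a) e ∧ e.2 = some i) +
      ind (ForgesSelf 𝓖 κ t x b h (q.1, a)) + (𝓖.N κ : ℝ≥0∞)⁻¹ := by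
  obtain ⟨⟨o, c⟩, T, Q⟩ := q
  by_cases hcQ : o.fst.toBits ∉ Q ∧ c ≤ t
  swap
  · refine (ex_le_const _ (c := 0) fun z => ?_).trans zero_le
    rw [ind_false fun h => hcQ h.2]
  obtain ⟨hQ, hc⟩ := hcQ
  have hX : 𝓖.smul κ h (𝓖.smul κ b (𝓖.G κ)) + 𝓖.smul κ (x - h * b) (𝓖.G κ) =
      𝓖.smul κ x (𝓖.G κ) := by
    rw [𝓖.smul_smul, ← 𝓖.smul_add]; congr 1; ring
  have hver : schnorrVer 𝓖 ID κ o.fst.toBits (o.snd.fst.toNat, o.snd.snd.toNat)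
      (𝓖.smul κ b (𝓖.G κ), 𝓖.smul κ (x - h * b) (𝓖.G κ)) T =
      (romHash (cat 𝓖 κ o.fst.toBits (outCommitment 𝓖 κ (𝓖.smul κ x (𝓖.G κ)) o)) T).map
        fun p => (decide ((o.snd.snd.toNat : ZMod (𝓖.N κ)) = p.1), p.2) := by
    unfold schnorrVer
    simp only [PState.bind_apply]
    rw [romHash_of_some _ _ hI.self, PMF.pure_bind, hX]
    rfl
  rw [winProb, hver, ex_map]
  rcases hf : a.find (cat 𝓖 κ o.fst.toBits (outCommitment 𝓖 κ (𝓖.smul κ x (𝓖.G κ)) o)) with _ | e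
  · have hT := hI.get? (cat 𝓖 κ o.fst.toBits (outCommitment 𝓖 κ (𝓖.smul κ x (𝓖.G κ)) o))
    rw [hf] at hT
    rw [romHash_of_none _ _ hT, ex_map]
    refine le_trans ?_ le_add_self
    rw [← ex_uniform_ind_eq (𝓖.N κ) (o.snd.snd.toNat : ZMod (𝓖.N κ))]
    exact ex_mono _ fun z => ind_mono fun hz => by simpa using Eq.symm (of_decide_eq_true hz.1)
  · have hT := hI.get? (cat 𝓖 κ o.fst.toBits (outCommitment 𝓖 κ (𝓖.smul κ x (𝓖.G κ)) o))
    rw [hf] at hT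
    rw [romHash_of_some _ _ hT, ex_pure]
    refine le_trans (ind_le fun hw => ?_) le_self_add
    have he : (o.snd.snd.toNat : ZMod (𝓖.N κ)) = e.1.2.toNat := of_decide_eq_true hw.1
    have hasked : o.fst.toBits ∉ a.asked := by rw [← hI.asked]; exact hQ
    have hforge : ForgesAt 𝓖 κ (𝓖.smul κ x (𝓖.G κ)) t ((o, c), a) e := ⟨hc, hasked, hf, he.symm⟩
    have hmem := Sim.mem_of_find hf
    have hkey := Sim.key_of_find hf
    rcases hi : e.2 with _ | i
    · refine le_trans ?_ le_add_self
      have hW : e.1.1.toBits = cat 𝓖 κ ID (𝓖.smul κ b (𝓖.G κ)) := by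
        rcases hI.signed e hmem hi with h1 | ⟨m, hm, R, h1⟩
        · exact h1
        · rw [hkey] at h1
          rw [(cat_inj h1).1] at hasked
          exact absurd hm hasked
      rw [ind_true]
      have hself := hI.self
      rw [← hW, hkey, hT] at hself
      exact ⟨hc, (cat_inj (hkey.symm.trans hW)).2, he.trans (by simpa using hself)⟩
    · refine le_trans ?_ le_self_add
      have hit : i < t := (hI.idx_lt e hmem i hi).trans_le hn
      rw [← ind_true (⟨e, hforge, hi⟩ :
        ∃ e, ForgesAt 𝓖 κ (𝓖.smul κ x (𝓖.G κ)) t ((o, c), a) e ∧ e.2 = some i)]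
      exact Finset.single_le_sum
        (f := fun i => ind (∃ e, ForgesAt 𝓖 κ (𝓖.smul κ x (𝓖.G κ)) t ((o, c), a) e ∧
          e.2 = some i)) (fun _ _ => zero_le) (Finset.mem_range.2 hit)

theorem related_start (b h : ZMod (𝓖.N κ)) :
    Related (cat 𝓖 κ ID (𝓖.smul κ b (𝓖.G κ))) h 0
      ([(cat 𝓖 κ ID (𝓖.smul κ b (𝓖.G κ)), h)], []) (simStart 𝓖 ID κ b h) := by
  have hkey : (listVal ((Val.ofBits ID).elems ++
      (𝓖.ptVal κ (𝓖.smul κ b (𝓖.G κ))).elems)).toBits = cat 𝓖 κ ID (𝓖.smul κ b (𝓖.G κ)) := by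
    rw [toBits_cat, Val.toBits_ofBits]
  refine ⟨fun w => ?_, rfl, rfl, by simp [simStart], ?_, ?_, ?_, ?_⟩
  · rw [get?_cons, simStart, Sim.find_cons, hkey]
    split_ifs
    · simp
    · rfl
  · intro e he j hj
    simp only [simStart, List.mem_singleton] at he
    simp [he] at hj
  · intro e he _
    simp only [simStart, List.mem_singleton] at he
    rw [he]
    exact .inl hkey
  · intro e he
    simp only [simStart, List.mem_singleton] at he
    simp [he]
  · rw [get?_cons, if_pos rfl]

theorem attack_le (x b h : ZMod (𝓖.N κ)) (r : Fin (B.k κ) → ZMod (𝓖.N κ)) :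
    ex (A.run (cmaOracles (bpvSchnorr 𝓖 B ID κ) (x, nonceTable 𝓖 B κ r))
        (attackInput 𝓖 B ID κ x b h) ([(cat 𝓖 κ ID (𝓖.smul κ b (𝓖.G κ)), h)], []))
      (winProb 𝓖 ID κ t (𝓖.smul κ b (𝓖.G κ), 𝓖.smul κ (x - h * b) (𝓖.G κ))) ≤
    ex ((A.tree (attackInput 𝓖 B ID κ x b h)).interp
        (machine (simEv 𝓖 κ (sgnDist 𝓖 B κ x r)) (simPost 𝓖 κ (𝓖.smul κ x (𝓖.G κ))))
        (simStart 𝓖 ID κ b h))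
      (fun q => ∑ i ∈ Finset.range t,
        ind (∃ e, ForgesAt 𝓖 κ (𝓖.smul κ x (𝓖.G κ)) t q e ∧ e.2 = some i) +
        ind (ForgesSelf 𝓖 κ t x b h q)) +
      (𝓖.N κ : ℝ≥0∞)⁻¹ + t * (t * maxNonceProb B κ r) := by
  rw [Prog.run_eq_interp]
  -- The error at event `n < t` is at most `(n + 1) * maxNonceProb`, hence at most `t *
  -- maxNonceProb`, and at most `t` events count.
  have hstep := Tree.approx_interp (t := t) (ε := t * maxNonceProb B κ r)
    (I := Related (cat 𝓖 κ ID (𝓖.smul κ b (𝓖.G κ))) h)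
    (fun n hn i y s a hI => (step_cma (B := B) (ID := ID) (x := x) (r := r) i y s a hI).mono
      (fun _ _ h => h) (by gcongr; exact_mod_cast hn))
    (A.tree (attackInput 𝓖 B ID κ x b h)) 0 ((A.tree_costly _).mono (Nat.zero_le _)) _ _
    (related_start (ID := ID) b h)
  rw [Nat.sub_zero] at hstep
  rw [← ex_add_const _ _ (𝓖.N κ : ℝ≥0∞)⁻¹]
  refine hstep _ _ (fun q => ex_le_const _ fun _ => ind_le_one _) fun q q' hq => ?_
  by_cases hc : q.1.2 ≤ t
  · obtain ⟨h1, n, hn, hI⟩ := hq hc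
    have := winProb_le (x := x) hn q q'.2 hI
    rw [h1] at this
    exact this
  · refine (ex_le_const _ (c := 0) fun z => ?_).trans zero_le
    rw [ind_false fun h => hc h.2.2]

theorem schnorrKg_nil : schnorrKg 𝓖 B ID κ [] = (randUnit (𝓖.N κ)).bind fun d =>
    (randUnit (𝓖.N κ)).bind fun b => (PMF.uniformOfFintype (ZMod (𝓖.N κ))).bind fun h =>
      (randTable (𝓖.N κ) (B.k κ)).bind fun r =>
        PMF.pure (((h * b + d, nonceTable 𝓖 B κ r), (𝓖.smul κ b (𝓖.G κ), 𝓖.smul κ d (𝓖.G κ))),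
          [(cat 𝓖 κ ID (𝓖.smul κ b (𝓖.G κ)), h)]) := by
  have h0 : ∀ w, HashTable.get? ([] : HashTable (𝓖.N κ)) w = none := fun _ => rfl
  simp only [schnorrKg, PState.bind_apply, draw, PMF.bind_map, Function.comp_def,
    romHash_of_none _ _ (h0 _), bpvOffline]
  rfl

theorem euCMA_apply_true : euCMA (bpvSchnorr 𝓖 B ID κ) (schnorrPub 𝓖 B κ) A t true =
    ex (schnorrKg 𝓖 B ID κ []) fun k =>
      ex (A.run (cmaOracles (bpvSchnorr 𝓖 B ID κ) k.1.1) (.pair (schnorrPub 𝓖 B κ)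
        ((bpvSchnorr 𝓖 B ID κ).pkVal k.1.2)) (k.2, [])) (winProb 𝓖 ID κ t k.1.2) := by
  have h1 : euCMA (bpvSchnorr 𝓖 B ID κ) (schnorrPub 𝓖 B κ) A t =
      (schnorrKg 𝓖 B ID κ []).bind fun k =>
        (A.run (cmaOracles (bpvSchnorr 𝓖 B ID κ) k.1.1) (.pair (schnorrPub 𝓖 B κ)
          ((bpvSchnorr 𝓖 B ID κ).pkVal k.1.2)) (k.2, [])).bind fun q =>
          (schnorrVer 𝓖 ID κ q.1.1.fst.toBits (q.1.1.snd.fst.toNat, q.1.1.snd.snd.toNat) k.1.2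
            q.2.1).map fun z =>
              (z.1 && decide (q.1.1.fst.toBits ∉ q.2.2) && decide (q.1.2 ≤ t)) := rfl
  rw [h1, bind_apply_eq_ex]
  congr 1
  funext k
  rw [bind_apply_eq_ex]
  congr 1
  funext q
  rw [winProb, PMF.map, bind_apply_eq_ex]
  congr 1
  funext z
  by_cases h : z.1 = true ∧ q.1.1.fst.toBits ∉ q.2.2 ∧ q.1.2 ≤ t
  · rw [ind_true h]
    simp [h]
  · rw [ind_false h]
    simp only [Function.comp, PMF.pure_apply]
    rw [if_neg]
    intro h'
    apply h
    simpa [and_assoc] using h'.symm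

/-- The advantage in the real attack, in terms of the simulated attack. -/
theorem euCMA_le : euCMA (bpvSchnorr 𝓖 B ID κ) (schnorrPub 𝓖 B κ) A t true ≤
    ∑ i ∈ Finset.range t, exSim 𝓖 B ID κ A (fun x _ _ q =>
      ind (∃ e, ForgesAt 𝓖 κ (𝓖.smul κ x (𝓖.G κ)) t q e ∧ e.2 = some i)) +
    exSim 𝓖 B ID κ A (fun x b h q => ind (ForgesSelf 𝓖 κ t x b h q)) +
    (𝓖.N κ : ℝ≥0∞)⁻¹ +
    t * (t * ex (randTable (𝓖.N κ) (B.k κ)) fun r => maxNonceProb B κ r) +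
    ((𝓖.N κ - 1 : ℕ) : ℝ≥0∞)⁻¹ := by
  set f : ZMod (𝓖.N κ) → ZMod (𝓖.N κ) → ZMod (𝓖.N κ) → (Fin (B.k κ) → ZMod (𝓖.N κ)) → ℝ≥0∞ :=
    fun x b h r => ex (A.run (cmaOracles (bpvSchnorr 𝓖 B ID κ) (x, nonceTable 𝓖 B κ r))
        (attackInput 𝓖 B ID κ x b h) ([(cat 𝓖 κ ID (𝓖.smul κ b (𝓖.G κ)), h)], []))
      (winProb 𝓖 ID κ t (𝓖.smul κ b (𝓖.G κ), 𝓖.smul κ (x - h * b) (𝓖.G κ))) with hf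
  have hf1 : ∀ x b h r, f x b h r ≤ 1 := fun x b h r =>
    ex_le_const _ fun q => ex_le_const _ fun _ => ind_le_one _
  have h1 : euCMA (bpvSchnorr 𝓖 B ID κ) (schnorrPub 𝓖 B κ) A t true =
      ex (randUnit (𝓖.N κ)) fun b => ex (PMF.uniformOfFintype (ZMod (𝓖.N κ))) fun h =>
        ex (randTable (𝓖.N κ) (B.k κ)) fun r => ex (randUnit (𝓖.N κ)) fun d =>
          f (h * b + d) b h r := by
    rw [euCMA_apply_true, schnorrKg_nil]
    simp only [ex_bind, ex_pure]
    rw [ex_comm]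
    congr 1
    funext b
    rw [ex_comm]
    congr 1
    funext h
    rw [ex_comm]
    congr 1
    funext r
    congr 1
    funext d
    simp only [hf, attackInput, add_sub_cancel_left]
    rfl
  -- The key `h * b + d` is replaced by a uniform nonzero residue `x`; accordingly `d` becomes `x -
  -- h * b`.
  have h2 : euCMA (bpvSchnorr 𝓖 B ID κ) (schnorrPub 𝓖 B κ) A t true ≤
      exKeys 𝓖 B κ (fun x r b h => f x b h r) + ((𝓖.N κ - 1 : ℕ) : ℝ≥0∞)⁻¹ := by
    rw [h1]
    calc _ ≤ ex (randUnit (𝓖.N κ)) fun b => ex (PMF.uniformOfFintype (ZMod (𝓖.N κ))) fun h =>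
        ex (randTable (𝓖.N κ) (B.k κ)) fun r => ex (randUnit (𝓖.N κ)) (fun x => f x b h r) +
          ((𝓖.N κ - 1 : ℕ) : ℝ≥0∞)⁻¹ :=
          ex_mono _ fun b => ex_mono _ fun h => ex_mono _ fun r =>
            ex_randUnit_shift_le (f := fun x => f x b h r) (fun x => hf1 x b h r) _
      _ = _ := by
        simp only [ex_add_const, exKeys]
        congr 1
        rw [ex_comm (randUnit (𝓖.N κ)) (randTable (𝓖.N κ) (B.k κ))]
        conv_rhs => enter [2, r]; rw [ex_comm]
        rw [ex_comm (randTable (𝓖.N κ) (B.k κ))]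
        congr 1
        funext b
        conv_rhs => enter [2, r]; rw [ex_comm]
        rw [ex_comm (randTable (𝓖.N κ) (B.k κ))]
  refine h2.trans ?_
  gcongr
  calc exKeys 𝓖 B κ (fun x r b h => f x b h r)
      ≤ exKeys 𝓖 B κ (fun x r b h => ex ((A.tree (attackInput 𝓖 B ID κ x b h)).interp
        (machine (simEv 𝓖 κ (sgnDist 𝓖 B κ x r)) (simPost 𝓖 κ (𝓖.smul κ x (𝓖.G κ))))
        (simStart 𝓖 ID κ b h))
      (fun q => ∑ i ∈ Finset.range t,
        ind (∃ e, ForgesAt 𝓖 κ (𝓖.smul κ x (𝓖.G κ)) t q e ∧ e.2 = some i) +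
        ind (ForgesSelf 𝓖 κ t x b h q)) +
      (𝓖.N κ : ℝ≥0∞)⁻¹ + t * (t * maxNonceProb B κ r)) :=
        ex_mono _ fun x => ex_mono _ fun r => ex_mono _ fun b => ex_mono _ fun h =>
          attack_le A x b h r
    _ = _ := by
      simp only [exSim, exKeys, ex_add, ex_sum, ex_mul_left, ex_const]

end Advantage

/-! ## The simulator as a program -/

/-- State of a simulation that keeps a log and may reuse given random values. -/
abbrev LogSim : Type := Sim × List Val × List Val

section Encoding

variable (𝓖 : GroupFamily) (κ F : ℕ) (X : 𝓖.Pt κ)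

/-- The constants the simulator needs. -/
def fixedVal : Val :=
  -- `F` bounds the sizes of all data and is stored because the programs use it as a number of
  -- iterations.
  .pair (𝓖.context κ) (.pair (.pair (𝓖.ptVal κ (𝓖.G κ)) (𝓖.ptVal κ X)) (.num F))

/-- The random oracle table of the simulator. -/
def Sim.table (a : Sim) : List (Val × Val) := a.entries.map fun e => e.1

def tableVal (T : List (Val × Val)) : Val := listVal (T.map fun e => .pair e.1 e.2)

def stateVal (a : LogSim) : Val :=
  .pair (fixedVal 𝓖 κ F X) (.pair (tableVal a.1.table) (.pair (listVal a.2.1) (listVal a.2.2)))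

/-- Size of the variable part of the state; values to be reused count twice because using them
enters them into the table. -/
def LogSim.weight (a : LogSim) : ℕ :=
  Val.weight (a.1.table.map fun e => .pair e.1 e.2) + Val.weight a.2.1 + 2 * Val.weight a.2.2

def statePot (a : LogSim) : ℕ := (fixedVal 𝓖 κ F X).size + LogSim.weight a + 6

/-- Reaction to a query if the value `v` is drawn. -/
def logPost (i : Option CMAOracle) (x v : Val) (a : LogSim) : Val × LogSim :=
  ((simPost 𝓖 κ X i x v a.1).1, (simPost 𝓖 κ X i x v a.1).2, v :: a.2.1, a.2.2.tail)

variable {𝓖 κ F X}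

theorem size_stateVal_le (a : LogSim) : (stateVal 𝓖 κ F X a).size ≤ statePot 𝓖 κ F X a := by
  simp only [stateVal, statePot, LogSim.weight, tableVal, Val.size_pair, Val.size_listVal]
  omega

theorem ptVal_eq_listVal (A : 𝓖.Pt κ) : listVal (𝓖.ptVal κ A).elems = 𝓖.ptVal κ A := by
  rw [GroupFamily.ptVal, Val.ofBits_eq_listVal, Val.elems_listVal]

theorem size_listVal_append_le (x y : Val) : (listVal (x.elems ++ y.elems)).size ≤
    x.size + y.size := by
  have h1 := x.weight_elems_lt
  have h2 := y.weight_elems_lt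
  rw [Val.size_listVal, Val.weight_append]
  omega

theorem find_table (a : Sim) (w : List Bool) :
    a.table.find? (fun e => e.1.toBits = w) = (a.find w).map fun e => e.1 := by
  rw [Sim.table, List.find?_map]
  rfl

theorem Val.size_le_of_mem {v : Val} {l : List Val} (h : v ∈ l) : v.size + 1 ≤ weight l :=
  List.single_le_sum (fun _ _ => Nat.zero_le _) _ (List.mem_map_of_mem h)

/-- The table and the answer after an event. -/
theorem table_simPost (i : Option CMAOracle) (x v : Val) (a : Sim) :
    (tableVal (simPost 𝓖 κ X i x v a).2.table, (simPost 𝓖 κ X i x v a).1) =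
    match i with
    | none => (tableVal a.table, v)
    | some .hash => match a.find x.toBits with
      | none => (.pair (.pair x v) (tableVal a.table), v)
      | some e => (tableVal a.table, e.1.2)
    | some .sign => (.pair (.pair (listVal (x.elems ++ (𝓖.ptVal κ (commitment 𝓖 κ X v)).elems))
        v.snd) (tableVal a.table), v) := by
  rcases i with _ | _ | _
  · rfl
  · rcases hf : a.find x.toBits with _ | e <;> simp only [simPost, hf] <;> rfl
  · rfl

/-- The value `v` enters the log and, as a whole or in part, possibly the table, hence `2 * v.size`.
The term `s` is for the commitment in the key that a signature programs. -/
theorem weight_logPost_le (i : Option CMAOracle) (x v : Val) (a : LogSim) {s : ℕ}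
    (hs : ∀ A, (𝓖.ptVal κ A).size ≤ s) :
    LogSim.weight (logPost 𝓖 κ X i x v a).2 ≤ Val.weight (a.1.table.map fun e => .pair e.1 e.2) +
      Val.weight a.2.1 + 2 * Val.weight a.2.2.tail + x.size + s + 2 * v.size + 3 := by
  have h1 : Val.weight ((simPost 𝓖 κ X i x v a.1).2.table.map fun e => .pair e.1 e.2) ≤
      Val.weight (a.1.table.map fun e => .pair e.1 e.2) + x.size + s + v.size + 2 := by
    have h2 := congrArg (fun p => p.1.size) (table_simPost (X := X) i x v a.1)
    simp only [tableVal, Val.size_listVal] at h2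
    have h3 := hs (commitment 𝓖 κ X v)
    have h4 := size_listVal_append_le x (𝓖.ptVal κ (commitment 𝓖 κ X v))
    have h5 := v.size_snd_le
    rcases i with _ | _ | _
    · simp only [Val.size_listVal] at h2
      omega
    · rcases hf : a.1.find x.toBits with _ | e <;> rw [hf] at h2 <;>
        simp only [Val.size_pair, Val.size_listVal] at h2 <;> omega
    · simp only [Val.size_pair] at h2
      simp only [Val.size_listVal] at h2 h4
      omega
  simp only [LogSim.weight, logPost]
  have h6 : Val.weight (v :: a.2.1) = v.size + 1 + Val.weight a.2.1 := by simp [Val.weight]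
  omega

end Encoding

/-! ### Efficiency of the deterministic part -/

/-- A query to the simulator. -/
structure SimQuery (𝓖 : GroupFamily) where
  κ : ℕ
  F : ℕ
  X : 𝓖.Pt κ
  a : LogSim
  x : Val
  v : Val
  state_le : (stateVal 𝓖 κ F X a).size ≤ F
  x_le : x.size ≤ F
  v_le : v.size ≤ F

namespace SimQuery

variable {𝓖 : GroupFamily}

def inp (q : SimQuery 𝓖) : Val := .pair (.pair (stateVal 𝓖 q.κ q.F q.X q.a) q.x) q.v

def out (i : Option CMAOracle) (q : SimQuery 𝓖) : Val :=
  .pair (stateVal 𝓖 q.κ q.F q.X (logPost 𝓖 q.κ q.X i q.x q.v q.a).2)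
    (logPost 𝓖 q.κ q.X i q.x q.v q.a).1

theorem lt_two_pow_of_size_le {x : Val} {F : ℕ} (h : x.size ≤ F) : x.toNat < 2 ^ F :=
  Nat.size_le.1 ((Nat.le_of_succ_le (EfficientlyComputable.size_toNat_le x)).trans h)

theorem listVal_snd (l : List Val) : (listVal l).snd = listVal l.tail := by
  cases l <;> rfl

-- All data of a query have size at most `F`, and `F` itself can be read from the state, so loops of
-- length `F` suffice for table lookup, concatenation and scalar multiplication.
open EfficientlyComputable in
theorem efficient (i : Option CMAOracle) :
    EfficientlyComputable (fun q : SimQuery 𝓖 => q.κ + q.F) inp (out i) := by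
  have hκ : PolyBdd (fun q : SimQuery 𝓖 => q.κ + q.F) fun q => q.κ :=
    PolyBdd.self.mono fun q => Nat.le_add_right _ _
  have hF : PolyBdd (fun q : SimQuery 𝓖 => q.κ + q.F) fun q => q.F :=
    PolyBdd.self.mono fun q => Nat.le_add_left _ _
  have h0 : EfficientlyComputable (fun q : SimQuery 𝓖 => q.κ + q.F) inp inp := by
    refine .id (((hF.add hF).add (hF.add (.const 2))).mono fun q => ?_)
    have h1 := q.state_le
    have h2 := q.x_le
    have h3 := q.v_le
    simp only [inp, Val.size_pair]
    omega
  have hfix : EfficientlyComputable (fun q : SimQuery 𝓖 => q.κ + q.F) inp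
    fun q => fixedVal 𝓖 q.κ q.F q.X := h0.fst.fst.fst
  have hx : EfficientlyComputable (fun q : SimQuery 𝓖 => q.κ + q.F) inp fun q => q.x := h0.fst.snd
  have hv : EfficientlyComputable (fun q : SimQuery 𝓖 => q.κ + q.F) inp fun q => q.v := h0.snd
  have htab : EfficientlyComputable (fun q : SimQuery 𝓖 => q.κ + q.F) inp
    fun q => tableVal q.a.1.table := h0.fst.fst.snd.fst
  have hlog : EfficientlyComputable (fun q : SimQuery 𝓖 => q.κ + q.F) inp
    fun q => listVal q.a.2.1 := h0.fst.fst.snd.snd.fst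
  have hrep : EfficientlyComputable (fun q : SimQuery 𝓖 => q.κ + q.F) inp
    fun q => listVal q.a.2.2 := h0.fst.fst.snd.snd.snd
  have hFc : EfficientlyComputable (fun q : SimQuery 𝓖 => q.κ + q.F) inp
    fun q => .num q.F := hfix.snd.snd
  have hctx : EfficientlyComputable (fun q : SimQuery 𝓖 => q.κ + q.F) inp
    fun q => 𝓖.context q.κ := hfix.fst
  have hG : EfficientlyComputable (fun q : SimQuery 𝓖 => q.κ + q.F) inp
    fun q => 𝓖.ptVal q.κ (𝓖.G q.κ) := hfix.snd.fst.fst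
  have hX : EfficientlyComputable (fun q : SimQuery 𝓖 => q.κ + q.F) inp
    fun q => 𝓖.ptVal q.κ q.X := hfix.snd.fst.snd
  have hxF : ∀ q : SimQuery 𝓖, q.x.elems.length ≤ q.F := fun q =>
    q.x.length_elems_le.trans q.x_le
  have htw : ∀ q : SimQuery 𝓖, Val.weight (q.a.1.table.map fun e => .pair e.1 e.2) ≤ q.F :=
    fun q => by
      have := q.state_le
      simp only [stateVal, tableVal, Val.size_pair, Val.size_listVal] at this
      omega
  have key : EfficientlyComputable (fun q : SimQuery 𝓖 => q.κ + q.F) inp fun q =>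
      .pair (tableVal (simPost 𝓖 q.κ q.X i q.x q.v q.a.1).2.table)
        (simPost 𝓖 q.κ q.X i q.x q.v q.a.1).1 := by
    have hpair := fun q : SimQuery 𝓖 => table_simPost (X := q.X) i q.x q.v q.a.1
    rcases i with _ | _ | _
    · exact htab.pair hv
    · have hl := lookup (T := fun q : SimQuery 𝓖 => q.a.1.table) hF hFc hx htab hxF
        (fun q => by simpa using (Val.length_le_weight _).trans (htw q))
        (fun q e he => by
          have h1 := Val.size_le_of_mem (List.mem_map_of_mem (f := fun e : Val × Val =>
            Val.pair e.1 e.2) he)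
          have h2 := e.1.length_elems_le
          have h3 := htw q
          simp only [Val.size_pair] at h1
          omega)
      classical
      refine (ite (p := fun q : SimQuery 𝓖 => ∃ b c, foundVal (q.a.1.table.find?
        fun e => e.1.toBits = q.x.toBits) = .pair b c) hl.isNum
        (fun q => Val.isNum_eq_zero_iff _) (htab.pair hl.snd)
        (((hx.pair hv).pair htab).pair hv)).congr fun q => ?_
      have h1 := hpair q
      simp only [find_table]
      rcases hf : q.a.1.find q.x.toBits with _ | e
      · rw [hf] at h1
        rw [if_neg (by simp [foundVal])]
        simp only [Prod.mk.injEq] at h1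
        rw [h1.1, h1.2]
      · rw [hf] at h1
        rw [if_pos ⟨_, _, rfl⟩]
        simp only [Prod.mk.injEq] at h1
        rw [h1.1, h1.2]
        rfl
    · have hNF : ∀ q : SimQuery 𝓖, 𝓖.N q.κ ≤ 2 ^ q.F := fun q => by
        refine (Nat.lt_size_self _).le.trans (Nat.pow_le_pow_right two_pos ?_)
        have := q.state_le
        simp only [stateVal, fixedVal, GroupFamily.context, Val.size_pair, Val.size_num] at this
        omega
      have hvs : ∀ q : SimQuery 𝓖, q.v.snd.toNat < 2 ^ q.F := fun q =>
        lt_two_pow_of_size_le (q.v.size_snd_le.trans q.v_le)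
      have hvf : ∀ q : SimQuery 𝓖, q.v.fst.toNat < 2 ^ q.F := fun q =>
        lt_two_pow_of_size_le (q.v.size_fst_le.trans q.v_le)
      have hc := ptAdd hκ hctx (ptNsmul hκ hF hvs hNF hctx hX hv.snd.toNat hFc)
        (ptNsmul hκ hF hvf hNF hctx hG hv.fst.toNat hFc)
      exact (((append (l := fun q : SimQuery 𝓖 =>
        (𝓖.ptVal q.κ (commitment 𝓖 q.κ q.X q.v)).elems) hF hFc hx
        (hc.congr fun q => (ptVal_eq_listVal _).symm) hxF).pair hv.snd).pair htab).pair hv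
  refine ((hfix.pair (key.fst.pair ((hv.pair hlog).pair hrep.snd))).pair key.snd).congr fun q => ?_
  simp only [out, logPost, stateVal, Val.fst_pair, Val.snd_pair, listVal_snd, listVal]

end SimQuery

/-! ### The programs that answer queries -/

section Handlers

/-- A program that computes the reaction to a query. -/
noncomputable def postProg (𝓖 : GroupFamily) (i : Option CMAOracle) : Prog Empty :=
  (SimQuery.efficient (𝓖 := 𝓖) i).choose

/-- The values to be reused, from a state and a query. -/
def replayProg : Prog Unit := .seq .fst (.seq .snd (.seq .snd .snd))

/-- A new random value for a query; signatures come from the oracle. -/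
def freshProg : Option CMAOracle → Prog Unit
  | none => .seq .snd .rand
  | some .hash => .seq .fst (.seq .fst (.seq .fst (.seq .snd (.seq .fst .rand))))
  | some .sign => .ask ()

def valueProg (i : Option CMAOracle) : Prog Unit :=
  .ifz (.seq replayProg .isNum) (.seq replayProg .fst) (freshProg i)

noncomputable def handler (𝓖 : GroupFamily) (i : Option CMAOracle) : Prog Unit :=
  .seq (.fork .id (valueProg i)) (postProg 𝓖 i).embed

theorem den_postProg (𝓖 : GroupFamily) (i : Option CMAOracle) :
    ∃ p : ℕ[X], ∀ q : SimQuery 𝓖, ∃ c ≤ p.eval (q.κ + q.F),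
      (postProg 𝓖 i).den noEv q.inp = PMF.pure (q.out i, c) := by
  obtain ⟨p, hp⟩ := (SimQuery.efficient (𝓖 := 𝓖) i).choose_spec
  refine ⟨p, fun q => ?_⟩
  obtain ⟨c, hc, h⟩ := hp q
  exact ⟨c, hc, by rw [← h, Prog.runPlain_eq_den]; rfl⟩

variable {𝓖 : GroupFamily} {κ F : ℕ} {X : 𝓖.Pt κ} {μ : PMF Val}

theorem den_replayProg (ev : Unit → Val → PMF Val) (a : LogSim) (x : Val) :
    ∃ c ≤ 12 * ((stateVal 𝓖 κ F X a).size + x.size + 1),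
      replayProg.den ev (.pair (stateVal 𝓖 κ F X a) x) = PMF.pure (listVal a.2.2, c) := by
  simp only [replayProg, Prog.den_seq, Prog.den_fst, Prog.den_snd, PMF.pure_bind, PMF.pure_map,
    Val.fst_pair, Val.snd_pair, stateVal]
  refine ⟨_, ?_, rfl⟩
  simp only [stepCost, Val.size_pair]
  omega

theorem den_freshProg (i : Option CMAOracle) (a : LogSim) (x : Val) :
    ∃ c : Val → ℕ, (∀ v, c v ≤ 16 * ((stateVal 𝓖 κ F X a).size + x.size + v.size + 1)) ∧
      (freshProg i).den (fun _ _ => μ) (.pair (stateVal 𝓖 κ F X a) x) =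
        (simEv 𝓖 κ μ i x).map fun v => (v, c v) := by
  rcases i with _ | _ | _
  · simp only [freshProg, Prog.den_seq, Prog.den_snd, Prog.den_rand, PMF.pure_bind, PMF.map_comp,
      Val.snd_pair, simEv]
    refine ⟨_, fun v => ?_, rfl⟩
    simp only [stepCost, Val.size_pair]
    omega
  · simp only [freshProg, Prog.den_seq, Prog.den_fst, Prog.den_snd, Prog.den_rand, PMF.pure_bind,
      PMF.map_comp, Val.fst_pair, Val.snd_pair, stateVal, fixedVal, GroupFamily.context, simEv]
    refine ⟨_, fun v => ?_, rfl⟩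
    simp only [Function.comp, stepCost, Val.size_pair]
    omega
  · simp only [freshProg, Prog.den_ask, simEv]
    refine ⟨_, fun v => ?_, rfl⟩
    simp only [stepCost, Val.size_pair]
    omega

theorem den_valueProg (i : Option CMAOracle) (a : LogSim) (x : Val) :
    ∃ c : Val → ℕ, (∀ v, c v ≤ 40 * ((stateVal 𝓖 κ F X a).size + x.size + v.size + 1)) ∧
      (valueProg i).den (fun _ _ => μ) (.pair (stateVal 𝓖 κ F X a) x) =
        (match a.2.2 with
          | [] => simEv 𝓖 κ μ i x
          | v :: _ => PMF.pure v).map fun v => (v, c v) := by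
  obtain ⟨c₁, hc₁, h₁⟩ := den_replayProg (𝓖 := 𝓖) (F := F) (X := X) (fun _ _ => μ) a x
  obtain ⟨c₂, hc₂, h₂⟩ := den_freshProg (𝓖 := 𝓖) (F := F) (X := X) (μ := μ) i a x
  have hrep : (listVal a.2.2).size ≤ (stateVal 𝓖 κ F X a).size := by
    simp only [stateVal, Val.size_pair]
    omega
  rcases hl : a.2.2 with _ | ⟨v, l⟩
  · simp only [valueProg, Prog.den_ifz, Prog.den_seq, h₁, hl, PMF.pure_bind, Prog.den_isNum,
      PMF.pure_map, listVal, Val.isNum, h₂, Val.num.injEq, one_ne_zero, if_false, PMF.map_comp]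
    refine ⟨_, fun u => ?_, rfl⟩
    have := hc₂ u
    simp only [stepCost, Val.size_num, Nat.size_one, Nat.size_zero]
    omega
  · have h3 : (Val.pair v (listVal l)).size ≤ (stateVal 𝓖 κ F X a).size := by
      rwa [hl] at hrep
    simp only [valueProg, Prog.den_ifz, Prog.den_seq, h₁, hl, PMF.pure_bind, Prog.den_isNum,
      PMF.pure_map, listVal, Val.isNum, if_true, Prog.den_fst, Val.fst_pair]
    refine ⟨fun _ => _, fun u => ?_, rfl⟩
    simp only [stepCost, Val.size_pair, Val.size_num, Nat.size_zero] at h3 ⊢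
    omega

theorem size_coin_le {x v : Val} (h : v ∈ (coin x).support) : v.size ≤ x.size := by
  rw [coin, PMF.mem_support_map_iff] at h
  obtain ⟨n, hn, rfl⟩ := h
  have h1 := Nat.size_le_size (uniformBelow_le hn)
  have h2 := EfficientlyComputable.size_toNat_le x
  simp only [Val.size_num]
  omega

theorem size_simEv_le {i : Option CMAOracle} {x v : Val}
    (hμ : ∀ v ∈ μ.support, v.size ≤ 2 * (𝓖.N κ).size + 3)
    (h : v ∈ (simEv 𝓖 κ μ i x).support) : v.size ≤ x.size + 2 * (𝓖.N κ).size + 3 := by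
  rcases i with _ | _ | _
  · have := size_coin_le h
    omega
  · have := size_coin_le h
    simp only [Val.size_num] at this
    omega
  · have := hμ v h
    omega

theorem logMachine_eq (i : Option CMAOracle) (x : Val) (a : LogSim) :
    logMachine (simEv 𝓖 κ μ) (simPost 𝓖 κ X) i x a =
      (match a.2.2 with
        | [] => simEv 𝓖 κ μ i x
        | v :: _ => PMF.pure v).map fun v => logPost 𝓖 κ X i x v a := by
  rcases hl : a.2.2 with _ | ⟨v, l⟩ <;> simp only [logMachine, hl, logPost, PMF.pure_map] <;> rfl

/-- The handlers implement the simulator's oracles. -/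
theorem exists_handles (𝓖 : GroupFamily) : ∃ w : ℕ[X],
    (∀ κ F, 100 * (F + 1) ≤ w.eval (κ + F)) ∧ ∀ (κ F t s D : ℕ) (X : 𝓖.Pt κ)
    (μ : PMF Val), (∀ v ∈ μ.support, v.size ≤ 2 * (𝓖.N κ).size + 3) → (𝓖.N κ).size ≤ s →
    (∀ A, (𝓖.ptVal κ A).size ≤ s) → 3 * t + 5 * s + 9 ≤ D →
    Handles (fun _ _ => μ) (handler 𝓖) (logMachine (simEv 𝓖 κ μ) (simPost 𝓖 κ X))
      (stateVal 𝓖 κ F X) (statePot 𝓖 κ F X) t F D (w.eval (κ + F)) := by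
  choose p hp using den_postProg 𝓖
  refine ⟨p none + p (some .hash) + p (some .sign) + 1000 * (Polynomial.X + 1),
    fun κ F => ?_, ?_⟩
  · simp only [Polynomial.eval_add, Polynomial.eval_mul, Polynomial.eval_ofNat, Polynomial.eval_X,
      Polynomial.eval_one]
    omega
  intro κ F t s D X μ hμ hN hs hD i x a hx ha
  have hi : (p i).eval (κ + F) ≤
      (p none + p (some .hash) + p (some .sign)).eval (κ + F) := by
    simp only [Polynomial.eval_add]
    rcases i with _ | _ | _ <;> omega
  obtain ⟨c, hc, hden⟩ := den_valueProg (𝓖 := 𝓖) (F := F) (X := X) (μ := μ) i a x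
  have hsz := size_stateVal_le (𝓖 := 𝓖) (F := F) (X := X) a
  rw [logMachine_eq, handler, Prog.den_seq, Prog.den_fork, Prog.den_id, PMF.pure_bind, hden,
    PMF.map_comp, PMF.bind_map, PMF.map]
  refine Approx.bind_same fun v hv => ?_
  -- A fresh value has size at most `t + 2 * s + 3` and counts twice; together with the query, the
  -- commitment and the constant `3` this gives `3 * t + 5 * s + 9`. A reused value pays for itself,
  -- since it counted twice in the list that it leaves.
  have hvw : v.size ≤ F ∧ LogSim.weight (logPost 𝓖 κ X i x v a).2 ≤ LogSim.weight a + D := by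
    have h1 := weight_logPost_le (X := X) i x v a hs
    rcases hl : a.2.2 with _ | ⟨u, l⟩
    · rw [hl] at hv h1
      have := size_simEv_le hμ hv
      refine ⟨by omega, h1.trans ?_⟩
      simp only [LogSim.weight, hl, List.tail_nil]
      omega
    · rw [hl] at hv h1
      simp only [PMF.support_pure, Set.mem_singleton_iff] at hv
      subst hv
      have h2 : Val.weight (v :: l) = v.size + 1 + Val.weight l := by simp [Val.weight]
      refine ⟨?_, h1.trans ?_⟩
      · simp only [statePot, LogSim.weight, hl] at ha
        omega
      · simp only [LogSim.weight, hl, List.tail_cons]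
        omega
  obtain ⟨hvF, hw⟩ := hvw
  obtain ⟨C, hC, hpost⟩ := hp i ⟨κ, F, X, a, x, v, by omega, by omega, hvF⟩
  simp only [Function.comp, Prog.den_embed]
  simp only [SimQuery.inp] at hpost
  rw [hpost, PMF.pure_map]
  refine Approx.pure ⟨rfl, ?_, ?_⟩
  · simp only [statePot]
    omega
  · have := hc v
    simp only [stepCost, Val.size_pair, Polynomial.eval_add, Polynomial.eval_mul,
      Polynomial.eval_ofNat, Polynomial.eval_X, Polynomial.eval_one] at hC hi ⊢
    omega

theorem size_sgnDist_le {B : BPVParams} {x : ZMod (𝓖.N κ)} {r : Fin (B.k κ) → ZMod (𝓖.N κ)}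
    {v : Val} (h : v ∈ (sgnDist 𝓖 B κ x r).support) : v.size ≤ 2 * (𝓖.N κ).size + 3 := by
  rw [sgnDist, PMF.mem_support_map_iff] at h
  obtain ⟨p, -, rfl⟩ := h
  have h1 := Nat.size_le_size (ZMod.val_lt p.1).le
  have h2 := Nat.size_le_size (ZMod.val_lt p.2).le
  simp only [sgnPair, Val.size_pair, Val.size_num]
  omega

end Handlers

/-! ## The attack on the hidden subset sum problem -/

/-- Addition reads the context and two points, and reading is charged; so its running time bounds
their sizes. -/
theorem GroupFamily.exists_bound (𝓖 : GroupFamily) : ∃ s : ℕ[X], ∀ κ,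
    (𝓖.context κ).size ≤ s.eval κ ∧ (𝓖.N κ).size ≤ s.eval κ ∧
      ∀ A, (𝓖.ptVal κ A).size ≤ s.eval κ := by
  obtain ⟨s, hs⟩ := 𝓖.add_efficient.size_inp
  refine ⟨s, fun κ => ?_⟩
  have h : ∀ A, (𝓖.context κ).size + (𝓖.ptVal κ A).size ≤ s.eval κ := fun A => by
    have := hs ⟨κ, (A, A)⟩
    simp only [Val.size_pair] at this
    simp only [GroupFamily.context, GroupFamily.ptVal, Val.size_pair]
    omega
  have h0 := h 0
  refine ⟨by omega, ?_, fun A => by have := h A; omega⟩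
  simp only [GroupFamily.context, Val.size_pair, Val.size_num] at h0
  omega

/-- A challenge together with the random choices made before the attack; `j` says in which event
the forgery is expected (`0` for key generation). -/
structure KeyChoice (𝓖 : GroupFamily) (B : BPVParams) (p : ℕ[X]) where
  κ : ℕ
  x : ZMod (𝓖.N κ)
  c : ℕ
  h : ZMod (𝓖.N κ)
  j : ℕ
  c_lt : c < 𝓖.N κ
  j_le : j ≤ p.eval κ
  -- Neither `v` nor `k` is assumed to be polynomially bounded. The bound on the size of `(v, k)`
  -- may be imposed because an attacker that has no time to read this pair never wins
  -- (`euCMA_eq_zero`).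
  pub_le : (B.toVal κ).size ≤ p.eval κ

namespace KeyChoice

variable {𝓖 : GroupFamily} {B : BPVParams} {p : ℕ[X]}

/-- For `c` uniform below `N - 1` this is a uniform nonzero residue. -/
def b (k : KeyChoice 𝓖 B p) : ZMod (𝓖.N k.κ) := ((k.c + 1 : ℕ) : ZMod (𝓖.N k.κ))

def X (k : KeyChoice 𝓖 B p) : 𝓖.Pt k.κ := 𝓖.smul k.κ k.x (𝓖.G k.κ)

def challenge (k : KeyChoice 𝓖 B p) : Val :=
  .pair (.pair (𝓖.params k.κ) (B.toVal k.κ)) (𝓖.ptVal k.κ k.X)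

def inp (k : KeyChoice 𝓖 B p) : Val :=
  .pair (.pair (.pair k.challenge (.num k.c)) (.num k.h.val)) (.num k.j)

variable (ID : ℕ → List Bool) (F : ℕ[X])

def start (k : KeyChoice 𝓖 B p) : Sim := simStart 𝓖 (ID k.κ) k.κ k.b k.h

/-- Encoded state of the simulator. -/
def state (k : KeyChoice 𝓖 B p) (a : LogSim) : Val := stateVal 𝓖 k.κ (F.eval k.κ) k.X a

def attack (k : KeyChoice 𝓖 B p) : Val := attackInput 𝓖 B (ID k.κ) k.κ k.x k.b k.h

variable {ID F}

theorem size_inp_le : PolyBdd (fun k : KeyChoice 𝓖 B p => k.κ) fun k => k.inp.size := by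
  obtain ⟨s, hs⟩ := 𝓖.exists_bound
  refine PolyBdd.mono (g := fun k => 5 * s.eval k.κ + 2 * p.eval k.κ + 12)
    ⟨5 * s + 2 * p + 12, fun k => by simp⟩ fun k => ?_
  obtain ⟨h1, h2, h3⟩ := hs k.κ
  have h4 := h3 (𝓖.G k.κ)
  have h5 := h3 k.X
  have h6 := Nat.size_le_size k.c_lt.le
  have h7 := Nat.size_le_size (ZMod.val_lt k.h).le
  have h8 := Nat.size_le_size k.j_le
  have h9 : (p.eval k.κ).size ≤ p.eval k.κ := Nat.size_le.2 (Nat.lt_two_pow_self)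
  have h10 := k.pub_le
  simp only [inp, challenge, GroupFamily.params, GroupFamily.context, Val.size_pair,
    Val.size_num] at h1 ⊢
  omega

open EfficientlyComputable in
/-- Preparation of the first run. -/
theorem efficient_first (hID : EfficientlyComputable (fun κ : ℕ => κ) Val.num
      (fun κ => Val.ofBits (ID κ))) :
    EfficientlyComputable (fun k : KeyChoice 𝓖 B p => k.κ) inp
      fun k => .pair k.inp (.pair (k.state F (k.start ID, [], [])) (k.attack ID)) := by
  obtain ⟨s, hs⟩ := 𝓖.exists_bound
  have hκ : PolyBdd (fun k : KeyChoice 𝓖 B p => k.κ) fun k => k.κ := .self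
  have h0 : EfficientlyComputable (fun k : KeyChoice 𝓖 B p => k.κ) inp inp := .id size_inp_le
  have hch : EfficientlyComputable (fun k : KeyChoice 𝓖 B p => k.κ) inp challenge :=
    h0.fst.fst.fst
  have hc : EfficientlyComputable (fun k : KeyChoice 𝓖 B p => k.κ) inp fun k => .num k.c :=
    h0.fst.fst.snd
  have hh : EfficientlyComputable (fun k : KeyChoice 𝓖 B p => k.κ) inp fun k => .num k.h.val :=
    h0.fst.snd
  have hX : EfficientlyComputable (fun k : KeyChoice 𝓖 B p => k.κ) inp
    fun k => 𝓖.ptVal k.κ k.X := hch.snd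
  have hpub : EfficientlyComputable (fun k : KeyChoice 𝓖 B p => k.κ) inp
    fun k => schnorrPub 𝓖 B k.κ := hch.fst
  have hctx : EfficientlyComputable (fun k : KeyChoice 𝓖 B p => k.κ) inp
    fun k => 𝓖.context k.κ := hpub.fst.fst
  have hG : EfficientlyComputable (fun k : KeyChoice 𝓖 B p => k.κ) inp
    fun k => 𝓖.ptVal k.κ (𝓖.G k.κ) := hpub.fst.snd
  have hN : EfficientlyComputable (fun k : KeyChoice 𝓖 B p => k.κ) inp
    fun k => .num (𝓖.N k.κ) := hctx.snd.fst
  have hκc : EfficientlyComputable (fun k : KeyChoice 𝓖 B p => k.κ) inp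
    fun k => .num k.κ := hctx.fst
  have h1 : EfficientlyComputable (fun k : KeyChoice 𝓖 B p => k.κ) inp fun _ => .num 1 :=
    const size_inp_le _
  have hnil : EfficientlyComputable (fun k : KeyChoice 𝓖 B p => k.κ) inp fun _ => .num 0 :=
    const size_inp_le _
  have hid : EfficientlyComputable (fun k : KeyChoice 𝓖 B p => k.κ) inp
    fun k => .ofBits (ID k.κ) :=
    hκc.comp (hID.reindex fun k : KeyChoice 𝓖 B p => k.κ)
  have hsc := polyEval s hκc
  have hNs : ∀ k : KeyChoice 𝓖 B p, 𝓖.N k.κ < 2 ^ s.eval k.κ := fun k =>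
    (Nat.lt_size_self _).trans_le (Nat.pow_le_pow_right two_pos (hs k.κ).2.1)
  have hU : EfficientlyComputable (fun k : KeyChoice 𝓖 B p => k.κ) inp
      fun k => 𝓖.ptVal k.κ (𝓖.smul k.κ k.b (𝓖.G k.κ)) :=
    (ptNsmul hκ (PolyBdd.eval s hκ) (n := fun k => k.c + 1)
      (fun k => (Nat.succ_le_of_lt k.c_lt).trans_lt (hNs k)) (fun k => (hNs k).le) hctx hG
      (hc.add h1) hsc).congr fun k => by rw [b, 𝓖.smul_natCast]
  have hD : EfficientlyComputable (fun k : KeyChoice 𝓖 B p => k.κ) inp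
      fun k => 𝓖.ptVal k.κ (𝓖.smul k.κ (k.x - k.h * k.b) (𝓖.G k.κ)) := by
    -- The summand `-h × U` is computed as `(N - h) × U`.
    refine (ptAdd hκ hctx hX (ptNsmul hκ (PolyBdd.eval s hκ) (n := fun k => 𝓖.N k.κ - k.h.val)
      (fun k => (Nat.sub_le _ _).trans_lt (hNs k)) (fun k => (hNs k).le) hctx hU (hN.sub hh)
      hsc)).congr fun k => ?_
    have h2 : ((𝓖.N k.κ - k.h.val : ℕ) : ZMod (𝓖.N k.κ)) = -k.h := by
      rw [Nat.cast_sub (ZMod.val_lt k.h).le]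
      simp
    rw [← 𝓖.smul_natCast, h2, 𝓖.smul_smul, X, ← 𝓖.smul_add]
    congr 2
    ring
  obtain ⟨i, hi⟩ := hID.size_out
  have hkey := append (l := fun k : KeyChoice 𝓖 B p =>
    (𝓖.ptVal k.κ (𝓖.smul k.κ k.b (𝓖.G k.κ))).elems) (PolyBdd.eval i hκ) (polyEval i hκc) hid
    (hU.congr fun k => (ptVal_eq_listVal _).symm) fun k => (Val.length_elems_le _).trans (hi k.κ)
  exact h0.pair (((hctx.pair ((hG.pair hX).pair (polyEval F hκc))).pair
    (((hkey.pair hh).pair hnil).pair (hnil.pair hnil))).pair (hpub.pair (hid.pair (hU.pair hD))))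

end KeyChoice

variable {𝓖 : GroupFamily} {B : BPVParams} {p : ℕ[X]} {ID : ℕ → List Bool} {F : ℕ[X]}

/-- The first run of the attacker: choice of keys, final state, and output. -/
structure FirstRun (𝓖 : GroupFamily) (B : BPVParams) (p F : ℕ[X]) extends KeyChoice 𝓖 B p where
  a : LogSim
  out : Val
  state_le : (toKeyChoice.state F a).size ≤ F.eval κ
  out_le : out.size ≤ p.eval κ

namespace FirstRun

/-- The random values to be used again. -/
def reused (q : FirstRun 𝓖 B p F) : List Val := q.a.2.1.reverse.take (q.j - 1)

open EfficientlyComputable in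
/-- Preparation of the second run. -/
theorem efficient_second (hID : EfficientlyComputable (fun κ : ℕ => κ) Val.num
      (fun κ => Val.ofBits (ID κ))) :
    EfficientlyComputable (fun q : FirstRun 𝓖 B p F => q.κ)
      (fun q => .pair (.pair q.inp (.pair (q.state F (q.start ID, [], [])) (q.attack ID)))
        (.pair (q.state F q.a) q.out))
      fun q => .pair (.pair q.inp q.out)
        (.pair (q.state F (q.start ID, [], q.reused)) (q.attack ID)) := by
  have hκ : PolyBdd (fun q : FirstRun 𝓖 B p F => q.κ) fun q => q.κ := .self
  have h0 := EfficientlyComputable.id (m := fun q : FirstRun 𝓖 B p F => q.κ)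
    (inp := fun q => .pair (.pair q.inp (.pair (q.state F (q.start ID, [], [])) (q.attack ID)))
        (.pair (q.state F q.a) q.out))
    (((((KeyChoice.efficient_first (𝓖 := 𝓖) (B := B) (p := p) (F := F) hID).size_out.reindex
      toKeyChoice).add ((PolyBdd.eval F hκ).add (PolyBdd.eval p hκ))).add (.const 2)).mono
      fun q => by
        have h1 := q.state_le
        have h2 := q.out_le
        simp only [Val.size_pair] at h1 ⊢
        omega)
  have hst := h0.fst.snd.fst
  have hF := hst.fst.snd.snd
  have hFb := PolyBdd.eval F hκ
  have hlog := h0.snd.fst.snd.snd.fst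
  have hnil := const h0.size_inp (.num 0)
  have hj := h0.fst.fst.snd.sub (const h0.size_inp (.num 1))
  -- The log has the latest value first. It is reversed, the first `j - 1` values are taken, and the
  -- reversal caused by taking them is undone.
  have hrev := revTake (l := fun _ => []) hFb hF hlog hnil
  have hrev2 := revTake (n := fun q : FirstRun 𝓖 B p F => q.j - 1) (l := fun _ => [])
    ((PolyBdd.eval p hκ).mono fun q => (Nat.sub_le _ _).trans q.j_le) hj hrev hnil
  have hrev3 := revTake (l := fun _ => []) hFb hF hrev2 hnil
  refine ((h0.fst.fst.pair h0.snd.snd).pair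
    ((hst.fst.pair (hst.snd.fst.pair (hst.snd.snd.fst.pair hrev3))).pair h0.fst.snd.snd)).congr
    fun q => ?_
  have h1 : q.a.2.1.length ≤ F.eval q.κ := by
    have h2 := q.state_le
    have h3 := Val.length_le_weight q.a.2.1
    simp only [KeyChoice.state, stateVal, Val.size_pair, Val.size_listVal] at h2
    omega
  simp only [KeyChoice.state, stateVal, Val.fst_pair, Val.snd_pair, List.append_nil,
    Val.elems_listVal, List.take_of_length_le h1, reused]
  rw [List.take_of_length_le (l := (q.a.2.1.reverse.take (q.j - 1)).reverse), List.reverse_reverse]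
  simp only [List.length_reverse, List.length_take]
  omega

end FirstRun

/-- Both runs of the attacker. -/
structure BothRuns (𝓖 : GroupFamily) (B : BPVParams) (p F : ℕ[X]) extends KeyChoice 𝓖 B p where
  out₁ : Val
  out₂ : Val
  a : LogSim
  state_le : (toKeyChoice.state F a).size ≤ F.eval κ
  out₁_le : out₁.size ≤ p.eval κ
  out₂_le : out₂.size ≤ p.eval κ

/-- The secret as computed from the outputs of both runs. -/
def KeyChoice.answer (k : KeyChoice 𝓖 B p) (o₁ o₂ : Val) : ZMod (𝓖.N k.κ) :=
  -- For `j = 0` the commitment is `U`, so the equation is `e * x + s = 0 * x + (c + 1)`.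
  if k.j = 0 then solve (o₁.snd.fst.toNat : ZMod (𝓖.N k.κ)) o₁.snd.snd.toNat (k.c + 1 : ℕ) (0 : ℕ)
  else solve (o₁.snd.fst.toNat : ZMod (𝓖.N k.κ)) o₁.snd.snd.toNat o₂.snd.fst.toNat
    o₂.snd.snd.toNat

open EfficientlyComputable in
theorem BothRuns.efficient_answer : EfficientlyComputable (fun q : BothRuns 𝓖 B p F => q.κ)
    (fun q => .pair (.pair q.inp q.out₁) (.pair (q.state F q.a) q.out₂))
    fun q => .num (q.answer q.out₁ q.out₂).val := by
  obtain ⟨s, hs⟩ := 𝓖.exists_bound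
  have hκ : PolyBdd (fun q : BothRuns 𝓖 B p F => q.κ) fun q => q.κ := .self
  have hp := PolyBdd.eval p hκ
  have h0 := EfficientlyComputable.id (m := fun q : BothRuns 𝓖 B p F => q.κ)
    (inp := fun q => .pair (.pair q.inp q.out₁) (.pair (q.state F q.a) q.out₂))
    (((((KeyChoice.size_inp_le (𝓖 := 𝓖) (B := B) (p := p)).reindex toKeyChoice).add hp).add
      ((PolyBdd.eval F hκ).add hp)).add (.const 3) |>.mono fun q => by
        have h1 := q.state_le
        have h2 := q.out₁_le
        have h3 := q.out₂_le
        simp only [Val.size_pair] at h1 ⊢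
        omega)
  have hctx := h0.fst.fst.fst.fst.fst.fst.fst.fst
  have hsc := polyEval s (f := fun q : BothRuns 𝓖 B p F => q.κ) hctx.fst
  have hN : EfficientlyComputable (fun q : BothRuns 𝓖 B p F => q.κ)
    (fun q => .pair (.pair q.inp q.out₁) (.pair (q.state F q.a) q.out₂))
    fun q => .num (𝓖.N q.κ) := hctx.snd.fst
  have hNs : ∀ q : BothRuns 𝓖 B p F, 𝓖.N q.κ ≤ 2 ^ s.eval q.κ := fun q =>
    ((Nat.lt_size_self _).trans_le (Nat.pow_le_pow_right two_pos (hs q.κ).2.1)).le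
  have hsb := PolyBdd.eval s hκ
  have h1 := h0.fst.snd.snd
  have h2 := h0.snd.snd.snd
  have hj := h0.fst.fst.snd
  have hc := h0.fst.fst.fst.fst.snd.add (const h0.size_inp (.num 1))
  refine (ite (p := fun q : BothRuns 𝓖 B p F => q.j = 0) hj (fun q => by
      simp [KeyChoice.inp]) (zmodSolve hsb hNs hN hsc h1.fst.toNat h1.snd.toNat hc
        (const h0.size_inp (.num 0)))
    (zmodSolve hsb hNs hN hsc h1.fst.toNat h1.snd.toNat h2.fst.toNat h2.snd.toNat)).congr
      fun q => ?_
  simp only [KeyChoice.answer]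
  split_ifs <;> rfl

/-! ### The complete program -/

namespace Approx

variable {α β γ δ : Type*} {ε : ℝ≥0∞} {μ : PMF α} {ν : PMF β}

theorem of_map {R : γ → β → Prop} {F : α → γ} (h : Approx ε R (μ.map F) ν) :
    Approx ε (fun a b => R (F a) b) μ ν := by
  intro f g hf hfg
  refine le_trans ?_ (h (fun c => ⨆ a, ⨆ _ : F a = c, f a) g
    (fun c => iSup₂_le fun a _ => hf a) fun c b hcb => iSup₂_le fun a ha => hfg a b (show R (F a) b from ha ▸ hcb))
  rw [ex_map]
  exact ex_mono _ fun a => le_iSup₂ (f := fun a' (_ : F a' = F a) => f a') a rfl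

end Approx

section Sequencing

variable {ι : Type} {ev : ι → Val → PMF Val} {K C P Q : Prog ι} {v v' : Val} {c : ℕ}

theorem Prog.den_seq_of_pure (hP : P.den ev v = PMF.pure (v', c)) :
    (Prog.seq P Q).den ev v = (Q.den ev v').map fun r => (r.1, c + r.2 + 1) := by
  rw [Prog.den_seq, hP, PMF.pure_bind]

theorem Prog.den_seq_fork_snd (hK : K.den ev v = PMF.pure (v', c)) :
    (Prog.seq (.fork K (.seq .snd C)) Q).den ev v = (C.den ev v.snd).bind fun o =>
      (Q.den ev (.pair v' o.1)).map fun r =>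
        (r.1, c + (stepCost v v.snd + o.2 + 1) + 1 + r.2 + 1) := by
  simp only [Prog.den_seq, Prog.den_fork, Prog.den_snd, hK, PMF.pure_bind, PMF.map_comp,
    PMF.bind_map, Function.comp_def]

end Sequencing

section Main

variable {𝓖 : GroupFamily} {B : BPVParams} {p : ℕ[X]} {ID : ℕ → List Bool}

/-- Fuel `F`, growth `D` of the state per query, and cost `w` per step of the simulation. -/
theorem exists_fuel (B : BPVParams) (p : ℕ[X]) (hID : EfficientlyComputable (fun κ : ℕ => κ) Val.num
      (fun κ => Val.ofBits (ID κ))) : ∃ F D w : ℕ[X], ∀ k : KeyChoice 𝓖 B p,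
    (∀ μ : PMF Val, (∀ v ∈ μ.support, v.size ≤ 2 * (𝓖.N k.κ).size + 3) →
      Handles (fun _ _ => μ) (handler 𝓖) (logMachine (simEv 𝓖 k.κ μ) (simPost 𝓖 k.κ k.X))
        (stateVal 𝓖 k.κ (F.eval k.κ) k.X) (statePot 𝓖 k.κ (F.eval k.κ) k.X) (p.eval k.κ)
        (F.eval k.κ) (D.eval k.κ) (w.eval k.κ)) ∧
    (fixedVal 𝓖 k.κ (F.eval k.κ) k.X).size + 3 * LogSim.weight (k.start ID, [], []) +
      3 * (D.eval k.κ * p.eval k.κ) + 6 ≤ F.eval k.κ ∧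
    p.eval k.κ ≤ F.eval k.κ ∧ 100 * (F.eval k.κ + 1) ≤ w.eval k.κ := by
  obtain ⟨s, hs⟩ := 𝓖.exists_bound
  obtain ⟨i, hi⟩ := hID.size_out
  obtain ⟨w, hw, hH⟩ := exists_handles 𝓖
  set D : ℕ[X] := 3 * p + 5 * s + 9 with hD
  set E : ℕ[X] := 3 * s + 3 * (i + 2 * s + 4) + 3 * (D * p) + p + 20 with hE
  -- The encoded state contains the numeral of the fuel, so the fuel has to exceed a quantity that
  -- includes its own binary length. The value `2 * E` will do, since its length is at most `E + 1`.
  refine ⟨2 * E, D, w.comp (Polynomial.X + 2 * E), fun k => ?_⟩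
  obtain ⟨h1, h2, h3⟩ := hs k.κ
  have hDe : D.eval k.κ = 3 * p.eval k.κ + 5 * s.eval k.κ + 9 := by simp [hD]
  have hEe : E.eval k.κ = 3 * s.eval k.κ + 3 * (i.eval k.κ + 2 * s.eval k.κ + 4) +
      3 * (D.eval k.κ * p.eval k.κ) + p.eval k.κ + 20 := by simp [hE]
  have hFe : (2 * E).eval k.κ = 2 * E.eval k.κ := by simp
  have hwe : (w.comp (Polynomial.X + 2 * E)).eval k.κ = w.eval (k.κ + (2 * E).eval k.κ) := by
    simp
  refine ⟨fun μ hμ => ?_, ?_, ?_, ?_⟩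
  · rw [hwe]
    exact hH k.κ _ _ (s.eval k.κ) _ k.X μ hμ h2 h3 hDe.ge
  · have h4 : Nat.size (2 * E.eval k.κ) ≤ E.eval k.κ + 1 := by
      rw [Nat.size_le, pow_succ, mul_comm]
      have : E.eval k.κ < 2 ^ E.eval k.κ := Nat.lt_two_pow_self
      omega
    have h5 := h3 (𝓖.G k.κ)
    have h6 := h3 k.X
    have h7 : LogSim.weight (k.start ID, [], []) ≤ i.eval k.κ + 2 * s.eval k.κ + 4 := by
      have h8 := size_listVal_append_le (Val.ofBits (ID k.κ))
        (𝓖.ptVal k.κ (𝓖.smul k.κ k.b (𝓖.G k.κ)))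
      have h9 : (Val.ofBits (ID k.κ)).size ≤ i.eval k.κ := hi k.κ
      have h10 := h3 (𝓖.smul k.κ k.b (𝓖.G k.κ))
      have h11 := Nat.size_le_size (ZMod.val_lt k.h).le
      simp only [LogSim.weight, KeyChoice.start, simStart, Sim.table, List.map_cons, List.map_nil,
        Val.weight, List.sum_cons, List.sum_nil, Val.size_pair, Val.size_num]
      omega
    simp only [fixedVal, Val.size_pair, Val.size_num, hFe]
    omega
  · omega
  · rw [hwe]
    exact hw _ _

/-- One program runs the attacker twice, with a common beginning, and evaluates both outputs. -/
theorem exists_twoRuns (B : BPVParams) (p : ℕ[X]) (A : Prog CMAOracle)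
    (hID : EfficientlyComputable (fun κ : ℕ => κ) Val.num (fun κ => Val.ofBits (ID κ))) :
    ∃ (P : Prog Unit) (q : ℕ[X]), ∀ (k : KeyChoice 𝓖 B p) (μ : PMF Val),
      (∀ v ∈ μ.support, v.size ≤ 2 * (𝓖.N k.κ).size + 3) →
      Approx 0 (fun r o => r.1.1.2 ≤ p.eval k.κ → r.2.1.2 ≤ p.eval k.κ →
          o.1 = .num (k.answer r.1.1.1 r.2.1.1).val ∧ o.2 ≤ q.eval k.κ)
        ((A.tree (k.attack ID)).fork (simEv 𝓖 k.κ μ) (simPost 𝓖 k.κ k.X) (k.j - 1) (k.start ID))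
        (P.den (fun _ _ => μ) k.inp) := by
  obtain ⟨F, D, w, hF⟩ := exists_fuel (𝓖 := 𝓖) B p hID
  obtain ⟨P₁, p₁, h₁⟩ := ec_iff.1 (KeyChoice.efficient_first (𝓖 := 𝓖) (B := B) (p := p) (F := F) hID)
  obtain ⟨P₂, p₂, h₂⟩ := ec_iff.1 (FirstRun.efficient_second (𝓖 := 𝓖) (B := B) (p := p) (F := F) hID)
  obtain ⟨P₃, p₃, h₃⟩ := ec_iff.1 (BothRuns.efficient_answer (𝓖 := 𝓖) (B := B) (p := p) (F := F))
  set C := A.compile (handler 𝓖) with hC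
  refine ⟨.seq P₁.embed (.seq (.fork .id (.seq .snd C)) (.seq P₂.embed
    (.seq (.fork .fst (.seq .snd C)) P₃.embed))),
    5 * p₁ + 5 * p₂ + p₃ + 2 * (p * w) + 20, fun k μ hμ => ?_⟩
  obtain ⟨hH, hpot, hpF, hFw⟩ := hF k
  have hrun := fun (a : LogSim) ha => compile_approx (a := a) (x := k.attack ID)
    (t := p.eval k.κ) size_stateVal_le (hH μ hμ) hpF hFw A le_rfl ha
  have hsup := fun a => ((A.tree_costly (k.attack ID)).interp_support
    (logMachine (simEv 𝓖 k.κ μ) (simPost 𝓖 k.κ k.X)) (n := _) a)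
  obtain ⟨c₁, hc₁, hd₁⟩ := h₁ k
  have hs₁ := (EfficientlyComputable.size_le_cost hd₁).2
  rw [Prog.den_seq_of_pure ((Prog.den_embed _ _ _).trans hd₁),
    Prog.den_seq_fork_snd (Prog.den_id _ _), Tree.fork]
  simp only [Polynomial.eval_add, Polynomial.eval_mul, Polynomial.eval_ofNat]
  have hA := ((hrun (k.start ID, [], []) (by
    simp only [statePot]
    omega)).mono_support fun r hr o _ hro => And.intro hro (hsup _ r hr).2)
  rw [Tree.interp_logMachine] at hA
  rw [PMF.map_bind]
  refine hA.of_map.bind_zero fun r o ⟨hro, hrs⟩ => ?_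
  by_cases hrt : r.1.1.2 ≤ p.eval k.κ
  swap
  · refine Approx.of_forall fun r' hr' _ h => absurd ?_ hrt
    rw [PMF.mem_support_map_iff] at hr'
    obtain ⟨_, _, rfl⟩ := hr'
    exact h
  obtain ⟨ho, hw, hoc⟩ := hro hrt
  replace ho : o.1 = .pair (k.state F (r.1.2, r.2.reverse ++ [], [])) r.1.1.1 := ho
  replace hw : statePot 𝓖 k.κ (F.eval k.κ) k.X (r.1.2, r.2.reverse ++ [], []) ≤
    statePot 𝓖 k.κ (F.eval k.κ) k.X (k.start ID, [], []) + D.eval k.κ * r.1.1.2 := hw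
  replace hoc : o.2 ≤ r.1.1.2 * w.eval k.κ := hoc
  replace hrs : r.1.1.1.size ≤ r.1.1.2 := hrs
  have hDt : D.eval k.κ * r.1.1.2 ≤ D.eval k.κ * p.eval k.κ := Nat.mul_le_mul_left _ hrt
  have hWt : r.1.1.2 * w.eval k.κ ≤ p.eval k.κ * w.eval k.κ := Nat.mul_le_mul_right _ hrt
  have hst : (k.state F (r.1.2, r.2.reverse ++ [], [])).size ≤ F.eval k.κ := by
    refine (size_stateVal_le _).trans (hw.trans ?_)
    simp only [statePot]
    omega
  obtain ⟨c₂, hc₂, hd₂⟩ : ∃ c ≤ p₂.eval k.κ, P₂.den noEv (.pair (.pair k.inp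
      (.pair (k.state F (k.start ID, [], [])) (k.attack ID)))
      (.pair (k.state F (r.1.2, r.2.reverse ++ [], [])) r.1.1.1)) = PMF.pure
        (.pair (.pair k.inp r.1.1.1)
          (.pair (k.state F (k.start ID, [], r.2.take (k.j - 1))) (k.attack ID)), c) := by
    have h5 := h₂ ⟨k, (r.1.2, r.2.reverse ++ [], []), r.1.1.1, hst, hrs.trans hrt⟩
    simpa only [FirstRun.reused, List.append_nil, List.reverse_reverse] using h5
  have hs₂ := (EfficientlyComputable.size_le_cost hd₂).2
  -- The second run may start with the whole log of the first one as values to be reused, which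
  -- count twice. The log weighs at most the initial weight plus `D * p`; this explains the factors
  -- `3` in `hpot`.
  have hpot₂ : statePot 𝓖 k.κ (F.eval k.κ) k.X (k.start ID, [], r.2.take (k.j - 1)) +
      D.eval k.κ * p.eval k.κ ≤ F.eval k.κ := by
    have h5 : Val.weight (r.2.take (k.j - 1)) ≤ Val.weight r.2 := Val.weight_take_le _ _
    have h6 : Val.weight r.2.reverse = Val.weight r.2 := Val.weight_reverse _
    simp only [statePot, LogSim.weight, List.append_nil] at hpot hw ⊢
    simp only [Val.weight, List.map_nil, List.sum_nil] at hpot hw h5 h6 ⊢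
    omega
  rw [ho, Prog.den_seq_of_pure ((Prog.den_embed _ _ _).trans hd₂),
    Prog.den_seq_fork_snd (Prog.den_fst _ _)]
  have hB := ((hrun _ hpot₂).mono_support fun r hr o _ hro => And.intro hro (hsup _ r hr).2)
  rw [← Tree.interp_logMachine_map (l := []), PMF.map_comp]
  simp only [PMF.map_bind]
  rw [PMF.map]
  refine hB.bind_zero fun r' o' ⟨hro', hrs'⟩ => ?_
  by_cases hrt' : r'.1.2 ≤ p.eval k.κ
  swap
  · refine Approx.of_forall fun r₂ hr₂ _ _ h => absurd ?_ hrt'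
    simp only [PMF.support_pure, Set.mem_singleton_iff, Function.comp] at hr₂
    rw [hr₂] at h
    exact h
  obtain ⟨ho', hw', hoc'⟩ := hro' hrt'
  replace ho' : o'.1 = .pair (k.state F r'.2) r'.1.1 := ho'
  have hDt' : D.eval k.κ * r'.1.2 ≤ D.eval k.κ * p.eval k.κ := Nat.mul_le_mul_left _ hrt'
  have hWt' : r'.1.2 * w.eval k.κ ≤ p.eval k.κ * w.eval k.κ := Nat.mul_le_mul_right _ hrt'
  have hst' : (k.state F r'.2).size ≤ F.eval k.κ :=
    (size_stateVal_le _).trans (hw'.trans (le_trans (by omega) hpot₂))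
  obtain ⟨c₃, hc₃, hd₃⟩ : ∃ c ≤ p₃.eval k.κ, P₃.den noEv (.pair (.pair k.inp r.1.1.1)
      (.pair (k.state F r'.2) r'.1.1)) = PMF.pure (.num (k.answer r.1.1.1 r'.1.1).val, c) :=
    h₃ ⟨k, r.1.1.1, r'.1.1, r'.2, hst', hrs.trans hrt, hrs'.trans hrt'⟩
  rw [ho']
  simp only [Val.fst_pair, Prog.den_embed, hd₃, PMF.pure_map]
  refine Approx.pure fun _ _ => ⟨rfl, ?_⟩
  simp only [stepCost, Val.snd_pair, Val.size_pair] at hs₁ hs₂ ⊢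
  omega

end Main

theorem ex_randUnit_eq_uniformBelow {N : ℕ} [Fact N.Prime] (f : ZMod N → ℝ≥0∞) :
    ex (randUnit N) f = ex (uniformBelow (N - 1)) fun c => f ((c + 1 : ℕ) : ZMod N) := by
  have hN := (Fact.out : N.Prime).two_le
  rw [ex_randUnit, ex_uniformBelow (by omega)]
  congr 1
  refine Finset.sum_bij' (i := fun z _ => z.val - 1) (j := fun c _ => ((c + 1 : ℕ) : ZMod N))
    ?_ ?_ ?_ ?_ ?_
  · intro z hz
    have h1 := ZMod.val_lt z
    rw [Finset.mem_range]
    omega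
  · intro c hc
    rw [Finset.mem_range] at hc
    refine Finset.mem_erase.2 ⟨?_, Finset.mem_univ _⟩
    rw [Ne, ZMod.natCast_eq_zero_iff]
    exact Nat.not_dvd_of_pos_of_lt c.succ_pos (by omega)
  all_goals intro z hz
  · have h1 : 0 < z.val := Nat.pos_of_ne_zero fun h =>
      (Finset.mem_erase.1 hz).1 ((ZMod.val_eq_zero z).1 h)
    rw [Nat.sub_add_cancel h1, ZMod.natCast_zmod_val]
  · rw [Finset.mem_range] at hz
    rw [ZMod.val_cast_of_lt (by omega), Nat.add_sub_cancel]
  · have h1 : 0 < z.val := Nat.pos_of_ne_zero fun h =>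
      (Finset.mem_erase.1 hz).1 ((ZMod.val_eq_zero z).1 h)
    rw [Nat.sub_add_cancel h1, ZMod.natCast_zmod_val]

theorem ahssExpt_apply_true (𝓖 : GroupFamily) (B : BPVParams) (κ : ℕ) (P : Prog Unit) (t : ℕ) :
    ahssExpt 𝓖 B κ P t true = ex (randUnit (𝓖.N κ)) fun x =>
      ex (randTable (𝓖.N κ) (B.k κ)) fun r =>
        ex (P.den (fun _ _ => sgnDist 𝓖 B κ x r) (.pair (.pair (𝓖.params κ) (B.toVal κ))
          (𝓖.ptVal κ (𝓖.smul κ x (𝓖.G κ))))) fun o =>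
            ind ((o.1.toNat : ZMod (𝓖.N κ)) = x ∧ o.2 ≤ t) := by
  have h1 : ahssExpt 𝓖 B κ P t = (randUnit (𝓖.N κ)).bind fun x =>
      (randTable (𝓖.N κ) (B.k κ)).bind fun r =>
        (P.run (fun _ _ => (draw (sgnDist 𝓖 B κ x r) : PState Unit Val))
          (.pair (.pair (𝓖.params κ) (B.toVal κ)) (𝓖.ptVal κ (𝓖.smul κ x (𝓖.G κ)))) ()).bind
            fun q => PMF.pure (decide ((q.1.1.toNat : ZMod (𝓖.N κ)) = x) &&
              decide (q.1.2 ≤ t)) := rfl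
  rw [h1, bind_apply_eq_ex]
  congr 1
  funext x
  rw [bind_apply_eq_ex]
  congr 1
  funext r
  rw [Prog.run_draw (fun _ _ => sgnDist 𝓖 B κ x r), bind_apply_eq_ex, ex_map]
  congr 1
  funext o
  by_cases h : (o.1.toNat : ZMod (𝓖.N κ)) = x ∧ o.2 ≤ t
  · rw [ind_true h]
    simp [h]
  · rw [ind_false h, PMF.pure_apply, if_neg]
    intro h'
    apply h
    simpa using h'.symm

section Coins

variable {ι : Type} {ev : ι → Val → PMF Val}

theorem ex_den_coins {v : Val} {P₁ P₂ P₃ Q : Prog ι} {n₁ n₂ n₃ c₁ c₂ c₃ : ℕ}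
    (h₁ : P₁.den ev v = PMF.pure (.num n₁, c₁)) (h₂ : P₂.den ev v = PMF.pure (.num n₂, c₂))
    (h₃ : P₃.den ev v = PMF.pure (.num n₃, c₃)) (g : Val × ℕ → ℝ≥0∞) :
    ex ((Prog.seq (.fork (.fork (.fork .id (.seq P₁ .rand)) (.seq P₂ .rand)) (.seq P₃ .rand))
      Q).den ev v) g = ex (uniformBelow n₁) fun i₁ => ex (uniformBelow n₂) fun i₂ =>
        ex (uniformBelow n₃) fun i₃ => ex (Q.den ev (.pair (.pair (.pair v (.num i₁)) (.num i₂))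
          (.num i₃))) fun o => g (o.1, stepCost v v + (c₁ + stepCost (.num n₁) (.num i₁) + 1) + 1 +
            (c₂ + stepCost (.num n₂) (.num i₂) + 1) + 1 +
            (c₃ + stepCost (.num n₃) (.num i₃) + 1) + 1 + o.2 + 1) := by
  simp only [Prog.den_seq, Prog.den_fork, Prog.den_id, Prog.den_rand, h₁, h₂, h₃, coin,
    PMF.pure_bind, ex_bind, ex_map, Val.toNat_num]

end Coins

/-! ### Success probability of the reduction that runs the attacker twice. -/

section Solving

variable {𝓖 : GroupFamily} {B : BPVParams} {p : ℕ[X]} {ID : ℕ → List Bool}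

/-- Two runs from which the secret can be computed: `j = 0` stands for a forgery on the identity,
`j = n + 1` for two forgeries based on event `n`. -/
def Solves (𝓖 : GroupFamily) (κ t : ℕ) (x b h : ZMod (𝓖.N κ)) (j : ℕ)
    (r : ((Val × ℕ) × Sim) × ((Val × ℕ) × Sim)) : Prop :=
  if j = 0 then (ForgesSelf 𝓖 κ t x b h r.1 ∧ h ≠ 0) ∧ r.2.1.2 ≤ t
  else Extractable 𝓖 κ (𝓖.smul κ x (𝓖.G κ)) t r

theorem outCommitment_smul {κ : ℕ} (x : ZMod (𝓖.N κ)) (o : Val) :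
    outCommitment 𝓖 κ (𝓖.smul κ x (𝓖.G κ)) o =
      𝓖.smul κ ((o.snd.snd.toNat : ZMod (𝓖.N κ)) * x + o.snd.fst.toNat) (𝓖.G κ) := by
  rw [outCommitment, 𝓖.smul_smul, ← 𝓖.smul_add]

theorem KeyChoice.answer_eq (k : KeyChoice 𝓖 B p)
    {r : ((Val × ℕ) × Sim) × ((Val × ℕ) × Sim)}
    (h : Solves 𝓖 k.κ (p.eval k.κ) k.x k.b k.h k.j r) :
    r.1.1.2 ≤ p.eval k.κ ∧ r.2.1.2 ≤ p.eval k.κ ∧ k.answer r.1.1.1 r.2.1.1 = k.x := by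
  unfold Solves at h
  unfold answer
  split_ifs at h ⊢ with hj
  · obtain ⟨⟨⟨h1, h2, h3⟩, h4⟩, h5⟩ := h
    refine ⟨h1, h5, solve_eq (by rw [h3]; simpa using h4) ?_⟩
    rw [outCommitment_smul] at h2
    have := 𝓖.smul_G_injective k.κ h2
    rw [this, b]
    simp
  · obtain ⟨h1, h2, h3, h4⟩ := h
    refine ⟨h1, h2, solve_eq h3 ?_⟩
    rw [outCommitment_smul, outCommitment_smul] at h4
    exact 𝓖.smul_G_injective k.κ h4

/-- The success probability of the attack on the hidden subset sum problem. -/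
theorem exists_attack (B : BPVParams) (p : ℕ[X]) (A : Prog CMAOracle)
    (hID : EfficientlyComputable (fun κ : ℕ => κ) Val.num (fun κ => Val.ofBits (ID κ))) :
    ∃ (P : Prog Unit) (q : ℕ[X]), ∀ κ, (B.toVal κ).size ≤ p.eval κ →
      exKeys 𝓖 B κ (fun x r b h => ex (uniformBelow (p.eval κ + 1)) fun j =>
        ex ((A.tree (attackInput 𝓖 B (ID κ) κ x b h)).fork (simEv 𝓖 κ (sgnDist 𝓖 B κ x r))
          (simPost 𝓖 κ (𝓖.smul κ x (𝓖.G κ))) (j - 1) (simStart 𝓖 (ID κ) κ b h)) fun r =>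
            ind (Solves 𝓖 κ (p.eval κ) x b h j r)) ≤
      ahssExpt 𝓖 B κ P (q.eval κ) true := by
  obtain ⟨Q, q, hQ⟩ := exists_twoRuns (𝓖 := 𝓖) B p A hID
  have h0 : EfficientlyComputable (fun k : KeyChoice 𝓖 B p => k.κ) KeyChoice.challenge
      KeyChoice.challenge := .id (KeyChoice.size_inp_le.mono fun k => by
    simp only [KeyChoice.inp, Val.size_pair]
    omega)
  have h1 := EfficientlyComputable.const h0.size_inp (.num 1)
  obtain ⟨P₁, p₁, h₁⟩ := ec_iff.1 (h0.fst.fst.fst.snd.fst.sub h1)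
  obtain ⟨P₂, p₂, h₂⟩ := ec_iff.1 h0.fst.fst.fst.snd.fst
  obtain ⟨P₃, p₃, h₃⟩ := ec_iff.1
    (EfficientlyComputable.polyEval (p + 1) (f := fun k : KeyChoice 𝓖 B p => k.κ) h0.fst.fst.fst.fst)
  -- The numbers `N - 1`, `N` and `p + 1` are computed as the ranges of `c`, `h` and the guess `j`.
  refine ⟨.seq (.fork (.fork (.fork .id (.seq P₁.embed .rand)) (.seq P₂.embed .rand))
    (.seq P₃.embed .rand)) Q, 10 * (p₁ + p₂ + p₃ + q + 10), fun κ hκ => ?_⟩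
  rw [ahssExpt_apply_true]
  refine ex_mono _ fun x => ex_mono _ fun r => ?_
  have hN := (𝓖.prime κ).out.two_le
  -- The programs that compute the three ranges read the challenge only; the other components of
  -- this key choice are arbitrary.
  set k₀ : KeyChoice 𝓖 B p := ⟨κ, x, 0, 0, 0, by omega, Nat.zero_le _, hκ⟩ with hk₀
  obtain ⟨c₁, hc₁, hd₁⟩ := h₁ k₀
  obtain ⟨c₂, hc₂, hd₂⟩ := h₂ k₀
  obtain ⟨c₃, hc₃, hd₃⟩ := h₃ k₀
  replace hd₁ : P₁.den noEv k₀.challenge = PMF.pure (.num (𝓖.N κ - 1), c₁) := hd₁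
  replace hd₂ : P₂.den noEv k₀.challenge = PMF.pure (.num (𝓖.N κ), c₂) := hd₂
  replace hd₃ : P₃.den noEv k₀.challenge = PMF.pure (.num (p.eval κ + 1), c₃) := by
    rw [hd₃]; simp [hk₀]
  replace hc₁ : c₁ ≤ p₁.eval κ := hc₁
  replace hc₂ : c₂ ≤ p₂.eval κ := hc₂
  replace hc₃ : c₃ ≤ p₃.eval κ := hc₃
  have hs₁ := EfficientlyComputable.size_le_cost hd₁
  have hs₂ := EfficientlyComputable.size_le_cost hd₂
  have hs₃ := EfficientlyComputable.size_le_cost hd₃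
  change _ ≤ ex (Prog.den _ _ k₀.challenge) _
  rw [ex_den_coins ((Prog.den_embed _ _ _).trans hd₁) ((Prog.den_embed _ _ _).trans hd₂)
    ((Prog.den_embed _ _ _).trans hd₃), ex_randUnit_eq_uniformBelow]
  refine ex_mono_support _ fun c hc => ?_
  rw [ex_uniformBelow_prime]
  refine ex_mono _ fun h => ex_mono_support _ fun j hj => ?_
  have hc' := mem_support_uniformBelow (by omega) hc
  have hj' := mem_support_uniformBelow (by omega) hj
  have happ := hQ ⟨κ, x, c, h, j, by omega, by omega, hκ⟩ (sgnDist 𝓖 B κ x r)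
    fun v hv => size_sgnDist_le hv
  refine (happ (fun r => ind (Solves 𝓖 κ (p.eval κ) x ((c + 1 : ℕ) : ZMod (𝓖.N κ)) h j r)) _
    (fun r => ind_le_one _) fun r o hro => ?_).trans_eq (add_zero _)
  refine ind_le fun hs => ?_
  obtain ⟨h4, h5, h6⟩ := KeyChoice.answer_eq
    (⟨κ, x, c, h, j, by omega, by omega, hκ⟩ : KeyChoice 𝓖 B p) hs
  obtain ⟨h7, h8⟩ := hro h4 h5
  rw [ind_true]
  refine ⟨?_, ?_⟩
  · rw [h7, Val.toNat_num, ZMod.natCast_zmod_val]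
    exact h6
  · have h9 := Nat.size_le_size hc'.le
    have h10 := Nat.size_le_size (ZMod.val_lt h).le
    have h11 := Nat.size_le_size hj'.le
    simp only [Val.size_num] at hs₁ hs₂ hs₃
    simp only [stepCost, Val.size_num, Polynomial.eval_mul, Polynomial.eval_add,
      Polynomial.eval_ofNat]
    replace h8 : o.2 ≤ q.eval κ := h8
    omega

end Solving

/-- The price of guessing one of `n` indices is a factor `n`. -/
theorem le_mul_ex_uniformBelow {n j : ℕ} (hj : j < n) (f : ℕ → ℝ≥0∞) :
    f j ≤ n * ex (uniformBelow n) f := by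
  have hn : 0 < n := by omega
  rw [ex_uniformBelow hn, ← mul_assoc,
    ENNReal.mul_inv_cancel (by exact_mod_cast hn.ne') (ENNReal.natCast_ne_top n), one_mul]
  exact Finset.single_le_sum (f := f) (fun _ _ => zero_le) (Finset.mem_range.2 hj)

/-! ## Bounds for the terms of the advantage -/

section Bounds

variable {𝓖 : GroupFamily} {B : BPVParams} {κ : ℕ} {ID : List Bool}

theorem exKeys_mono {f g : ZMod (𝓖.N κ) → (Fin (B.k κ) → ZMod (𝓖.N κ)) → ZMod (𝓖.N κ) →
    ZMod (𝓖.N κ) → ℝ≥0∞} (h : ∀ x r b y, f x r b y ≤ g x r b y) :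
    exKeys 𝓖 B κ f ≤ exKeys 𝓖 B κ g :=
  ex_mono _ fun x => ex_mono _ fun r => ex_mono _ fun b => ex_mono _ fun y => h x r b y

theorem exKeys_mul_left (c : ℝ≥0∞) (f : ZMod (𝓖.N κ) → (Fin (B.k κ) → ZMod (𝓖.N κ)) →
    ZMod (𝓖.N κ) → ZMod (𝓖.N κ) → ℝ≥0∞) :
    exKeys 𝓖 B κ (fun x r b y => c * f x r b y) = c * exKeys 𝓖 B κ f := by
  simp only [exKeys, ex_mul_left]

theorem sq_exKeys_le {f : ZMod (𝓖.N κ) → (Fin (B.k κ) → ZMod (𝓖.N κ)) → ZMod (𝓖.N κ) →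
    ZMod (𝓖.N κ) → ℝ≥0∞} (h : ∀ x r b y, f x r b y ≤ 1) :
    exKeys 𝓖 B κ f ^ 2 ≤ exKeys 𝓖 B κ fun x r b y => f x r b y ^ 2 := by
  refine (sq_ex_le _ fun x => ex_le_const _ fun r => ex_le_const _ fun b => ex_le_const _ fun y =>
    h x r b y).trans (ex_mono _ fun x => ?_)
  refine (sq_ex_le _ fun r => ex_le_const _ fun b => ex_le_const _ fun y =>
    h x r b y).trans (ex_mono _ fun r => ?_)
  refine (sq_ex_le _ fun b => ex_le_const _ fun y => h x r b y).trans (ex_mono _ fun b => ?_)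
  exact sq_ex_le _ fun y => h x r b y

theorem exKeys_fork_le {A : Prog CMAOracle} {t j : ℕ} {δ : ℝ≥0∞} (hj : j ≤ t)
    (h : exKeys 𝓖 B κ (fun x r b h => ex (uniformBelow (t + 1)) fun j =>
        ex ((A.tree (attackInput 𝓖 B ID κ x b h)).fork (simEv 𝓖 κ (sgnDist 𝓖 B κ x r))
          (simPost 𝓖 κ (𝓖.smul κ x (𝓖.G κ))) (j - 1) (simStart 𝓖 ID κ b h)) fun r =>
            ind (Solves 𝓖 κ t x b h j r)) ≤ δ) :
    exKeys 𝓖 B κ (fun x r b h =>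
        ex ((A.tree (attackInput 𝓖 B ID κ x b h)).fork (simEv 𝓖 κ (sgnDist 𝓖 B κ x r))
          (simPost 𝓖 κ (𝓖.smul κ x (𝓖.G κ))) (j - 1) (simStart 𝓖 ID κ b h)) fun r =>
            ind (Solves 𝓖 κ t x b h j r)) ≤ (t + 1 : ℕ) * δ := by
  refine le_trans ?_ (mul_le_mul_right h _)
  rw [← exKeys_mul_left]
  exact exKeys_mono fun x r b h => le_mul_ex_uniformBelow (Nat.lt_succ_of_le hj) fun j =>
    ex ((A.tree (attackInput 𝓖 B ID κ x b h)).fork (simEv 𝓖 κ (sgnDist 𝓖 B κ x r))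
      (simPost 𝓖 κ (𝓖.smul κ x (𝓖.G κ))) (j - 1) (simStart 𝓖 ID κ b h)) fun r =>
        ind (Solves 𝓖 κ t x b h j r)

/-- The square is moved inside the choice of keys, `forging` applies to each choice, and the guess
that belongs to event `i` is `j = i + 1`. -/
theorem sq_exSim_forgesAt_le (A : Prog CMAOracle) {t i : ℕ} {δ : ℝ≥0∞} (hi : i < t)
    (h : exKeys 𝓖 B κ (fun x r b h => ex (uniformBelow (t + 1)) fun j =>
        ex ((A.tree (attackInput 𝓖 B ID κ x b h)).fork (simEv 𝓖 κ (sgnDist 𝓖 B κ x r))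
          (simPost 𝓖 κ (𝓖.smul κ x (𝓖.G κ))) (j - 1) (simStart 𝓖 ID κ b h)) fun r =>
            ind (Solves 𝓖 κ t x b h j r)) ≤ δ) :
    exSim 𝓖 B ID κ A (fun x _ _ q =>
      ind (∃ e, ForgesAt 𝓖 κ (𝓖.smul κ x (𝓖.G κ)) t q e ∧ e.2 = some i)) ^ 2 ≤
      (t + 1 : ℕ) * δ + (𝓖.N κ : ℝ≥0∞)⁻¹ := by
  refine (sq_exKeys_le fun x r b y => ex_le_const _ fun q => ind_le_one _).trans ?_
  refine le_trans ?_ (add_le_add_left (exKeys_fork_le (j := i + 1) hi h) _)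
  refine (exKeys_mono fun x r b y => forging _ _ t i _ (simStart 𝓖 ID κ b y) rfl
    (by simp [simStart])).trans_eq ?_
  simp only [exKeys, ex_add_const, Solves, Nat.succ_ne_zero, if_false, Nat.add_sub_cancel]

/-- One run would suffice to find the secret, but the reduction always makes two, and both have to
stay in time. For `j = 0` they are independent given the keys, so both succeed with probability at
least the square. If `h = 0`, then `h * x + s = b` does not determine `x`; this accounts for `1 /
N`. -/
theorem exSim_forgesSelf_le (A : Prog CMAOracle) {t : ℕ} {δ : ℝ≥0∞}
    (h : exKeys 𝓖 B κ (fun x r b h => ex (uniformBelow (t + 1)) fun j =>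
        ex ((A.tree (attackInput 𝓖 B ID κ x b h)).fork (simEv 𝓖 κ (sgnDist 𝓖 B κ x r))
          (simPost 𝓖 κ (𝓖.smul κ x (𝓖.G κ))) (j - 1) (simStart 𝓖 ID κ b h)) fun r =>
            ind (Solves 𝓖 κ t x b h j r)) ≤ δ) :
    ∃ ε : ℝ≥0∞, ε ^ 2 ≤ (t + 1 : ℕ) * δ ∧
      exSim 𝓖 B ID κ A (fun x b h q => ind (ForgesSelf 𝓖 κ t x b h q)) ≤
        ε + (𝓖.N κ : ℝ≥0∞)⁻¹ := by
  refine ⟨exSim 𝓖 B ID κ A (fun x b h q => ind (ForgesSelf 𝓖 κ t x b h q ∧ h ≠ 0)), ?_, ?_⟩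
  · refine (sq_exKeys_le fun x r b y => ex_le_const _ fun q => ind_le_one _).trans
      (le_trans (exKeys_mono fun x r b y => ?_) (exKeys_fork_le (j := 0) (Nat.zero_le _) h))
    rw [Nat.zero_sub, Tree.fork_zero, sq_ex]
    refine ex_mono _ fun q => ex_mono _ fun q' => ?_
    rw [← ind_and]
    refine ind_mono fun ⟨h1, h2⟩ => ?_
    rw [Solves, if_pos rfl]
    exact ⟨h1, h2.1.1⟩
  · have h0 : exKeys 𝓖 B κ (fun _ _ _ y => ind (y = 0)) = (𝓖.N κ : ℝ≥0∞)⁻¹ := by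
      simp only [exKeys, ex_uniform_ind_eq, ex_const]
    rw [← h0]
    simp only [exSim, exKeys, ← ex_add]
    refine ex_mono _ fun x => ex_mono _ fun r => ex_mono _ fun b => ex_mono _ fun y => ?_
    rw [← ex_add_const]
    refine ex_mono _ fun q => (ind_mono fun hq => ?_).trans (ind_or_le _ _)
    exact (em (y = 0)).symm.imp (fun hy => ⟨hq, hy⟩) id

/-- The cost of a run is at least the size of its input, which contains `(v, k)`. -/
theorem euCMA_eq_zero (A : Prog CMAOracle) {t : ℕ} (h : t < (B.toVal κ).size) :
    euCMA (bpvSchnorr 𝓖 B ID κ) (schnorrPub 𝓖 B κ) A t true = 0 := by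
  rw [euCMA_apply_true]
  refine ex_eq_zero _ fun k _ => ex_eq_zero _ fun q hq => ?_
  rw [Prog.run_eq_interp] at hq
  have h1 := ((A.tree_costly _).interp_support _ _ q hq).1
  simp only [schnorrPub, Val.size_pair] at h1
  exact ex_eq_zero _ fun z _ => ind_false fun hz => by
    have := hz.2.2
    omega

end Bounds

/-! ## Collisions of nonces -/

section Collision

variable {𝓖 : GroupFamily} {B : BPVParams}

theorem inv_two_le_ex_ne (N : ℕ) [Fact N.Prime] :
    (2 : ℝ≥0∞)⁻¹ ≤ ex (PMF.uniformOfFintype (ZMod N)) fun c =>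
      ex (PMF.uniformOfFintype (ZMod N)) fun c' => ind (c ≠ c') := by
  have hN : (N : ℝ≥0∞)⁻¹ ≤ 2⁻¹ :=
    ENNReal.inv_le_inv.2 (by exact_mod_cast (Fact.out : N.Prime).two_le)
  have h1 : (1 : ℝ≥0∞) ≤ 2⁻¹ + ex (PMF.uniformOfFintype (ZMod N)) fun c =>
      ex (PMF.uniformOfFintype (ZMod N)) fun c' => ind (c ≠ c') := by
    refine le_trans ?_ (add_le_add_left hN _)
    have h2 : ex (PMF.uniformOfFintype (ZMod N)) (fun c =>
        ex (PMF.uniformOfFintype (ZMod N)) fun c' => ind (c' = c)) = (N : ℝ≥0∞)⁻¹ := by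
      simp only [ex_uniform_ind_eq, ex_const]
    rw [← h2, ← ex_add]
    simp only [← ex_add]
    refine (ex_const (PMF.uniformOfFintype (ZMod N)) 1).symm.le.trans (ex_mono _ fun c => ?_)
    refine (ex_const (PMF.uniformOfFintype (ZMod N)) 1).symm.le.trans (ex_mono _ fun c' => ?_)
    by_cases h : c' = c
    · rw [ind_true h]; exact le_self_add
    · rw [ind_true (Ne.symm h)]; exact le_add_self
  rw [← ENNReal.inv_two_add_inv_two] at h1
  exact (ENNReal.add_le_add_iff_left (by simp)).1 h1

/-- Let `z` be a most likely nonce. Two samples both have nonce `z` with probability `maxNonceProb ^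
2`, and independently of this their values `c` differ with probability at least `1 / 2`, because `N
≥ 2`. -/
theorem sq_maxNonceProb_le {κ : ℕ} (x : ZMod (𝓖.N κ)) (r : Fin (B.k κ) → ZMod (𝓖.N κ)) :
    maxNonceProb B κ r ^ 2 ≤ 2 * ex (sgnDist 𝓖 B κ x r) fun v => ex (sgnDist 𝓖 B κ x r) fun w =>
      ind ((v.snd.toNat : ZMod (𝓖.N κ)) ≠ w.snd.toNat ∧
        (v.snd.toNat : ZMod (𝓖.N κ)) * x + v.fst.toNat =
          (w.snd.toNat : ZMod (𝓖.N κ)) * x + w.fst.toNat) := by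
  obtain ⟨z, hz⟩ := exists_eq_ciSup_of_finite (f := nonceProb B κ r)
  have h1 : ∀ f : Val → ℝ≥0∞, ex (sgnDist 𝓖 B κ x r) f = ex (B.randSubset κ) fun S =>
      ex (PMF.uniformOfFintype (ZMod (𝓖.N κ))) fun c => f (sgnPair (∑ i ∈ S, r i - x * c, c)) :=
    fun f => by simp only [sgnDist_eq, ex_bind, ex_map]
  have h2 : maxNonceProb B κ r * (maxNonceProb B κ r * 2⁻¹) ≤ ex (sgnDist 𝓖 B κ x r) fun v =>
      ex (sgnDist 𝓖 B κ x r) fun w =>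
      ind ((v.snd.toNat : ZMod (𝓖.N κ)) ≠ w.snd.toNat ∧
        (v.snd.toNat : ZMod (𝓖.N κ)) * x + v.fst.toNat =
          (w.snd.toNat : ZMod (𝓖.N κ)) * x + w.fst.toNat) := by
    rw [show maxNonceProb B κ r = nonceProb B κ r z from hz.symm]
    refine (mul_le_mul_right (mul_le_mul_right (inv_two_le_ex_ne (𝓖.N κ)) _) _).trans ?_
    simp only [h1, nonceProb, ← ex_mul_right]
    refine ex_mono _ fun S => ?_
    rw [← ex_mul_left]
    simp only [← ex_mul_left]
    rw [ex_comm]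
    refine ex_mono _ fun c => ex_mono _ fun S' => ex_mono _ fun c' => ?_
    rw [← ind_and, ← ind_and]
    refine ind_mono fun ⟨h3, h4, h5⟩ => ?_
    simp only [sgnPair, Val.fst_pair, Val.snd_pair, Val.toNat_num, ZMod.natCast_zmod_val]
    exact ⟨h5, by rw [h3, h4]; ring⟩
  calc maxNonceProb B κ r ^ 2 = 2 * (maxNonceProb B κ r * (maxNonceProb B κ r * 2⁻¹)) := by
        rw [pow_two, ← mul_assoc (maxNonceProb B κ r), mul_comm _ (2⁻¹ : ℝ≥0∞), ← mul_assoc,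
          ENNReal.mul_inv_cancel two_ne_zero ENNReal.ofNat_ne_top, one_mul]
    _ ≤ _ := by gcongr

/-- Two samples. -/
structure SamplePair (𝓖 : GroupFamily) (B : BPVParams) (p : ℕ[X]) where
  κ : ℕ
  x : ZMod (𝓖.N κ)
  v : Val
  w : Val
  v_le : v.size ≤ 2 * (𝓖.N κ).size + 3
  w_le : w.size ≤ 2 * (𝓖.N κ).size + 3
  pub_le : (B.toVal κ).size ≤ p.eval κ

def SamplePair.challenge {p : ℕ[X]} (k : SamplePair 𝓖 B p) : Val :=
  .pair (.pair (𝓖.params k.κ) (B.toVal k.κ)) (𝓖.ptVal k.κ (𝓖.smul k.κ k.x (𝓖.G k.κ)))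

open EfficientlyComputable in
theorem SamplePair.efficient (p : ℕ[X]) : EfficientlyComputable (fun k : SamplePair 𝓖 B p => k.κ)
    (fun k => .pair k.challenge (.pair k.v k.w))
    fun k => .num (solve (n := 𝓖.N k.κ) (k.v.fst.toNat : ZMod (𝓖.N k.κ)) k.v.snd.toNat
      k.w.fst.toNat k.w.snd.toNat).val := by
  obtain ⟨s, hs⟩ := 𝓖.exists_bound
  have h0 := EfficientlyComputable.id (m := fun k : SamplePair 𝓖 B p => k.κ)
    (inp := fun k => .pair k.challenge (.pair k.v k.w))
    (PolyBdd.mono (g := fun k => 7 * s.eval k.κ + p.eval k.κ + 20)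
      ⟨7 * s + p + 20, fun k => by simp⟩ fun k => by
        obtain ⟨h1, h2, h3⟩ := hs k.κ
        have h4 := h3 (𝓖.G k.κ)
        have h5 := h3 (𝓖.smul k.κ k.x (𝓖.G k.κ))
        have h6 := k.v_le
        have h7 := k.w_le
        have h8 := k.pub_le
        simp only [challenge, GroupFamily.params, GroupFamily.context, Val.size_pair] at h1 ⊢
        omega)
  have hctx := h0.fst.fst.fst.fst
  have hsc := polyEval s (f := fun k : SamplePair 𝓖 B p => k.κ) hctx.fst
  have hNs : ∀ k : SamplePair 𝓖 B p, 𝓖.N k.κ ≤ 2 ^ s.eval k.κ := fun k =>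
    ((Nat.lt_size_self _).trans_le (Nat.pow_le_pow_right two_pos (hs k.κ).2.1)).le
  have hv := h0.snd.fst
  have hw := h0.snd.snd
  exact zmodSolve (N := fun k : SamplePair 𝓖 B p => 𝓖.N k.κ) (PolyBdd.eval s .self) hNs
    hctx.snd.fst hsc hv.fst.toNat hv.snd.toNat hw.fst.toNat hw.snd.toNat

/-- The attack asks for two samples and solves the linear equation they satisfy if their nonces
agree. -/
theorem exists_collision_attack (B : BPVParams) (p : ℕ[X]) : ∃ (P : Prog Unit) (q : ℕ[X]), ∀ κ,
    (B.toVal κ).size ≤ p.eval κ →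
      (ex (randTable (𝓖.N κ) (B.k κ)) fun r => maxNonceProb B κ r) ^ 2 ≤
        2 * ahssExpt 𝓖 B κ P (q.eval κ) true := by
  obtain ⟨Q, q, hQ⟩ := ec_iff.1 (SamplePair.efficient (𝓖 := 𝓖) (B := B) p)
  refine ⟨.seq (.fork .id (.fork (.ask ()) (.ask ()))) Q.embed, 20 * q + 20, fun κ hκ => ?_⟩
  rw [ahssExpt_apply_true, ← ex_mul_left, ← ex_const (randUnit (𝓖.N κ))
    ((ex (randTable (𝓖.N κ) (B.k κ)) fun r => maxNonceProb B κ r) ^ 2)]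
  refine ex_mono _ fun x => ?_
  rw [← ex_mul_left]
  refine (sq_ex_le _ fun r => iSup_le fun z => ex_le_const _ fun _ => ind_le_one _).trans
    (ex_mono _ fun r => (sq_maxNonceProb_le (𝓖 := 𝓖) x r).trans ?_)
  gcongr
  simp only [Prog.den_seq, Prog.den_fork, Prog.den_id, Prog.den_ask, Prog.den_embed,
    PMF.pure_bind, ex_bind, ex_map]
  refine ex_mono_support _ fun v hv => ex_mono_support _ fun w hw => ind_le fun ⟨h1, h2⟩ => ?_
  obtain ⟨c, hc, hd⟩ := hQ ⟨κ, x, v, w, size_sgnDist_le hv, size_sgnDist_le hw, hκ⟩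
  have hs := (EfficientlyComputable.size_le_cost hd).1
  change _ ≤ ex (Q.den noEv (Val.pair (SamplePair.challenge
    ⟨κ, x, v, w, size_sgnDist_le hv, size_sgnDist_le hw, hκ⟩) (Val.pair v w))) _
  rw [hd, ex_pure, ind_true]
  refine ⟨?_, ?_⟩
  · rw [Val.toNat_num, ZMod.natCast_zmod_val]
    exact solve_eq h1 h2
  · simp only [SamplePair.challenge, Val.size_pair] at hs
    simp only [stepCost, Val.size_pair, Polynomial.eval_add, Polynomial.eval_mul,
      Polynomial.eval_ofNat] at hc ⊢
    omega

/-- Guessing discrete logarithms. -/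
theorem exists_guess (𝓖 : GroupFamily) : ∃ (P : Prog Empty) (q : ℕ[X]), ∀ κ,
    (𝓖.N κ : ℝ≥0∞)⁻¹ ≤ dlExpt 𝓖 κ P (q.eval κ) true := by
  obtain ⟨s, hs⟩ := 𝓖.exists_bound
  refine ⟨.seq .fst (.seq .fst (.seq .snd (.seq .fst .rand))), 30 * s + 30, fun κ => ?_⟩
  have h1 : ∀ P t, dlExpt 𝓖 κ P t true = ex (randUnit (𝓖.N κ)) fun d =>
      ex (P.den noEv (.pair (𝓖.params κ) (𝓖.ptVal κ (𝓖.smul κ d (𝓖.G κ))))) fun o =>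
        PMF.pure (decide ((o.1.toNat : ZMod (𝓖.N κ)) = d) && decide (o.2 ≤ t)) true := by
    intro P t
    simp only [← Prog.runPlain_eq_den]
    rfl
  rw [h1, ← ex_const (randUnit (𝓖.N κ)) (𝓖.N κ : ℝ≥0∞)⁻¹]
  refine ex_mono _ fun d => ?_
  simp only [Prog.den_seq, Prog.den_fst, Prog.den_snd, Prog.den_rand, PMF.pure_bind, ex_map,
    Val.fst_pair, Val.snd_pair, GroupFamily.params, ex_coin]
  rw [← ex_uniform_ind_eq (𝓖.N κ) d]
  refine ex_mono _ fun z => ind_le fun hz => ?_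
  obtain ⟨h2, h3, h4⟩ := hs κ
  have h5 := h4 (𝓖.G κ)
  have h6 := h4 (𝓖.smul κ d (𝓖.G κ))
  have h7 := Nat.size_le_size (ZMod.val_lt z).le
  rw [PMF.pure_apply, if_pos]
  simp only [GroupFamily.context, Val.size_pair, Val.size_num] at h2
  rw [eq_comm, Bool.and_eq_true, decide_eq_true_iff, decide_eq_true_iff]
  refine ⟨by rw [Val.toNat_num, ZMod.natCast_zmod_val, hz], ?_⟩
  simp only [stepCost, Val.size_pair, Val.size_num, Polynomial.eval_add, Polynomial.eval_mul,
    Polynomial.eval_ofNat]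
  omega

end Collision

/-! ## Negligible functions -/

namespace Negligible

variable {f g : ℕ → ℝ}

theorem add (hf : Negligible f) (hg : Negligible g) : Negligible fun κ => f κ + g κ :=
  Asymptotics.SuperpolynomialDecay.add hf hg

theorem const_mul (hf : Negligible f) (c : ℝ) : Negligible fun κ => c * f κ :=
  Asymptotics.SuperpolynomialDecay.const_mul hf c

theorem eval_mul (hf : Negligible f) (p : ℕ[X]) : Negligible fun κ => ((p.eval κ : ℕ) : ℝ) * f κ := by
  have h := Asymptotics.SuperpolynomialDecay.polynomial_mul hf (p.map (Nat.castRingHom ℝ))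
  refine Asymptotics.SuperpolynomialDecay.congr h fun κ => ?_
  rw [Polynomial.eval_natCast_map]
  rfl

/-- Decay of order `n` of the square root is decay of order `2 * n` of `f`. -/
theorem sqrt (hf : Negligible f) : Negligible fun κ => √(f κ) := by
  intro n
  have h := (Real.continuous_sqrt.tendsto 0).comp (hf (2 * n))
  rw [Real.sqrt_zero] at h
  refine h.congr fun κ => ?_
  simp only [Function.comp]
  rw [Real.sqrt_mul (by positivity), pow_mul', Real.sqrt_sq (by positivity)]

theorem of_le (hg : Negligible g) (hf : ∀ κ, 0 ≤ f κ) (h : ∀ κ, f κ ≤ g κ) : Negligible f :=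
  Asymptotics.SuperpolynomialDecay.trans_abs_le hg fun κ => by
    rw [abs_of_nonneg (hf κ)]
    exact (h κ).trans (le_abs_self _)

end Negligible

theorem le_ofReal_sqrt {x y : ℝ≥0∞} {b : ℝ} (h : x ^ 2 ≤ y) (hy : y ≤ ENNReal.ofReal b) :
    x ≤ ENNReal.ofReal √b := by
  by_contra! hlt
  have h1 := ENNReal.pow_lt_pow_left two_ne_zero hlt
  refine absurd (h.trans hy) (not_le.2 (lt_of_le_of_lt ?_ h1))
  rw [← ENNReal.ofReal_pow (Real.sqrt_nonneg b)]
  rcases le_total 0 b with hb | hb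
  · rw [Real.sq_sqrt hb]
  · rw [ENNReal.ofReal_of_nonpos hb]
    exact zero_le

theorem apply_eq_ofReal {α : Type*} (μ : PMF α) (a : α) : μ a = ENNReal.ofReal (μ a).toReal :=
  (ENNReal.ofReal_toReal (μ.apply_ne_top a)).symm

theorem inv_sub_one_le {N : ℕ} (hN : 2 ≤ N) : ((N - 1 : ℕ) : ℝ≥0∞)⁻¹ ≤ 2 * (N : ℝ≥0∞)⁻¹ := by
  have h : (N : ℝ≥0∞) ≤ 2 * ((N - 1 : ℕ) : ℝ≥0∞) := by exact_mod_cast (by omega)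
  calc ((N - 1 : ℕ) : ℝ≥0∞)⁻¹ = 2 * (2 * ((N - 1 : ℕ) : ℝ≥0∞))⁻¹ := by
        rw [ENNReal.mul_inv (by simp) (by simp), ← mul_assoc,
          ENNReal.mul_inv_cancel two_ne_zero ENNReal.ofNat_ne_top, one_mul]
    _ ≤ _ := by gcongr

/-- Security of the scheme. -/
theorem euCMASecure_bpvSchnorr (𝓖 : GroupFamily) (B : BPVParams) (ID : ℕ → List Bool)
    (hID : EfficientlyComputable (fun κ : ℕ => κ) Val.num (fun κ => Val.ofBits (ID κ)))
    (hDL : DLHard 𝓖) (hAHSS : AHSSHard 𝓖 B) :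
    EUCMASecure (fun κ => bpvSchnorr 𝓖 B (ID κ) κ) (schnorrPub 𝓖 B) := by
  intro A p
  obtain ⟨P, q, hP⟩ := exists_attack (𝓖 := 𝓖) B p A hID
  obtain ⟨P₂, q₂, hP₂⟩ := exists_collision_attack (𝓖 := 𝓖) B p
  obtain ⟨P₃, q₃, hP₃⟩ := exists_guess 𝓖
  set a : ℕ → ℝ := fun κ => (ahssExpt 𝓖 B κ P (q.eval κ) true).toReal with ha
  set c : ℕ → ℝ := fun κ => (ahssExpt 𝓖 B κ P₂ (q₂.eval κ) true).toReal with hc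
  set g : ℕ → ℝ := fun κ => (dlExpt 𝓖 κ P₃ (q₃.eval κ) true).toReal with hg
  have ha' : Negligible a := hAHSS P q
  have hc' : Negligible c := hAHSS P₂ q₂
  have hg' : Negligible g := hDL P₃ q₃
  -- The summands correspond to those of `euCMA_le`: forgeries through hash queries, forgeries
  -- through the entry of key generation, a verification query not asked before, nonces whose
  -- commitments are already in the table, and the change of the key, where `1 / (N - 1) ≤ 2 / N`.
  have hneg : Negligible fun κ => ((p.eval κ : ℕ) : ℝ) * √(((p + 1).eval κ : ℕ) * a κ + g κ) +
      (√(((p + 1).eval κ : ℕ) * a κ) + g κ) + g κ +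
      ((p.eval κ : ℕ) : ℝ) * (((p.eval κ : ℕ) : ℝ) * √(2 * c κ)) + 2 * g κ :=
    ((((((ha'.eval_mul (p + 1)).add hg').sqrt.eval_mul p).add
      ((ha'.eval_mul (p + 1)).sqrt.add hg')).add hg').add
      (((hc'.const_mul 2).sqrt.eval_mul p).eval_mul p)).add (hg'.const_mul 2)
  refine hneg.of_le (fun κ => ENNReal.toReal_nonneg) fun κ => ?_
  have hap : 0 ≤ a κ := ENNReal.toReal_nonneg
  have hcp : 0 ≤ c κ := ENNReal.toReal_nonneg
  have hgp : 0 ≤ g κ := ENNReal.toReal_nonneg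
  refine ENNReal.toReal_le_of_le_ofReal (by positivity) ?_
  -- The reductions are available only where `(v, k)` can be read in time `p`; elsewhere the
  -- advantage is zero.
  rcases lt_or_ge (p.eval κ) (B.toVal κ).size with hlt | hle
  · rw [euCMA_eq_zero A hlt]
    exact zero_le
  have hae : ahssExpt 𝓖 B κ P (q.eval κ) true = ENNReal.ofReal (a κ) := apply_eq_ofReal _ _
  have hce : ahssExpt 𝓖 B κ P₂ (q₂.eval κ) true = ENNReal.ofReal (c κ) := apply_eq_ofReal _ _
  have hge : (𝓖.N κ : ℝ≥0∞)⁻¹ ≤ ENNReal.ofReal (g κ) :=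
    (hP₃ κ).trans_eq (apply_eq_ofReal _ _)
  have hA := hP κ hle
  rw [hae] at hA
  have ht : (((p.eval κ + 1 : ℕ) : ℝ≥0∞)) * ENNReal.ofReal (a κ) =
      ENNReal.ofReal (((p + 1).eval κ : ℕ) * a κ) := by
    rw [ENNReal.ofReal_mul (by positivity), ENNReal.ofReal_natCast]
    simp
  have h1 : ∀ i ∈ Finset.range (p.eval κ), exSim 𝓖 B (ID κ) κ A (fun x _ _ q =>
      ind (∃ e, ForgesAt 𝓖 κ (𝓖.smul κ x (𝓖.G κ)) (p.eval κ) q e ∧ e.2 = some i)) ≤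
        ENNReal.ofReal √(((p + 1).eval κ : ℕ) * a κ + g κ) := fun i hi =>
    le_ofReal_sqrt (sq_exSim_forgesAt_le A (Finset.mem_range.1 hi) hA) (by
      rw [ENNReal.ofReal_add (by positivity) hgp, ← ht]
      gcongr)
  obtain ⟨ε, hε, h2⟩ := exSim_forgesSelf_le A hA
  have hε' := le_ofReal_sqrt hε ht.le
  have h3 := le_ofReal_sqrt (hP₂ κ hle) (b := 2 * c κ) (by
    rw [hce, ENNReal.ofReal_mul two_pos.le, ENNReal.ofReal_ofNat])
  have h4 := inv_sub_one_le (𝓖.prime κ).out.two_le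
  rw [ENNReal.ofReal_add (by positivity) (by positivity),
    ENNReal.ofReal_add (by positivity) (by positivity),
    ENNReal.ofReal_add (by positivity) (by positivity),
    ENNReal.ofReal_add (by positivity) (by positivity),
    ENNReal.ofReal_add (by positivity) (by positivity),
    ENNReal.ofReal_mul (by positivity), ENNReal.ofReal_mul (by positivity),
    ENNReal.ofReal_mul (by positivity), ENNReal.ofReal_mul two_pos.le, ENNReal.ofReal_ofNat,
    ENNReal.ofReal_natCast]
  refine (euCMA_le A).trans ?_
  gcongr
  · exact (Finset.sum_le_card_nsmul _ _ _ h1).trans_eq (by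
      rw [Finset.card_range, nsmul_eq_mul])
  · exact h2.trans (by gcongr)
  · exact h4.trans (by gcongr)

end BPVSchnorr

theorem theorem2 (𝓖 : BPVSchnorr.GroupFamily) (B : BPVSchnorr.BPVParams)
    (ID : ℕ → List Bool)
    (hID : BPVSchnorr.EfficientlyComputable (fun κ : ℕ => κ) BPVSchnorr.Val.num
      (fun κ => BPVSchnorr.Val.ofBits (ID κ)))
    (hDL : BPVSchnorr.DLHard 𝓖) (hAHSS : BPVSchnorr.AHSSHard 𝓖 B) :
    BPVSchnorr.EUCMASecure (fun κ => BPVSchnorr.bpvSchnorr 𝓖 B (ID κ) κ)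
      (BPVSchnorr.schnorrPub 𝓖 B) := by
  exact BPVSchnorr.euCMASecure_bpvSchnorr 𝓖 B ID hID hDL hAHSS
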